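/- Let $M$ be a closed oriented surface of genus $2$, concretely $$M=\{(x,y,z)\in\mathbb R^3 : z^2=(9-x^2-y^2)\,((x+\tfrac32)^2+y^2-\tfrac14)\,((x-\tfrac32)^2+y^2-\tfrac14)\},$$ with its boundary orientation (outward normal first), and let $\gamma_1,\dots,\gamma_5$ be the standard chain of simple closed curves on $M$: $\gamma_1,\gamma_3,\gamma_5$ are, from left to right, the three ovals of $M\cap\{y=0\}$, and $\gamma_2$, $\gamma_4$ are the circles of radius $\tfrac12$ about $(-\tfrac32,0)$ and $(\tfrac32,0)$ in the plane $z=0$. Let $\mathrm{Map}_2=\mathrm{Diff}^+(M)/\mathrm{Diff}^0(M)$ be the mapping class group (orientation preserving diffeomorphisms modulo those isotopic to the identity), let $t_{\gamma_i}\in\mathrm{Map}_2$ be the class of a (left-handed) Dehn twist about $\gamma_i$, and let $$\Gamma(2\mid -)=\langle \alpha_1,\beta_1,\alpha_2,\beta_2 \mid [\alpha_1,\beta_1][\alpha_2,\beta_2]=1\rangle,\qquad [a,b]=aba^{-1}b^{-1}.$$ Put $x=\beta_2^{-1}\alpha_1\beta_1\alpha_1^{-1}\in\Gamma(2\mid-)$.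 Then $x=\alpha_2\beta_2^{-1}\alpha_2^{-1}\beta_1$, and for every base point $p\in M$ there is an isomorphism $\Gamma(2\mid-)\cong\pi_1(M,p)$ such that the homomorphism $\mathrm{Map}_2\to\mathrm{Out}(\Gamma(2\mid-))$ given by the action of diffeomorphisms on $\pi_1(M,p)$ (which is well defined up to inner automorphisms) maps $t_{\gamma_1},\dots,t_{\gamma_5}$ to the classes, modulo inner automorphisms, of the following automorphisms: - $t_{\gamma_1}$: $\alpha_1\mapsto\alpha_1\beta_1^{-1}$, and $\beta_1,\alpha_2,\beta_2$ are fixed; - $t_{\gamma_2}$: $\beta_1\mapsto\beta_1\alpha_1$, and $\alpha_1,\alpha_2,\beta_2$ are fixed; - $t_{\gamma_3}$: $\alpha_1\mapsto\alpha_1x^{-1}$, $\beta_1\mapsto x\beta_1x^{-1}$, $\alpha_2\mapsto x\alpha_2$, and $\beta_2$ is fixed; - $t_{\gamma_4}$: $\beta_2\mapsto\beta_2\alpha_2$, and $\alpha_1,\beta_1,\alpha_2$ are fixed; - $t_{\gamma_5}$: $\alpha_2\mapsto\alpha_2\beta_2^{-1}$, and $\alpha_1,\beta_1,\beta_2$ are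 fixed. Consequently, let $G$ be a finite group and $(a_1,b_1,a_2,b_2)$ a generating vector of $G$ of type $(2\mid-)$, that is, $a_1,b_1,a_2,b_2$ generate $G$ and $[a_1,b_1][a_2,b_2]=1$, and let $\theta:\Gamma(2\mid-)\to G$ be the epimorphism that maps $(\alpha_1,\beta_1,\alpha_2,\beta_2)$ to it. For each $i$ and each automorphism $\varphi$ of $\Gamma(2\mid-)$ in the outer class of $t_{\gamma_i}$, the vector $(\theta\varphi(\alpha_1),\theta\varphi(\beta_1),\theta\varphi(\alpha_2),\theta\varphi(\beta_2))$ is, up to simultaneous conjugation by an element of $G$, obtained from $(a_1,b_1,a_2,b_2)$ by the $i$-th substitution above, with $a_j,b_j$ in place of $\alpha_j,\beta_j$. -/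

import Mathlib

open Set Topology
open scoped ContDiff commutatorElement unitInterval

noncomputable section

/-! ### Orbifold surface groups, generating vectors, outer automorphisms -/

/-- The generators `α k, β k` (`k < g`) and `γ j` (`j < r`). -/
inductive OrbifoldGen (g r : ℕ) : Type
  | a (k : Fin g) : OrbifoldGen g r
  | b (k : Fin g) : OrbifoldGen g r
  | c (j : Fin r) : OrbifoldGen g r

/-- The relators `∏ [α k, β k] · ∏ γ j` and `γ j ^ m j`. -/
def orbifoldRelators (g : ℕ) {r : ℕ} (m : Fin r → ℕ) : Set (FreeGroup (OrbifoldGen g r)) :=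
  insert
    ((List.ofFn fun k : Fin g =>
        ⁅FreeGroup.of (OrbifoldGen.a (r := r) k), FreeGroup.of (OrbifoldGen.b k)⁆).prod *
      (List.ofFn fun j : Fin r => FreeGroup.of (OrbifoldGen.c (g := g) j)).prod)
    (Set.range fun j : Fin r => FreeGroup.of (OrbifoldGen.c (g := g) j) ^ m j)

/-- The orbifold surface group `Γ(g | m 0, …, m (r-1))`. -/
abbrev OrbifoldSurfaceGroup (g : ℕ) {r : ℕ} (m : Fin r → ℕ) : Type :=
  PresentedGroup (orbifoldRelators g m)

/-- `(a, b, c)` is an (ordered) generating vector of type `(g | m)` of the group `G`. -/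
structure IsGeneratingVector {G : Type*} [Group G] {g r : ℕ} (m : Fin r → ℕ)
    (a b : Fin g → G) (c : Fin r → G) : Prop where
  generates : Subgroup.closure (Set.range a ∪ Set.range b ∪ Set.range c) = ⊤
  order : ∀ j, orderOf (c j) = m j
  relation : (List.ofFn fun k => ⁅a k, b k⁆).prod * (List.ofFn c).prod = 1

/-- `Γ(2 | -)`, the surface group of genus two. -/
abbrev Gamma2 : Type := OrbifoldSurfaceGroup 2 ![]

/-- The generators `(α₁, β₁, α₂, β₂)` of `Γ(2 | -)`. -/
def gamma2Gen : Fin 4 → Gamma2 :=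
  ![PresentedGroup.of (.a 0), PresentedGroup.of (.b 0),
    PresentedGroup.of (.a 1), PresentedGroup.of (.b 1)]

/-- The element `x = β₂⁻¹ α₁ β₁ α₁⁻¹` attached to a quadruple `(α₁, β₁, α₂, β₂)`. -/
def twistElt {G : Type*} [Group G] (V : Fin 4 → G) : G := (V 3)⁻¹ * V 0 * V 1 * (V 0)⁻¹

/-- The five substitutions of a quadruple `(α₁, β₁, α₂, β₂)`. The indices `0, …, 4` stand for the
curves `γ₁, …, γ₅`. -/
def twistMove {G : Type*} [Group G] (V : Fin 4 → G) : Fin 5 → (Fin 4 → G)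
  | 0 => ![V 0 * (V 1)⁻¹, V 1, V 2, V 3]
  | 1 => ![V 0, V 1 * V 0, V 2, V 3]
  | 2 => ![V 0 * (twistElt V)⁻¹, twistElt V * V 1 * (twistElt V)⁻¹, twistElt V * V 2, V 3]
  | 3 => ![V 0, V 1, V 2, V 3 * V 2]
  | 4 => ![V 0, V 1, V 2 * (V 3)⁻¹, V 3]

instance innNormal (G : Type*) [Group G] : (MulAut.conj (G := G)).range.Normal := by
  constructor
  rintro _ ⟨x, rfl⟩ φ
  refine ⟨φ x, ?_⟩
  ext y
  simp [MulAut.mul_apply]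

/-- `Out(G) = Aut(G) / Inn(G)`. -/
abbrev OutAut (G : Type*) [Group G] : Type _ := MulAut G ⧸ (MulAut.conj (G := G)).range

/-! ### The closed surface of genus two in 3-space -/

/-- Euclidean 3-space (as a smooth space; no metric is used). -/
abbrev R3 : Type := Fin 3 → ℝ

/-- The polynomial `z² - (9 - x² - y²) ((x + 3/2)² + y² - 1/4) ((x - 3/2)² + y² - 1/4)`. The second
term is positive exactly inside the circle of radius 3 and outside the two circles of radius `1/2`
about `(±3/2, 0)`, that is, on the interior of a disc with two holes. -/
def surfFun (p : R3) : ℝ :=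
  p 2 ^ 2 - (9 - p 0 ^ 2 - p 1 ^ 2) * ((p 0 + 3 / 2) ^ 2 + p 1 ^ 2 - 1 / 4) *
    ((p 0 - 3 / 2) ^ 2 + p 1 ^ 2 - 1 / 4)

/-- The zero set of `surfFun`: the double of a disc with two holes, a closed surface of genus two
embedded in 3-space (it is the boundary of the handlebody `surfFun ≤ 0`). -/
def surfSet : Set R3 := {p | surfFun p = 0}

/-- The closed surface `M` of genus two. -/
abbrev Surf : Type := surfSet

/-- The outward normal direction of `M`, the gradient of `surfFun`. -/
def surfNormal (p : R3) : R3 := fun i => fderiv ℝ surfFun p (Pi.single i 1)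

/-- The orientation of `M` as the boundary of `surfFun ≤ 0`: `(u, v)` is a positive basis of the
tangent plane at `p` iff `(normal, u, v)` is a positive basis of 3-space. -/
def surfOrient (p u v : R3) : ℝ := (Matrix.of ![surfNormal p, u, v]).det

/-- `f : M → M` is smooth and preserves the orientation: near every point it is the restriction of a
smooth map `H` of an open set of 3-space, whose derivative takes positive bases of the tangent plane
to positive bases (the tangent cone of a smooth submanifold is its tangent space). -/
def IsSmoothOriented (f : Surf → Surf) : Prop :=
  ∀ p : Surf, ∃ (U : Set R3) (H : R3 → R3), IsOpen U ∧ (p : R3) ∈ U ∧ ContDiffOn ℝ ∞ H U ∧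
    (∀ q : Surf, (q : R3) ∈ U → H q = f q) ∧
    ∀ u ∈ tangentConeAt ℝ surfSet (p : R3), ∀ v ∈ tangentConeAt ℝ surfSet (p : R3),
      0 < surfOrient p u v → 0 < surfOrient (f p) (fderiv ℝ H p u) (fderiv ℝ H p v)

lemma IsSmoothOriented.id : IsSmoothOriented (fun p => p) := fun p =>
  ⟨univ, fun q => q, isOpen_univ, mem_univ _, contDiff_id.contDiffOn, fun _ _ => rfl, by
    intro u _ v _ h
    have : fderiv ℝ (fun q : R3 => q) (p : R3) = ContinuousLinearMap.id ℝ R3 := fderiv_id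
    simpa [this] using h⟩

lemma IsSmoothOriented.comp {f g : Surf → Surf} (hg : IsSmoothOriented g)
    (hf : IsSmoothOriented f) : IsSmoothOriented (fun p => g (f p)) := by
  intro p
  obtain ⟨U, H, hU, hpU, hH, hHf, hHo⟩ := hf p
  obtain ⟨V, K, hV, hpV, hK, hKg, hKo⟩ := hg (f p)
  have hHp : H p = f p := hHf p hpU
  have hdH : DifferentiableAt ℝ H p :=
    ((hH.contDiffAt (hU.mem_nhds hpU)).differentiableAt (by simp))
  have hdK : DifferentiableAt ℝ K (H p) := by
    rw [hHp]
    exact ((hK.contDiffAt (hV.mem_nhds hpV)).differentiableAt (by simp))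
  refine ⟨U ∩ H ⁻¹' V, K ∘ H, hH.continuousOn.isOpen_inter_preimage hU hV,
    ⟨hpU, by simpa [hHp] using hpV⟩,
    hK.comp (hH.mono inter_subset_left) (fun q hq => hq.2), ?_, ?_⟩
  · rintro q ⟨hq, hq'⟩
    have h1 := hHf q hq
    have h2 : (f q : R3) ∈ V := by rw [← h1]; exact hq'
    simp [h1, hKg _ h2]
  · have tan : ∀ u ∈ tangentConeAt ℝ surfSet (p : R3),
        fderiv ℝ H p u ∈ tangentConeAt ℝ surfSet (f p : R3) := by
      intro u hu
      have hu' : u ∈ tangentConeAt ℝ (surfSet ∩ U) (p : R3) := by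
        rwa [tangentConeAt_inter_nhds (hU.mem_nhds hpU)]
      have := (hdH.hasFDerivAt.hasFDerivWithinAt (s := surfSet ∩ U)).mapsTo_tangent_cone hu'
      rw [hHp] at this
      refine tangentConeAt_mono ?_ this
      rintro _ ⟨q, ⟨hq, hqU⟩, rfl⟩
      rw [hHf ⟨q, hq⟩ hqU]
      exact (f ⟨q, hq⟩).2
    intro u hu v hv h
    have := hKo _ (tan u hu) _ (tan v hv) (hHo u hu v hv h)
    rw [fderiv_comp _ hdK hdH, hHp]
    exact this

/-- `Diff⁺(M)`: the group of orientation preserving diffeomorphisms of `M`. -/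
def DiffPlus : Subgroup (Surf ≃ₜ Surf) where
  carrier := {h | IsSmoothOriented h ∧ IsSmoothOriented h.symm}
  mul_mem' hg hh := ⟨hg.1.comp hh.1, hh.2.comp hg.2⟩
  one_mem' := ⟨IsSmoothOriented.id, IsSmoothOriented.id⟩
  inv_mem' hh := ⟨hh.2, hh.1⟩

/-- A family of maps `Φ t : M → M`, `t ∈ [0, 1]`, is smooth in `(t, p)` jointly: it is locally the
restriction of smooth maps of open subsets of `ℝ × R3`. -/
def IsSmoothFamily (Φ : I → Surf → Surf) : Prop :=
  ∀ (t₀ : I) (p : Surf), ∃ (U : Set (ℝ × R3)) (H : ℝ × R3 → R3), IsOpen U ∧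
    ((t₀ : ℝ), (p : R3)) ∈ U ∧ ContDiffOn ℝ ∞ H U ∧
    ∀ (t : I) (q : Surf), ((t : ℝ), (q : R3)) ∈ U → H ((t : ℝ), (q : R3)) = Φ t q

lemma IsSmoothFamily.const {f : Surf → Surf} (hf : IsSmoothOriented f) :
    IsSmoothFamily (fun _ => f) := by
  intro t p
  obtain ⟨U, H, hU, hpU, hH, hHf, -⟩ := hf p
  exact ⟨Prod.snd ⁻¹' U, H ∘ Prod.snd, hU.preimage continuous_snd, hpU,
    hH.comp contDiff_snd.contDiffOn (fun q hq => hq), fun _ q hq => hHf q hq⟩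

lemma IsSmoothFamily.comp {Φ Ψ : I → Surf → Surf} (hΦ : IsSmoothFamily Φ)
    (hΨ : IsSmoothFamily Ψ) : IsSmoothFamily (fun t p => Φ t (Ψ t p)) := by
  intro t p
  obtain ⟨U, H, hU, hpU, hH, hHf⟩ := hΨ t p
  obtain ⟨V, K, hV, hpV, hK, hKg⟩ := hΦ t (Ψ t p)
  have hc : ContDiffOn ℝ ∞ (fun q : ℝ × R3 => (q.1, H q)) U := contDiff_fst.contDiffOn.prodMk hH
  refine ⟨U ∩ (fun q : ℝ × R3 => (q.1, H q)) ⁻¹' V, fun q => K (q.1, H q),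
    hc.continuousOn.isOpen_inter_preimage hU hV, ⟨hpU, ?_⟩,
    hK.comp (hc.mono inter_subset_left) (fun q hq => hq.2), ?_⟩
  · simpa [hHf t p hpU] using hpV
  · rintro s q ⟨hq, hq'⟩
    have h1 := hHf s q hq
    have h2 : ((s : ℝ), (Ψ s q : R3)) ∈ V := by rw [← h1]; exact hq'
    simp only [h1, hKg _ _ h2]

/-- `Diff⁰(M)`: the diffeomorphisms that are isotopic to the identity, through a smooth path of
diffeomorphisms (together with the path of inverses). -/
def DiffZero : Subgroup DiffPlus where
  carrier := {h | ∃ Φ : I → DiffPlus, Φ 0 = 1 ∧ Φ 1 = h ∧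
    IsSmoothFamily (fun t => ((Φ t : Surf ≃ₜ Surf) : Surf → Surf)) ∧
    IsSmoothFamily (fun t => (((Φ t)⁻¹ : Surf ≃ₜ Surf) : Surf → Surf))}
  mul_mem' := by
    rintro g h ⟨Φ, h0, h1, hs, hi⟩ ⟨Ψ, h0', h1', hs', hi'⟩
    exact ⟨fun t => Φ t * Ψ t, by simp [h0, h0'], by simp [h1, h1'], hs.comp hs', by
      have := hi'.comp hi
      simp only [mul_inv_rev, Subgroup.coe_mul]
      exact this⟩
  one_mem' := ⟨fun _ => 1, rfl, rfl, IsSmoothFamily.const (1 : DiffPlus).2.1,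
    IsSmoothFamily.const (1 : DiffPlus).2.2⟩
  inv_mem' := by
    rintro h ⟨Φ, h0, h1, hs, hi⟩
    exact ⟨fun t => (Φ t)⁻¹, by simp [h0], by simp [h1], hi, by simpa using hs⟩

instance diffZeroNormal : DiffZero.Normal := by
  constructor
  rintro h ⟨Φ, h0, h1, hs, hi⟩ g
  refine ⟨fun t => g * Φ t * g⁻¹, by simp [h0], by simp [h1], ?_, ?_⟩
  · exact ((IsSmoothFamily.const g.2.1).comp hs).comp (IsSmoothFamily.const g.2.2)
  · have := ((IsSmoothFamily.const g.2.1).comp hi).comp (IsSmoothFamily.const g.2.2)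
    simp only [mul_inv_rev, inv_inv, Subgroup.coe_mul, InvMemClass.coe_inv]
    exact this

/-- The mapping class group `Map₂ = Diff⁺(M) / Diff⁰(M)`. -/
abbrev Map2 : Type := DiffPlus ⧸ DiffZero

/-- Under the identification `e` of `Γ` with `π₁(M, p)`, the automorphism `φ` of `Γ` is the one which
`h` induces with the help of some path `δ` from `p` to `h p`, that is, `h_*` followed by the change
of base point along `δ`. -/
def Induces {Γ : Type*} [Group Γ] {p : Surf} (e : Γ ≃* FundamentalGroup Surf p)
    (h : Surf ≃ₜ Surf) (φ : MulAut Γ) : Prop :=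
  ∃ δ : Path p (h p), ∀ w : Γ,
    FundamentalGroup.fundamentalGroupMulEquivOfPath δ (e (φ w)) =
      FundamentalGroup.map (h : C(Surf, Surf)) p (e w)

/-! ### The five curves and their Dehn twists -/

/-- The chain of simple closed curves `γ₁, …, γ₅`: the three ovals in which the plane `y = 0` meets
`M` are `γ₁`, `γ₃`, `γ₅` (from left to right), and the boundary circles of the two holes in the plane
`z = 0` are `γ₂` (left) and `γ₄` (right). Consecutive curves meet in exactly one point, the other
pairs are disjoint. -/
def chainCurve : Fin 5 → Set Surf
  | 0 => {p | p.1 1 = 0 ∧ p.1 0 ≤ -2}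
  | 1 => {p | p.1 2 = 0 ∧ (p.1 0 + 3 / 2) ^ 2 + p.1 1 ^ 2 = 1 / 4}
  | 2 => {p | p.1 1 = 0 ∧ -1 ≤ p.1 0 ∧ p.1 0 ≤ 1}
  | 3 => {p | p.1 2 = 0 ∧ (p.1 0 - 3 / 2) ^ 2 + p.1 1 ^ 2 = 1 / 4}
  | 4 => {p | p.1 1 = 0 ∧ 2 ≤ p.1 0}

/-- An annular neighbourhood of the curve `C`: a smooth embedding of `ℝ/ℤ × (-1, 1)` into `M` with
core curve `C`, written as a map of `(θ, s)` which is periodic in `θ` and used for `|s| < 1`. The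
orientation is such that `(∂/∂s, ∂/∂θ)` is a positive basis, as for the polar coordinates
(radius, angle) in the oriented plane. -/
structure IsAnnulus (φ : ℝ → ℝ → Surf) (C : Set Surf) : Prop where
  smooth : ContDiffOn ℝ ∞ (fun q : ℝ × ℝ => (φ q.1 q.2 : R3)) (univ ×ˢ Ioo (-1) 1)
  inj : ∀ θ θ' : ℝ, ∀ s ∈ Ioo (-1 : ℝ) 1, ∀ s' ∈ Ioo (-1 : ℝ) 1,
    φ θ s = φ θ' s' ↔ s = s' ∧ ∃ n : ℤ, θ' = θ + n
  oriented : ∀ θ : ℝ, ∀ s ∈ Ioo (-1 : ℝ) 1,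
    0 < surfOrient (φ θ s) (deriv (fun b => (φ θ b : R3)) s) (deriv (fun a => (φ a s : R3)) θ)
  core : Set.range (fun θ => φ θ 0) = C

/-- `t` is a (left-handed) Dehn twist about the simple closed curve `C`: for some annular
neighbourhood of `C` it is `(θ, s) ↦ (θ + f s, s)` in the annulus, where the smooth function `f` is
`0` for `s ≤ -1/2` and `1` for `s ≥ 1/2`, and it is the identity outside of the annulus. -/
def IsDehnTwist (t : Surf ≃ₜ Surf) (C : Set Surf) : Prop :=
  ∃ (φ : ℝ → ℝ → Surf) (f : ℝ → ℝ), IsAnnulus φ C ∧ ContDiff ℝ ∞ f ∧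
    (∀ s ≤ -(1 / 2 : ℝ), f s = 0) ∧ (∀ s ≥ (1 / 2 : ℝ), f s = 1) ∧
    (∀ θ : ℝ, ∀ s ∈ Ioo (-1 : ℝ) 1, t (φ θ s) = φ (θ + f s) s) ∧
    ∀ p : Surf, (∀ θ : ℝ, ∀ s ∈ Ioo (-1 : ℝ) 1, p ≠ φ θ s) → t p = p

end

/-!
The surface `M` is cut by the planes `y = 0` and `z = 0` into four faces, given by the signs of `y`
and `z`. A face is a half disc with two notches, hence contractible (`exists_face_contraction`). The
edges lie on three ovals in `y = 0` and three circles in `z = 0`, and the six vertices are the points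
`(x, 0, 0)` with `x = -3, -2, -1, 1, 2, 3`, all of which belong to all faces. The `i`-th curve of the
chain is the union of the two edges between consecutive vertices.

**The fundamental group.** For a vertex `i` and a face `f` let `P i f` be the class of the loop that
goes from the leftmost vertex to `i` in `f` and returns in the front face `y, z ≥ 0`. For two vertices
on an oval or a circle the quotient of the labels is the same in two faces that meet there. Such a
labelling (`IsLabelling`) in any group is determined by four labels with one relation, which becomes
the surface relation for the quadruple `IsLabelling.quad`. This gives the homomorphism `gamma2ToPi`
from the surface group to `π₁`.
* It is injective (`gamma2ToPi_injective`): the surface group has the labelling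
  `exists_gamma2_labelling` by its own elements, which is a cocycle and so glues a covering of `M`
  (`IsLabelling.bundle`); there the image of `w` acts on a fibre as the left multiplication by `w`.
* It is surjective (`gamma2ToPi_surjective`): explicit annuli around the ovals and circles
  (`exists_isAnnulus_ovalSet`, `exists_isAnnulus_circSet`) show that every path is homotopic to a
  composite of paths in faces (`faceGen_of_pathClass`).

The same annuli give the existence of Dehn twists (`exists_isDehnTwist_chainCurve`). That twists of
an annulus are diffeomorphisms, and continuous in the twisting function, comes from the inverse
function theorem (`IsAnnulus.exists_chart`).

**The action of a twist.** An arbitrary annulus around the `i`-th curve can be turned around so that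
its positive side is on the positive side of the plane of the curve; the orientation of `M` then fixes
the direction in which the core runs (`IsDehnTwist.exists_isSided`). The twist is isotopic to one
supported on the positive side, which is the identity on the faces on the negative side, and further
to one supported on the negative side, which is the identity on the faces on the positive side. The
latter isotopy moves a vertex on the curve once along the curve (`pathClass_track_core`) and fixes the
others. So the change of the labels is known (`IsSided.exists_pushHom_quad`), and
`IsLabelling.quad_twist` turns it into the substitution, up to conjugation.

**The mapping class group.** Any diffeomorphism with a path from the base point to its image induces
an automorphism; another path changes it by an inner one, and the track of the base point shows that
isotopies to the identity induce the trivial outer class (`exists_map2_hom`). The assertion on finite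
groups follows by applying the epimorphism to the formulas (`map_twistMove`).
-/

noncomputable section

open CategoryTheory

/-! ### Classes of paths in the fundamental groupoid -/


section PathClasses

variable {X Y : Type*} [TopologicalSpace X] [TopologicalSpace Y]

/-- The class of a path, as a morphism of the fundamental groupoid. -/
def pathClass {a b : X} (γ : Path a b) :
    FundamentalGroupoid.mk a ⟶ FundamentalGroupoid.mk b :=
  Path.Homotopic.Quotient.mk γ

lemma pathClass_trans {a b c : X} (γ : Path a b) (δ : Path b c) :
    pathClass (γ.trans δ) = pathClass γ ≫ pathClass δ := rfl

lemma pathClass_symm {a b : X} (γ : Path a b) :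
    pathClass γ.symm = Groupoid.inv (pathClass γ) := rfl

lemma pathClass_refl (a : X) : pathClass (Path.refl a) = 𝟙 (FundamentalGroupoid.mk a) := rfl

lemma pathClass_eq {a b : X} {γ δ : Path a b} (h : γ.Homotopic δ) : pathClass γ = pathClass δ :=
  Path.Homotopic.Quotient.eq.2 h

lemma exists_pathClass_eq {a b : X} (x : FundamentalGroupoid.mk a ⟶ FundamentalGroupoid.mk b) :
    ∃ γ : Path a b, pathClass γ = x :=
  Path.Homotopic.Quotient.mk_surjective x

/-- The class of the image in `X` of any path from `a` to `b` in a simply connected space `Y`. -/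
def simpClass [SimplyConnectedSpace Y] (f : C(Y, X)) (a b : Y) :
    FundamentalGroupoid.mk (f a) ⟶ FundamentalGroupoid.mk (f b) :=
  pathClass ((PathConnectedSpace.somePath a b).map f.continuous)

lemma pathClass_map_eq_simpClass [SimplyConnectedSpace Y] (f : C(Y, X)) {a b : Y} (γ : Path a b) :
    pathClass (γ.map f.continuous) = simpClass f a b :=
  pathClass_eq ((SimplyConnectedSpace.paths_homotopic _ _).map f)

@[simp] lemma simpClass_self [SimplyConnectedSpace Y] (f : C(Y, X)) (a : Y) :
    simpClass f a a = 𝟙 _ :=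
  (pathClass_map_eq_simpClass f (Path.refl a)).symm

lemma simpClass_comp [SimplyConnectedSpace Y] (f : C(Y, X)) (a b c : Y) :
    simpClass f a b ≫ simpClass f b c = simpClass f a c := by
  rw [simpClass, simpClass, ← pathClass_trans, ← Path.map_trans, pathClass_map_eq_simpClass]

/-- The boundary of a square in `X` is null-homotopic. -/
lemma pathClass_square {a b c d : X} (p : Path a b) (q : Path c d) (l : Path a c) (r : Path b d)
    (F : I × I → X) (hF : Continuous F) (h0 : ∀ t, F (t, 0) = p t) (h1 : ∀ t, F (t, 1) = q t)
    (hl : ∀ s, F (0, s) = l s) (hr : ∀ s, F (1, s) = r s) :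
    pathClass p ≫ pathClass r = pathClass l ≫ pathClass q := by
  obtain rfl : F (0, 0) = a := by rw [h0, p.source]
  obtain rfl : F (1, 0) = b := by rw [h0, p.target]
  obtain rfl : F (0, 1) = c := by rw [h1, q.source]
  obtain rfl : F (1, 1) = d := by rw [h1, q.target]
  have : ContractibleSpace I := (convex_Icc (0 : ℝ) 1).contractibleSpace ⟨0, by simp⟩
  let u : Path (0 : I) 1 := ⟨⟨fun t => t, continuous_id⟩, rfl, rfl⟩
  let f : C(I × I, X) := ⟨F, hF⟩
  have e0 : p = (u.prod (Path.refl 0)).map f.continuous := by ext t; exact (h0 t).symm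
  have e1 : q = (u.prod (Path.refl 1)).map f.continuous := by ext t; exact (h1 t).symm
  have e2 : l = ((Path.refl 0).prod u).map f.continuous := by ext t; exact (hl t).symm
  have e3 : r = ((Path.refl 1).prod u).map f.continuous := by ext t; exact (hr t).symm
  rw [e0, e1, e2, e3]
  refine pathClass_eq (γ := Path.trans _ _) (δ := Path.trans _ _) ?_
  rw [← Path.map_trans, ← Path.map_trans]
  exact (SimplyConnectedSpace.paths_homotopic _ _).map f

/-- Naturality of a homotopy with respect to a path. -/
lemma pathClass_homotopy (G : I × X → X) (hG : Continuous G) {a b a' b' a'' b'' : X}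
    (γ : Path a b) (p : Path a' b') (q : Path a'' b'') (l : Path a' a'') (r : Path b' b'')
    (h0 : ∀ t, G (0, γ t) = p t) (h1 : ∀ t, G (1, γ t) = q t)
    (hl : ∀ s, G (s, a) = l s) (hr : ∀ s, G (s, b) = r s) :
    pathClass p ≫ pathClass r = pathClass l ≫ pathClass q :=
  pathClass_square p q l r (fun x => G (x.2, γ x.1)) (by fun_prop) h0 h1
    (fun s => by simpa using hl s) (fun s => by simpa using hr s)

/-- A property of path classes that is stable under composition holds for all of them if it holds
for the paths that stay in one member of an open cover. -/
lemma pathClass_induction {ι : Type*} (U : ι → Set X) (hU : ∀ i, IsOpen (U i))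
    (hcov : ∀ x, ∃ i, x ∈ U i)
    (P : ∀ {a b : X}, (FundamentalGroupoid.mk a ⟶ FundamentalGroupoid.mk b) → Prop)
    (comp : ∀ {a b c : X} (x : FundamentalGroupoid.mk a ⟶ FundamentalGroupoid.mk b)
      (y : FundamentalGroupoid.mk b ⟶ FundamentalGroupoid.mk c), P x → P y → P (x ≫ y))
    (small : ∀ (i : ι) {a b : X} (γ : Path a b), (∀ t, γ t ∈ U i) → P (pathClass γ))
    {a b : X} (x : FundamentalGroupoid.mk a ⟶ FundamentalGroupoid.mk b) : P x := by
  obtain ⟨γ, rfl⟩ := exists_pathClass_eq x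
  obtain ⟨t, h0, mono, ⟨n, hn⟩, ht⟩ := exists_monotone_Icc_subset_open_cover_unitInterval
    (c := fun i => γ ⁻¹' U i) (fun i => (hU i).preimage γ.continuous)
    (fun s _ => by simpa using hcov (γ s))
  have piece : ∀ k, P (pathClass (γ.subpath (t k) (t (k + 1)))) := by
    intro k
    obtain ⟨i, hi⟩ := ht k
    refine small i _ fun s => ?_
    have : γ.subpath (t k) (t (k + 1)) s ∈ range (γ.subpath (t k) (t (k + 1))) := ⟨s, rfl⟩
    rw [Path.range_subpath_of_le _ _ _ (mono k.le_succ)] at this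
    obtain ⟨s', hs', e⟩ := this
    rw [← e]
    exact hi hs'
  have ind : ∀ k, P (pathClass (γ.subpath (t 0) (t (k + 1)))) := by
    intro k
    induction k with
    | zero => exact piece 0
    | succ k ih =>
      have := comp _ _ ih (piece (k + 1))
      rwa [← pathClass_trans, pathClass_eq ⟨Path.Homotopy.subpathTransSubpath γ _ _ _⟩] at this
  have key := ind n
  rw [hn (n + 1) n.le_succ, h0, Path.subpath_zero_one] at key
  have gen : ∀ {a' b' : X} (ha : a' = a) (hb : b' = b), P (pathClass (γ.cast ha hb)) →
      P (pathClass γ) := by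
    rintro _ _ rfl rfl h
    exact h
  exact gen _ _ key

/-- The image of a path class under a map `T` for which `T a = a'` and `T b = b'`. -/
def pushClass (T : C(X, Y)) {a b : X} {a' b' : Y} (ha : T a = a') (hb : T b = b')
    (x : FundamentalGroupoid.mk a ⟶ FundamentalGroupoid.mk b) :
    FundamentalGroupoid.mk a' ⟶ FundamentalGroupoid.mk b' :=
  (Path.Homotopic.Quotient.map x T).cast ha.symm hb.symm

lemma pushClass_pathClass (T : C(X, Y)) {a b : X} {a' b' : Y} (ha : T a = a') (hb : T b = b')
    (γ : Path a b) :
    pushClass T ha hb (pathClass γ) =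
      pathClass ((γ.map T.continuous).cast ha.symm hb.symm) := rfl

lemma pushClass_comp (T : C(X, Y)) {a b c : X} {a' b' c' : Y} (ha : T a = a') (hb : T b = b')
    (hc : T c = c') (x : FundamentalGroupoid.mk a ⟶ FundamentalGroupoid.mk b)
    (y : FundamentalGroupoid.mk b ⟶ FundamentalGroupoid.mk c) :
    pushClass T ha hc (x ≫ y) = pushClass T ha hb x ≫ pushClass T hb hc y := by
  subst ha hb hc
  simp only [pushClass, Path.Homotopic.Quotient.cast_rfl_rfl]
  exact (FundamentalGroupoid.map T).map_comp x y

lemma pushClass_id (T : C(X, Y)) {a : X} {a' : Y} (ha : T a = a') :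
    pushClass T ha ha (𝟙 (FundamentalGroupoid.mk a)) = 𝟙 _ := by
  subst ha
  rfl

lemma pushClass_inv (T : C(X, Y)) {a b : X} {a' b' : Y} (ha : T a = a') (hb : T b = b')
    (x : FundamentalGroupoid.mk a ⟶ FundamentalGroupoid.mk b) :
    pushClass T hb ha (Groupoid.inv x) = Groupoid.inv (pushClass T ha hb x) := by
  obtain ⟨γ, rfl⟩ := exists_pathClass_eq x
  rfl

end PathClasses

/-! ### The surface group and labellings of the vertices -/

lemma gamma2Gen_relation :
    ⁅gamma2Gen 0, gamma2Gen 1⁆ * ⁅gamma2Gen 2, gamma2Gen 3⁆ = 1 := by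
  have h := PresentedGroup.one_of_mem (rels := orbifoldRelators 2 ![]) (mem_insert _ _)
  simp only [List.ofFn_succ, List.ofFn_zero, List.prod_cons, List.prod_nil, mul_one,
    Fin.succ_zero_eq_one, map_mul, map_commutatorElement, Fin.isValue] at h
  exact h

/-- The two expressions for `x` agree as soon as the quadruple satisfies the surface relation. -/
lemma twistElt_eq {G : Type*} [Group G] {V : Fin 4 → G} (h : ⁅V 0, V 1⁆ * ⁅V 2, V 3⁆ = 1) :
    twistElt V = V 2 * (V 3)⁻¹ * (V 2)⁻¹ * V 1 := by
  rw [mul_eq_one_iff_eq_inv] at h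
  have h2 : V 0 * V 1 * (V 0)⁻¹ = V 3 * V 2 * (V 3)⁻¹ * (V 2)⁻¹ * V 1 := by
    rw [← mul_inv_eq_iff_eq_mul]
    simpa [commutatorElement_def, mul_assoc] using h
  rw [twistElt, mul_assoc, mul_assoc, ← mul_assoc (V 0), h2]
  group

/-- The homomorphism from `Γ(2 | -)` given by a quadruple that satisfies the relation. -/
def gamma2Hom {G : Type*} [Group G] (V : Fin 4 → G) (h : ⁅V 0, V 1⁆ * ⁅V 2, V 3⁆ = 1) :
    Gamma2 →* G :=
  PresentedGroup.toGroup
    (f := fun x => match x with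
      | .a k => ![V 0, V 2] k
      | .b k => ![V 1, V 3] k
      | .c j => j.elim0) (by
    intro r hr
    rcases hr with rfl | ⟨j, -⟩
    · simpa [List.ofFn_succ, List.ofFn_zero, map_commutatorElement] using h
    · exact j.elim0)

@[simp] lemma gamma2Hom_gen {G : Type*} [Group G] (V : Fin 4 → G)
    (h : ⁅V 0, V 1⁆ * ⁅V 2, V 3⁆ = 1) (j : Fin 4) : gamma2Hom V h (gamma2Gen j) = V j := by
  fin_cases j <;> exact PresentedGroup.toGroup.of _

lemma closure_range_gamma2Gen : Subgroup.closure (range gamma2Gen) = ⊤ := by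
  rw [← PresentedGroup.closure_range_of, eq_comm]
  refine le_antisymm ?_ ?_
  · rw [Subgroup.closure_le]
    rintro _ ⟨x, rfl⟩
    refine Subgroup.subset_closure ?_
    rcases x with k | k | j
    · fin_cases k
      exacts [⟨0, rfl⟩, ⟨2, rfl⟩]
    · fin_cases k
      exacts [⟨1, rfl⟩, ⟨3, rfl⟩]
    · exact j.elim0
  · rw [Subgroup.closure_le]
    rintro _ ⟨j, rfl⟩
    refine Subgroup.subset_closure ?_
    fin_cases j
    exacts [⟨_, rfl⟩, ⟨_, rfl⟩, ⟨_, rfl⟩, ⟨_, rfl⟩]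

/-- The oval (component of `y = 0`) through a vertex of the cell structure. -/
def ovalIdx : Fin 6 → Fin 3 := ![0, 0, 1, 1, 2, 2]

/-- The circle (component of `z = 0`) through a vertex; the outer circle has the index `2`. -/
def circIdx : Fin 6 → Fin 3 := ![2, 0, 0, 1, 1, 2]

/-- A labelling of the pairs (vertex, face) by elements of a group. Faces are given by the signs of
`y` and `z`, with `true` for `≥ 0`. For two vertices on a common edge the quotient of the labels is
the same for the two faces that meet in this edge. -/
structure IsLabelling {G : Type*} [Group G] (P : Fin 6 → Bool → Bool → G) : Prop where
  base : ∀ ε δ, P 0 ε δ = 1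
  front : ∀ i, P i true true = 1
  oval : ∀ i j, ovalIdx i = ovalIdx j → ∀ δ,
    P i true δ * (P j true δ)⁻¹ = P i false δ * (P j false δ)⁻¹
  circ : ∀ i j, circIdx i = circIdx j → ∀ ε,
    P i ε true * (P j ε true)⁻¹ = P i ε false * (P j ε false)⁻¹

/-- The general solution of the equations in `IsLabelling`: the labelling with prescribed labels
`a₁, b₂, a₃, b₄` of four pairs (vertex, face). It is a labelling if these four elements satisfy one
relation, which is the surface relation in other generators. -/
def stdLabel {G : Type*} [Group G] (a₁ b₂ a₃ b₄ : G) : Fin 6 → Bool → Bool → G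
  | 1, true, false => a₁
  | 1, false, false => a₁
  | 2, true, false => a₁
  | 2, false, true => b₂
  | 2, false, false => b₂ * a₁
  | 3, true, false => a₃
  | 3, false, true => b₂
  | 3, false, false => a₃ * a₁⁻¹ * b₂ * a₁
  | 4, true, false => a₃
  | 4, false, true => b₄
  | 4, false, false => b₄ * b₂⁻¹ * a₃ * a₁⁻¹ * b₂ * a₁
  | 5, false, true => b₄
  | 5, false, false => b₄
  | _, _, _ => 1

lemma isLabelling_stdLabel {G : Type*} [Group G] {a₁ b₂ a₃ b₄ : G}
    (h : a₃ * b₄ = b₄ * b₂⁻¹ * a₃ * a₁⁻¹ * b₂ * a₁) : IsLabelling (stdLabel a₁ b₂ a₃ b₄) where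
  base ε δ := by cases ε <;> cases δ <;> rfl
  front i := by fin_cases i <;> rfl
  oval i j hij δ := by
    fin_cases i <;> fin_cases j <;> first | exact absurd hij (by decide) | skip
    all_goals cases δ <;> simp [stdLabel, ← h]
  circ i j hij ε := by
    fin_cases i <;> fin_cases j <;> first | exact absurd hij (by decide) | skip
    all_goals cases ε <;> simp [stdLabel, mul_assoc]

namespace IsLabelling

variable {G : Type*} [Group G] {P : Fin 6 → Bool → Bool → G}

/-- A labelling is determined by four of its values, which satisfy one relation. -/
lemma values (hP : IsLabelling P) :
    P 1 false true = 1 ∧ P 2 true false = P 1 true false ∧ P 3 false true = P 2 false true ∧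
      P 4 true false = P 3 true false ∧ P 5 true false = 1 ∧
      P 3 true false * P 4 false true = P 4 false true * (P 2 false true)⁻¹ * P 3 true false *
        (P 1 true false)⁻¹ * P 2 false true * P 1 true false := by
  have o01 := hP.oval 1 0 rfl
  have o23 := hP.oval 3 2 rfl
  have o45 := hP.oval 5 4 rfl
  have c12 := hP.circ 2 1 rfl
  have c34 := hP.circ 4 3 rfl
  have c05 := hP.circ 5 0 rfl
  simp only [Bool.forall_bool, hP.base, hP.front, inv_one, mul_one] at o01 o23 o45 c12 c34 c05
  obtain ⟨o01a, o01b⟩ := o01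
  obtain ⟨o23a, o23b⟩ := o23
  obtain ⟨o45a, o45b⟩ := o45
  obtain ⟨c12a, c12b⟩ := c12
  obtain ⟨c34a, c34b⟩ := c34
  obtain ⟨c05a, c05b⟩ := c05
  have e1 : P 1 false true = 1 := o01b.symm
  have e2 : P 2 true false = P 1 true false := by
    rw [eq_comm, mul_inv_eq_one] at c12b; exact c12b
  have e3 : P 3 false true = P 2 false true := by
    rw [eq_comm, mul_inv_eq_one] at o23b; exact o23b
  have e4 : P 4 true false = P 3 true false := by
    rw [eq_comm, mul_inv_eq_one] at c34b; exact c34b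
  have e5 : P 5 true false = 1 := c05b.symm
  have e6 : P 5 false true = P 4 false true := by
    rw [eq_comm, mul_inv_eq_one] at o45b; exact o45b
  refine ⟨e1, e2, e3, e4, e5, ?_⟩
  have f2 : P 2 false false = P 2 false true * P 1 true false := by
    rw [e1, inv_one, mul_one, ← o01a] at c12a
    rw [c12a]; group
  have f3 : P 3 false false = P 3 true false * (P 1 true false)⁻¹ * P 2 false true *
      P 1 true false := by
    rw [e2, f2] at o23a
    rw [o23a]; group
  have f4 : P 4 false false = P 4 false true * (P 2 false true)⁻¹ * P 3 false false := by
    rw [e3] at c34a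
    rw [c34a]; group
  rw [e5, e4, ← c05a, e6, one_mul] at o45a
  have : P 4 false false = P 3 true false * P 4 false true := by
    rw [inv_eq_iff_eq_inv] at o45a
    rw [o45a]; group
  rw [← this, f4, f3]
  group

/-- The quadruple of a labelling that corresponds to the generators of `Γ(2 | -)`. -/
def quad (P : Fin 6 → Bool → Bool → G) : Fin 4 → G :=
  ![(P 2 false true)⁻¹, (P 1 true false)⁻¹, (P 4 false true)⁻¹ * P 2 false true,
    (P 2 false true)⁻¹ * (P 3 true false)⁻¹ * P 2 false true]

lemma quad_relation (hP : IsLabelling P) :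
    ⁅quad P 0, quad P 1⁆ * ⁅quad P 2, quad P 3⁆ = 1 := by
  obtain ⟨-, -, -, -, -, h⟩ := hP.values
  simp only [quad, commutatorElement_def, Matrix.cons_val]
  generalize P 1 true false = a₁ at *
  generalize P 2 false true = b₂ at *
  generalize P 3 true false = a₃ at *
  generalize P 4 false true = b₄ at *
  have : b₄⁻¹ * a₃⁻¹ * b₄ = a₁⁻¹ * b₂⁻¹ * a₁ * a₃⁻¹ * b₂ := by
    have h' : b₄⁻¹ * a₃ * b₄ = b₂⁻¹ * a₃ * a₁⁻¹ * b₂ * a₁ := by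
      rw [mul_assoc, h]; group
    rw [← inv_inj]
    calc _ = b₄⁻¹ * a₃ * b₄ := by group
      _ = _ := by rw [h']; group
  calc _ = b₂⁻¹ * a₁⁻¹ * b₂ * a₁ * (b₄⁻¹ * a₃⁻¹ * b₄) * b₂⁻¹ * a₃ * b₂ := by group
    _ = 1 := by rw [this]; group

/-- The label of every pair lies in each subgroup that contains the quadruple. -/
lemma mem_of_quad_mem (hP : IsLabelling P) {S : Subgroup G} (hS : ∀ j, quad P j ∈ S)
    (i : Fin 6) (ε δ : Bool) : P i ε δ ∈ S := by
  have b₂ : P 2 false true ∈ S := by simpa [quad] using S.inv_mem (hS 0)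
  have a₁ : P 1 true false ∈ S := by simpa [quad] using S.inv_mem (hS 1)
  have b₄ : P 4 false true ∈ S := by
    simpa [quad] using S.mul_mem b₂ (S.inv_mem (hS 2))
  have a₃ : P 3 true false ∈ S := by
    have := S.mul_mem (S.mul_mem b₂ (S.inv_mem (hS 3))) (S.inv_mem b₂)
    simpa [quad, mul_assoc] using this
  obtain ⟨e1, e2, e3, e4, e5, -⟩ := hP.values
  have step : ∀ {x y z w : G}, x * y⁻¹ = z * w⁻¹ → y ∈ S → z ∈ S → w ∈ S → x ∈ S := by
    intro x y z w e hy hz hw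
    rw [mul_inv_eq_iff_eq_mul] at e
    rw [e]
    exact S.mul_mem (S.mul_mem hz (S.inv_mem hw)) hy
  have i0 : ∀ ε δ, P 0 ε δ ∈ S := fun ε δ => by rw [hP.base]; exact S.one_mem
  have ii : ∀ i, P i true true ∈ S := fun i => by rw [hP.front]; exact S.one_mem
  have i1 : P 1 false true ∈ S := by rw [e1]; exact S.one_mem
  have i5 : P 5 true false ∈ S := by rw [e5]; exact S.one_mem
  have j1 : P 1 false false ∈ S := step (hP.oval 1 0 rfl false).symm (i0 _ _) a₁ (i0 _ _)
  have j2 : P 2 false false ∈ S := step (hP.circ 2 1 rfl false).symm j1 b₂ i1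
  have j2' : P 2 true false ∈ S := by rw [e2]; exact a₁
  have j3 : P 3 false false ∈ S := step (hP.oval 3 2 rfl false).symm j2 a₃ j2'
  have j3' : P 3 false true ∈ S := by rw [e3]; exact b₂
  have j4 : P 4 false false ∈ S := step (hP.circ 4 3 rfl false).symm j3 b₄ j3'
  have j4' : P 4 true false ∈ S := by rw [e4]; exact a₃
  have j5 : P 5 false false ∈ S := step (hP.oval 5 4 rfl false).symm j4 i5 j4'
  have j5' : P 5 false true ∈ S := step (hP.circ 5 0 rfl false) (i0 _ _) j5 (i0 _ _)
  fin_cases i <;> cases ε <;> cases δ <;> first | exact i0 _ _ | exact ii _ | assumption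

/-- The `i`-th curve consists of two arcs between its vertices `i` and `i + 1`, on one of which the
coordinate among `y, z` that does not vanish on the curve is negative. This is the face that has
the latter arc on its boundary and lies on the positive side of the curve. -/
def backFace (i : Fin 5) : Bool × Bool := ![(true, false), (false, true), (true, false),
  (false, true), (true, false)] i

/-- Whether the face `(ε, δ)` is on the positive side of the `i`-th curve. -/
def posFace (i : Fin 5) (ε δ : Bool) : Bool := ![ε, δ, ε, δ, ε] i

/-- The value of a labelling on the `i`-th curve, oriented from the vertex `i` to the vertex `i + 1` on
its negative arc; on the positive arc the labels are `1` by `IsLabelling.front`. -/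
def core (P : Fin 6 → Bool → Bool → G) (i : Fin 5) : G :=
  P i.succ (backFace i).1 (backFace i).2 * (P i.castSucc (backFace i).1 (backFace i).2)⁻¹

/-- A homomorphism that changes a labelling like a Dehn twist about the `i`-th curve changes the
quadruple by the `i`-th substitution, up to conjugation. The change by a twist: with `c` the curve if
it passes through the base vertex `0` and `c = 1` otherwise, the labels of the faces on the positive
side of the curve are conjugated by `c⁻¹`; a label of a face on the other side is multiplied on the
left by `c⁻¹ d`, with `d` the curve if the vertex lies on it and `d = 1` otherwise. -/
lemma quad_twist (hP : IsLabelling P) (T : G →* G) (i : Fin 5) (c : G)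
    (hc : c = if i = 0 then core P i else 1)
    (hpos : ∀ k ε δ, posFace i ε δ = true → T (P k ε δ) = c⁻¹ * P k ε δ * c)
    (hneg : ∀ k ε δ, posFace i ε δ = false → T (P k ε δ) =
      c⁻¹ * (if k = i.castSucc ∨ k = i.succ then core P i else 1) * P k ε δ) :
    ∃ g : G, ∀ j, T (quad P j) = g * twistMove (quad P) i j * g⁻¹ := by
  obtain ⟨e1, e2, e3, e4, e5, -⟩ := hP.values
  have a1 := hpos 1 true false
  have a1' := hneg 1 true false
  have b2 := hpos 2 false true
  have b2' := hneg 2 false true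
  have a3 := hpos 3 true false
  have a3' := hneg 3 true false
  have b4 := hpos 4 false true
  have b4' := hneg 4 false true
  -- the substitution for the middle curve is normalised to fix `β₂`, which costs a conjugation
  refine ⟨if i = 2 then (twistElt (quad P))⁻¹ else 1, fun j => ?_⟩
  fin_cases i
  all_goals
    simp [core, backFace, posFace] at hc a1 a1' b2 b2' a3 a3' b4 b4'
    subst hc
  · simp [hP.base] at a1 b2' a3 b4'
    fin_cases j <;> simp [quad, twistMove, a1, b2', a3, b4', mul_assoc]
  · simp [e1] at a1' b2 a3' b4
    fin_cases j <;> simp [quad, twistMove, a1', b2, a3', b4]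
  · simp [e2] at a1 b2' a3 b4'
    fin_cases j <;> simp [quad, twistMove, twistElt, a1, b2', a3, b4', mul_assoc]
  · simp [e3] at a1' b2 a3' b4
    fin_cases j <;> simp [quad, twistMove, a1', b2, a3', b4, mul_assoc]
  · simp [e4, e5] at a1 b2' a3 b4'
    fin_cases j <;> simp [quad, twistMove, a1, b2', a3, b4', mul_assoc]

end IsLabelling

/-! ### The cell structure of the surface -/


/-- The polynomial in `x, y` whose square root is `|z|` on the surface. -/
def planeFun (x y : ℝ) : ℝ :=
  (9 - x ^ 2 - y ^ 2) * ((x + 3 / 2) ^ 2 + y ^ 2 - 1 / 4) * ((x - 3 / 2) ^ 2 + y ^ 2 - 1 / 4)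

lemma continuous_planeFun : Continuous fun q : ℝ × ℝ => planeFun q.1 q.2 := by
  unfold planeFun; fun_prop

lemma mem_surfSet {p : R3} : p ∈ surfSet ↔ p 2 ^ 2 = planeFun (p 0) (p 1) := by
  simp only [surfSet, mem_ofPred_eq, surfFun, planeFun, sub_eq_zero]

lemma planeFun_nonneg_iff {x y : ℝ} : 0 ≤ planeFun x y ↔ 0 ≤ 9 - x ^ 2 - y ^ 2 ∧
    0 ≤ (x + 3 / 2) ^ 2 + y ^ 2 - 1 / 4 ∧ 0 ≤ (x - 3 / 2) ^ 2 + y ^ 2 - 1 / 4 := by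
  refine ⟨fun h => ?_, fun ⟨h1, h2, h3⟩ => mul_nonneg (mul_nonneg h1 h2) h3⟩
  have hA : 0 ≤ 9 - x ^ 2 - y ^ 2 := by
    by_contra hA
    push Not at hA
    have hB : 0 < (x + 3 / 2) ^ 2 + y ^ 2 - 1 / 4 := by
      by_contra hB
      nlinarith [sq_nonneg (x + 2), sq_nonneg (x + 1), sq_nonneg (x + 3 / 2)]
    have hC : 0 < (x - 3 / 2) ^ 2 + y ^ 2 - 1 / 4 := by
      by_contra hC
      nlinarith [sq_nonneg (x - 2), sq_nonneg (x - 1), sq_nonneg (x - 3 / 2)]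
    exact absurd h (not_le.2 (mul_neg_of_neg_of_pos (mul_neg_of_neg_of_pos hA hB) hC))
  refine ⟨hA, ?_, ?_⟩
  · by_contra hB
    push Not at hB
    have hA' : 0 < 9 - x ^ 2 - y ^ 2 := by nlinarith [sq_nonneg (x + 3 / 2 + 1 / 2), sq_nonneg y]
    have hC : 0 < (x - 3 / 2) ^ 2 + y ^ 2 - 1 / 4 := by
      nlinarith [sq_nonneg (x + 3 / 2 + 1 / 2), sq_nonneg y]
    exact absurd h (not_le.2 (mul_neg_of_neg_of_pos (mul_neg_of_pos_of_neg hA' hB) hC))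
  · by_contra hC
    push Not at hC
    have hA' : 0 < 9 - x ^ 2 - y ^ 2 := by nlinarith [sq_nonneg (x - 3 / 2 - 1 / 2), sq_nonneg y]
    have hB : 0 < (x + 3 / 2) ^ 2 + y ^ 2 - 1 / 4 := by
      nlinarith [sq_nonneg (x - 3 / 2 - 1 / 2), sq_nonneg y]
    exact absurd h (not_le.2 (mul_neg_of_pos_of_neg (mul_pos hA' hB) hC))

namespace Surf

lemma eqn (q : Surf) : q.1 2 ^ 2 = planeFun (q.1 0) (q.1 1) := mem_surfSet.1 q.2

lemma planeFun_nonneg (q : Surf) : 0 ≤ planeFun (q.1 0) (q.1 1) := by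
  rw [← q.eqn]; positivity

/-- The point of the surface with coordinates `x, y, z`. -/
def mk (x y z : ℝ) (h : z ^ 2 = planeFun x y) : Surf := ⟨![x, y, z], mem_surfSet.2 h⟩

@[simp] lemma mk_zero (x y z : ℝ) (h : z ^ 2 = planeFun x y) : (mk x y z h).1 0 = x := rfl
@[simp] lemma mk_one (x y z : ℝ) (h : z ^ 2 = planeFun x y) : (mk x y z h).1 1 = y := rfl
@[simp] lemma mk_two (x y z : ℝ) (h : z ^ 2 = planeFun x y) : (mk x y z h).1 2 = z := rfl

lemma ext' {p q : Surf} (h0 : p.1 0 = q.1 0) (h1 : p.1 1 = q.1 1) (h2 : p.1 2 = q.1 2) :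
    p = q :=
  Subtype.ext (funext fun i => by fin_cases i <;> assumption)

lemma continuous_coord (i : Fin 3) : Continuous fun q : Surf => q.1 i :=
  (continuous_apply i).comp continuous_subtype_val

lemma continuous_of_coord {X : Type*} [TopologicalSpace X] {f : X → Surf}
    (h0 : Continuous fun x => (f x).1 0) (h1 : Continuous fun x => (f x).1 1)
    (h2 : Continuous fun x => (f x).1 2) : Continuous f :=
  continuous_induced_rng.2 (continuous_pi fun i => by fin_cases i <;> assumption)

end Surf

/-- The sign of a truth value, `true` standing for `1` and `false` for `-1`. -/
def sg (ε : Bool) : ℝ := if ε then 1 else -1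

@[simp] lemma sg_mul_self (ε : Bool) : sg ε * sg ε = 1 := by cases ε <;> simp [sg]

lemma sg_sq (ε : Bool) : sg ε ^ 2 = 1 := by cases ε <;> simp [sg]

/-- The four faces of the cell structure, cut out by the planes `y = 0` and `z = 0`. -/
def face (ε δ : Bool) : Set Surf := {q | 0 ≤ sg ε * q.1 1 ∧ 0 ≤ sg δ * q.1 2}

/-- The ordinate of the lower boundary of the half disc with two holes. -/
def lowBd (x : ℝ) : ℝ := √(1 / 4 - (|x| - 3 / 2) ^ 2)

/-- The factor by which a vertical segment shrinks when the half disc with two holes is obtained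
from the half disc. -/
def shrink (x : ℝ) : ℝ := 1 - lowBd x / max 2 (√(9 - x ^ 2))

lemma continuous_lowBd : Continuous lowBd := by unfold lowBd; fun_prop

lemma continuous_shrink : Continuous shrink := by
  unfold shrink
  refine continuous_const.sub (continuous_lowBd.div₀ (by fun_prop) fun x => ?_)
  have := le_max_left 2 (√(9 - x ^ 2))
  positivity

lemma lowBd_nonneg (x : ℝ) : 0 ≤ lowBd x := Real.sqrt_nonneg _

lemma shrink_pos (x : ℝ) : 0 < shrink x := by
  have h2 := le_max_left 2 (√(9 - x ^ 2))
  have h1 : lowBd x ≤ 1 := by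
    unfold lowBd
    exact Real.sqrt_le_iff.2 ⟨zero_le_one, by nlinarith [sq_nonneg (|x| - 3 / 2)]⟩
  rw [shrink, sub_pos, div_lt_one (by positivity)]
  linarith

lemma lowBd_add_shrink_mul (x : ℝ) : lowBd x + shrink x * √(9 - x ^ 2) = √(9 - x ^ 2) := by
  rcases eq_or_ne (lowBd x) 0 with h | h
  · simp [shrink, h]
  · have hx : 0 < 1 / 4 - (|x| - 3 / 2) ^ 2 := by
      by_contra hx
      exact h (Real.sqrt_eq_zero_of_nonpos (not_lt.1 hx))
    have h4 : 2 ≤ √(9 - x ^ 2) := by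
      rw [Real.le_sqrt' two_pos, ← sq_abs x]
      nlinarith [abs_nonneg x]
    have : √(9 - x ^ 2) ≠ 0 := by positivity
    rw [shrink, max_eq_right h4]
    field_simp
    ring

/-- The points between the two boundary curves lie in the disc with two holes. -/
lemma planeFun_nonneg_of_between {x y : ℝ} (hx : x ^ 2 ≤ 9) (h1 : lowBd x ≤ y)
    (h2 : y ≤ √(9 - x ^ 2)) : 0 ≤ planeFun x y := by
  have hy : 0 ≤ y := (lowBd_nonneg x).trans h1
  have h3 : y ^ 2 ≤ 9 - x ^ 2 := (Real.le_sqrt hy (by linarith)).1 h2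
  have h4 : 1 / 4 - (|x| - 3 / 2) ^ 2 ≤ y ^ 2 := by
    rw [lowBd, Real.sqrt_le_left hy] at h1
    exact h1
  have h5 := sq_abs x
  have h6 := le_abs_self x
  have h7 := neg_abs_le x
  exact planeFun_nonneg_iff.2 ⟨by linarith, by nlinarith, by nlinarith⟩

lemma planeFun_sg_mul (ε : Bool) (x y : ℝ) : planeFun x (sg ε * y) = planeFun x y := by
  simp only [planeFun, mul_pow, sg_sq, one_mul]

/-- The contraction of a face: after its two holes have been straightened it is a half disc, which
is contracted linearly to its left corner. -/
lemma exists_face_contraction (ε δ : Bool) : ∃ H : I × face ε δ → face ε δ, Continuous H ∧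
    (∀ q, H (0, q) = q) ∧ ∀ q, (H (1, q)).1.1 = ![-3, 0, 0] := by
  let X : I × face ε δ → ℝ := fun w => (1 - w.1) * w.2.1.1 0 + w.1 * (-3)
  let Y : I × face ε δ → ℝ := fun w =>
    (1 - w.1) * ((sg ε * w.2.1.1 1 - lowBd (w.2.1.1 0)) / shrink (w.2.1.1 0))
  let Z : I × face ε δ → ℝ := fun w => lowBd (X w) + shrink (X w) * Y w
  have hxc : Continuous fun w : I × face ε δ => w.2.1.1 0 :=
    (Surf.continuous_coord 0).comp (by fun_prop)
  have hyc : Continuous fun w : I × face ε δ => w.2.1.1 1 :=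
    (Surf.continuous_coord 1).comp (by fun_prop)
  have hX : Continuous X := by fun_prop
  have hY : Continuous Y := by
    refine Continuous.mul (by fun_prop) (Continuous.div₀ ?_ (continuous_shrink.comp hxc)
      fun w => (shrink_pos _).ne')
    exact (continuous_const.mul hyc).sub (continuous_lowBd.comp hxc)
  have hZ : Continuous Z :=
    (continuous_lowBd.comp hX).add ((continuous_shrink.comp hX).mul hY)
  -- the straightened ordinate is nonnegative, and the straightened point lies in the disc
  have bounds : ∀ w, 0 ≤ Y w ∧ (X w) ^ 2 + Y w ^ 2 ≤ 9 := by
    rintro ⟨t, q⟩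
    obtain ⟨hA, hB, hC⟩ := planeFun_nonneg_iff.1 q.1.planeFun_nonneg
    have hy := q.2.1
    have hlow : lowBd (q.1.1 0) ≤ sg ε * q.1.1 1 := by
      rw [lowBd, Real.sqrt_le_left hy, mul_pow, sg_sq, one_mul]
      rcases abs_cases (q.1.1 0) with h | h <;> rw [h.1] <;> nlinarith
    have htop : sg ε * q.1.1 1 ≤ √(9 - q.1.1 0 ^ 2) := by
      refine Real.le_sqrt_of_sq_le ?_
      rw [mul_pow, sg_sq, one_mul]
      linarith
    have hs := shrink_pos (q.1.1 0)
    set u := (sg ε * q.1.1 1 - lowBd (q.1.1 0)) / shrink (q.1.1 0) with hu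
    have hu0 : 0 ≤ u := div_nonneg (by linarith) hs.le
    have hu1 : u ≤ √(9 - q.1.1 0 ^ 2) := by
      rw [hu, div_le_iff₀ hs]
      have := lowBd_add_shrink_mul (q.1.1 0)
      linarith
    have hu2 : u ^ 2 ≤ 9 - q.1.1 0 ^ 2 :=
      (Real.le_sqrt hu0 (by nlinarith [sq_nonneg (q.1.1 1)])).1 hu1
    have t0 := t.2.1
    have t1 := t.2.2
    refine ⟨mul_nonneg (by linarith) hu0, ?_⟩
    change ((1 - (t : ℝ)) * q.1.1 0 + t * (-3)) ^ 2 + ((1 - t) * u) ^ 2 ≤ 9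
    have h3 : -3 ≤ q.1.1 0 := by nlinarith [sq_nonneg (q.1.1 1)]
    nlinarith [mul_nonneg t0 (sub_nonneg.2 t1), mul_nonneg (mul_nonneg t0 (sub_nonneg.2 t1))
      (by linarith : 0 ≤ q.1.1 0 + 3), mul_nonneg (sq_nonneg (1 - (t : ℝ))) (sub_nonneg.2 hu2)]
  have key : ∀ w, 0 ≤ planeFun (X w) (Z w) := by
    intro w
    obtain ⟨h1, h2⟩ := bounds w
    refine planeFun_nonneg_of_between (by nlinarith [sq_nonneg (Y w)]) ?_ ?_
    · exact le_add_of_nonneg_right (mul_nonneg (shrink_pos _).le h1)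
    · rw [← lowBd_add_shrink_mul (X w)]
      have : Y w ≤ √(9 - X w ^ 2) := Real.le_sqrt_of_sq_le (by linarith)
      have := mul_le_mul_of_nonneg_left this (shrink_pos (X w)).le
      simp only [Z]
      linarith
  have hZ0 : ∀ w, 0 ≤ Z w := fun w =>
    add_nonneg (lowBd_nonneg _) (mul_nonneg (shrink_pos _).le (bounds w).1)
  refine ⟨fun w => ⟨Surf.mk (X w) (sg ε * Z w) (sg δ * √(planeFun (X w) (Z w))) ?_, ?_, ?_⟩,
    ?_, ?_, ?_⟩
  · rw [mul_pow, sg_sq, one_mul, Real.sq_sqrt (key w), planeFun_sg_mul]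
  · simpa [← mul_assoc] using hZ0 w
  · simp [← mul_assoc]
  · refine Continuous.subtype_mk (Surf.continuous_of_coord hX (continuous_const.mul hZ) ?_) _
    exact continuous_const.mul (continuous_planeFun.comp (hX.prodMk hZ)).sqrt
  · intro q
    have hX0 : X (0, q) = q.1.1 0 := by simp [X]
    have hZ0 : Z (0, q) = sg ε * q.1.1 1 := by
      have := (shrink_pos (q.1.1 0)).ne'
      simp only [Z, hX0, Y]
      simp
      field_simp
      ring
    refine Subtype.ext (Surf.ext' hX0 ?_ ?_)
    · simp [hZ0, ← mul_assoc]
    · simp only [Surf.mk_two, hX0, hZ0, planeFun_sg_mul]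
      rw [← q.1.eqn, ← one_mul (q.1.1 2 ^ 2), ← sg_sq δ, ← mul_pow, Real.sqrt_sq q.2.2,
        ← mul_assoc, sg_mul_self, one_mul]
  · intro q
    have hX0 : X (1, q) = -3 := by simp [X]
    have hZ0 : Z (1, q) = 0 := by
      simp only [Z, hX0, Y, lowBd]
      norm_num
    simp only [Surf.mk, hX0, hZ0]
    norm_num [planeFun]

/-- The abscissas of the six vertices, the points with `y = z = 0`. -/
def vtxX : Fin 6 → ℝ := ![-3, -2, -1, 1, 2, 3]

/-- The vertices of the cell structure, from left to right. -/
def vtx (i : Fin 6) : Surf := Surf.mk (vtxX i) 0 0 (by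
  fin_cases i <;> norm_num [vtxX, planeFun])

@[simp] lemma vtx_zero (i : Fin 6) : (vtx i).1 0 = vtxX i := rfl
@[simp] lemma vtx_one (i : Fin 6) : (vtx i).1 1 = 0 := rfl
@[simp] lemma vtx_two (i : Fin 6) : (vtx i).1 2 = 0 := rfl

lemma vtx_mem_face (i : Fin 6) (ε δ : Bool) : vtx i ∈ face ε δ := by simp [face]

instance contractibleSpace_face (ε δ : Bool) : ContractibleSpace (face ε δ) := by
  obtain ⟨H, hH, h0, h1⟩ := exists_face_contraction ε δ
  rw [contractible_iff_id_nullhomotopic]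
  refine ⟨⟨vtx 0, vtx_mem_face 0 ε δ⟩, ⟨⟨⟨H, hH⟩, h0, fun q => ?_⟩⟩⟩
  exact Subtype.ext (Subtype.ext (h1 q))

/-- The class of the paths from `a` to `b` in a face. -/
def faceClass (ε δ : Bool) {a b : Surf} (ha : a ∈ face ε δ) (hb : b ∈ face ε δ) :
    FundamentalGroupoid.mk a ⟶ FundamentalGroupoid.mk b :=
  simpClass (⟨Subtype.val, continuous_subtype_val⟩ : C(face ε δ, Surf)) ⟨a, ha⟩ ⟨b, hb⟩

lemma pathClass_eq_faceClass {ε δ : Bool} {a b : Surf} (γ : Path a b)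
    (h : ∀ t, γ t ∈ face ε δ) :
    pathClass γ = faceClass ε δ (by simpa using h 0) (by simpa using h 1) := by
  have ha : a ∈ face ε δ := by simpa using h 0
  have hb : b ∈ face ε δ := by simpa using h 1
  exact pathClass_map_eq_simpClass (⟨Subtype.val, continuous_subtype_val⟩ : C(face ε δ, Surf))
    (a := ⟨a, ha⟩) (b := ⟨b, hb⟩)
    ⟨⟨fun t => ⟨γ t, h t⟩, by fun_prop⟩, Subtype.ext γ.source, Subtype.ext γ.target⟩

@[simp] lemma faceClass_self {ε δ : Bool} {a : Surf} (ha : a ∈ face ε δ) :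
    faceClass ε δ ha ha = 𝟙 _ :=
  simpClass_self _ _

@[simp] lemma faceClass_comp {ε δ : Bool} {a b c : Surf} (ha : a ∈ face ε δ)
    (hb : b ∈ face ε δ) (hc : c ∈ face ε δ) :
    faceClass ε δ ha hb ≫ faceClass ε δ hb hc = faceClass ε δ ha hc :=
  simpClass_comp _ _ _ _

lemma faceClass_comp_assoc {ε δ : Bool} {a b c : Surf} (ha : a ∈ face ε δ)
    (hb : b ∈ face ε δ) (hc : c ∈ face ε δ) {Z : FundamentalGroupoid Surf}
    (h : FundamentalGroupoid.mk c ⟶ Z) :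
    faceClass ε δ ha hb ≫ faceClass ε δ hb hc ≫ h = faceClass ε δ ha hc ≫ h := by
  rw [← Category.assoc, faceClass_comp]

lemma exists_path_faceClass {ε δ : Bool} {a b : Surf} (ha : a ∈ face ε δ) (hb : b ∈ face ε δ) :
    ∃ γ : Path a b, (∀ t, γ t ∈ face ε δ) ∧ pathClass γ = faceClass ε δ ha hb := by
  let γ := PathConnectedSpace.somePath (⟨a, ha⟩ : face ε δ) ⟨b, hb⟩
  exact ⟨γ.map continuous_subtype_val, fun t => (γ t).2, rfl⟩

/-- If a simply connected space is mapped to two faces, then the face classes agree. -/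
lemma faceClass_eq_of_map {Y : Type*} [TopologicalSpace Y] [SimplyConnectedSpace Y]
    (f : C(Y, Surf)) {ε δ ε' δ' : Bool} (h : ∀ y, f y ∈ face ε δ) (h' : ∀ y, f y ∈ face ε' δ')
    {a b : Surf} (u v : Y) (hu : f u = a) (hv : f v = b) (ha : a ∈ face ε δ) (hb : b ∈ face ε δ)
    (ha' : a ∈ face ε' δ') (hb' : b ∈ face ε' δ') :
    faceClass ε δ ha hb = faceClass ε' δ' ha' hb' := by
  subst hu hv
  exact (pathClass_eq_faceClass ((PathConnectedSpace.somePath u v).map f.continuous)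
    (fun t => h _)).symm.trans (pathClass_eq_faceClass
      ((PathConnectedSpace.somePath u v).map f.continuous) (fun t => h' _))

/-- Two points on the same half of an oval. The halves are the graphs of `± √ planeFun` over the
intervals `[-3, -2]`, `[-1, 1]`, `[2, 3]`. -/
lemma faceClass_oval {δ : Bool} {a b : Surf} {l u : ℝ}
    (hlu : ∀ x, l ≤ x → x ≤ u → 0 ≤ planeFun x 0) (ha : a.1 0 ∈ Icc l u) (hb : b.1 0 ∈ Icc l u)
    (ha1 : a ∈ face true δ) (hb1 : b ∈ face true δ) (ha2 : a ∈ face false δ)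
    (hb2 : b ∈ face false δ) :
    faceClass true δ ha1 hb1 = faceClass false δ ha2 hb2 := by
  have : ContractibleSpace (Icc l u) := (convex_Icc l u).contractibleSpace ⟨_, ha⟩
  let f : C(Icc l u, Surf) := ⟨fun x => Surf.mk x 0 (sg δ * √(planeFun x 0))
    (by rw [mul_pow, sg_sq, one_mul, Real.sq_sqrt (hlu x x.2.1 x.2.2)]),
    Surf.continuous_of_coord continuous_subtype_val continuous_const
      (continuous_const.mul (continuous_planeFun.comp (by fun_prop :
        Continuous fun x : Icc l u => ((x : ℝ), (0 : ℝ)))).sqrt)⟩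
  have hf : ∀ ε y, f y ∈ face ε δ := fun ε y => by
    constructor <;> simp [f, ← mul_assoc]
  have hval : ∀ (c : Surf) (hc : c.1 0 ∈ Icc l u), c ∈ face true δ → c ∈ face false δ →
      f ⟨c.1 0, hc⟩ = c := by
    intro c hc h1 h2
    have hy : c.1 1 = 0 := by
      have := h1.1
      have := h2.1
      simp only [sg] at *
      norm_num at *
      linarith
    refine Surf.ext' rfl hy.symm ?_
    have := c.eqn
    rw [hy] at this
    change sg δ * √(planeFun (c.1 0) 0) = c.1 2
    rw [← this, ← one_mul (c.1 2 ^ 2), ← sg_sq δ, ← mul_pow, Real.sqrt_sq h1.2, ← mul_assoc,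
      sg_mul_self, one_mul]
  exact faceClass_eq_of_map f (hf true) (hf false) _ _ (hval a ha ha1 ha2) (hval b hb hb1 hb2) _ _ _ _

/-- Two points on the same half of a circle in the plane `z = 0`. -/
lemma faceClass_circ {ε : Bool} {a b : Surf} {c R : ℝ}
    (hR : ∀ x y, (x - c) ^ 2 + y ^ 2 = R → planeFun x y = 0)
    (ha : (a.1 0 - c) ^ 2 + a.1 1 ^ 2 = R) (hb : (b.1 0 - c) ^ 2 + b.1 1 ^ 2 = R)
    (ha1 : a ∈ face ε true) (hb1 : b ∈ face ε true) (ha2 : a ∈ face ε false)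
    (hb2 : b ∈ face ε false) :
    faceClass ε true ha1 hb1 = faceClass ε false ha2 hb2 := by
  have mem : ∀ x y, (x - c) ^ 2 + y ^ 2 = R → x ∈ Icc (c - √R) (c + √R) := by
    intro x y h
    have := Real.abs_le_sqrt (show (x - c) ^ 2 ≤ R by nlinarith [sq_nonneg y])
    rw [abs_le] at this
    constructor <;> linarith
  have hR0 : 0 ≤ R := by rw [← ha]; positivity
  have : ContractibleSpace (Icc (c - √R) (c + √R)) :=
    (convex_Icc _ _).contractibleSpace ⟨_, mem _ _ ha⟩
  have pos : ∀ x : Icc (c - √R) (c + √R), 0 ≤ R - (x - c) ^ 2 := by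
    intro x
    have h1 := x.2.1
    have h2 := x.2.2
    have : |(x : ℝ) - c| ≤ √R := abs_le.2 ⟨by linarith, by linarith⟩
    rw [Real.le_sqrt (abs_nonneg _) hR0, sq_abs] at this
    linarith
  let f : C(Icc (c - √R) (c + √R), Surf) := ⟨fun x => Surf.mk x (sg ε * √(R - (x - c) ^ 2)) 0
    (by
      rw [hR]
      · simp
      · rw [mul_pow, sg_sq, one_mul, Real.sq_sqrt (pos x)]; ring),
    Surf.continuous_of_coord continuous_subtype_val (by dsimp; fun_prop) continuous_const⟩
  have hf : ∀ δ y, f y ∈ face ε δ := fun δ y => by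
    constructor <;> simp [f, ← mul_assoc]
  have hval : ∀ (q : Surf) (hq : (q.1 0 - c) ^ 2 + q.1 1 ^ 2 = R), q ∈ face ε true →
      q ∈ face ε false → f ⟨q.1 0, mem _ _ hq⟩ = q := by
    intro q hq h1 h2
    have hz : q.1 2 = 0 := by
      have := h1.2
      have := h2.2
      simp only [sg] at *
      norm_num at *
      linarith
    refine Surf.ext' rfl ?_ hz.symm
    change sg ε * √(R - (q.1 0 - c) ^ 2) = q.1 1
    rw [← hq, add_sub_cancel_left, ← one_mul (q.1 1 ^ 2), ← sg_sq ε, ← mul_pow, Real.sqrt_sq h1.1,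
      ← mul_assoc, sg_mul_self, one_mul]
  exact faceClass_eq_of_map f (hf true) (hf false) _ _ (hval a ha ha1 ha2) (hval b hb hb1 hb2) _ _ _ _

/-! ### The labelling of the vertices by loops -/


/-- Left ends of the three ovals in `y = 0`. -/
def ovalL : Fin 3 → ℝ := ![-3, -1, 2]

/-- Right ends of the three ovals in `y = 0`. -/
def ovalR : Fin 3 → ℝ := ![-2, 1, 3]

/-- Centres of the three circles in `z = 0`. -/
def circC : Fin 3 → ℝ := ![-(3 / 2), 3 / 2, 0]

/-- Squared radii of the three circles in `z = 0`. -/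
def circR : Fin 3 → ℝ := ![1 / 4, 1 / 4, 9]

/-- The three components of the intersection of the surface with the plane `y = 0`. -/
def ovalSet (k : Fin 3) : Set Surf := {q | q.1 1 = 0 ∧ ovalL k ≤ q.1 0 ∧ q.1 0 ≤ ovalR k}

/-- The three components of the intersection of the surface with the plane `z = 0`. -/
def circSet (k : Fin 3) : Set Surf :=
  {q | q.1 2 = 0 ∧ (q.1 0 - circC k) ^ 2 + q.1 1 ^ 2 = circR k}

lemma planeFun_nonneg_of_oval (k : Fin 3) (x : ℝ) (h1 : ovalL k ≤ x) (h2 : x ≤ ovalR k) :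
    0 ≤ planeFun x 0 := by
  rw [planeFun_nonneg_iff]
  fin_cases k <;> simp [ovalL, ovalR] at h1 h2 <;> refine ⟨?_, ?_, ?_⟩ <;> nlinarith

lemma planeFun_eq_zero_of_circ (k : Fin 3) (x y : ℝ) (h : (x - circC k) ^ 2 + y ^ 2 = circR k) :
    planeFun x y = 0 := by
  fin_cases k <;> simp [circC, circR] at h
  · rw [planeFun, show (x + 3 / 2) ^ 2 + y ^ 2 - 1 / 4 = 0 by linarith]; ring
  · rw [planeFun, show (x - 3 / 2) ^ 2 + y ^ 2 - 1 / 4 = 0 by linarith]; ring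
  · rw [planeFun, show 9 - x ^ 2 - y ^ 2 = 0 by linarith]; ring

lemma exists_mem_ovalSet {q : Surf} (h : q.1 1 = 0) : ∃ k, q ∈ ovalSet k := by
  have h2 := planeFun_nonneg_iff.1 q.planeFun_nonneg
  rw [h] at h2
  obtain ⟨hA, hB, hC⟩ := h2
  have hA1 : -3 ≤ q.1 0 := by nlinarith
  have hA2 : q.1 0 ≤ 3 := by nlinarith
  by_cases h1 : q.1 0 < -(3 / 2)
  · exact ⟨0, h, by simpa [ovalL], by simp [ovalR]; nlinarith⟩
  by_cases h3 : 3 / 2 < q.1 0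
  · exact ⟨2, h, by simp [ovalL]; nlinarith, by simpa [ovalR]⟩
  · exact ⟨1, h, by simp [ovalL]; nlinarith, by simp [ovalR]; nlinarith⟩

lemma exists_mem_circSet {q : Surf} (h : q.1 2 = 0) : ∃ k, q ∈ circSet k := by
  have h2 := q.eqn
  rw [h, planeFun, eq_comm] at h2
  simp only [ne_eq, OfNat.ofNat_ne_zero, not_false_eq_true, zero_pow, mul_eq_zero] at h2
  rcases h2 with (h2 | h2) | h2
  · exact ⟨2, h, by simp [circC, circR]; linarith⟩
  · exact ⟨0, h, by simp [circC, circR]; linarith⟩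
  · exact ⟨1, h, by simp [circC, circR]; linarith⟩

lemma vtx_mem_ovalSet (i : Fin 6) : vtx i ∈ ovalSet (ovalIdx i) := by
  fin_cases i <;> norm_num [ovalSet, ovalIdx, vtxX, Fin.ext_iff, show ovalL 0 = -3 from rfl,
    show ovalL 1 = -1 from rfl, show ovalL 2 = 2 from rfl, show ovalR 0 = -2 from rfl,
    show ovalR 1 = 1 from rfl, show ovalR 2 = 3 from rfl]

lemma vtx_mem_circSet (i : Fin 6) : vtx i ∈ circSet (circIdx i) := by
  fin_cases i <;> norm_num [circSet, circIdx, vtxX, Fin.ext_iff, show circC 0 = -(3 / 2) from rfl,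
    show circC 1 = 3 / 2 from rfl, show circC 2 = 0 from rfl, show circR 0 = 1 / 4 from rfl,
    show circR 1 = 1 / 4 from rfl, show circR 2 = 9 from rfl]

/-- Half of an oval is an interval, so that two points of the half are joined in the same way in the
two faces that meet there. -/
lemma faceClass_eq_of_ovalSet {k : Fin 3} {δ : Bool} {a b : Surf} (ha : a ∈ ovalSet k)
    (hb : b ∈ ovalSet k) (ha1 : a ∈ face true δ) (hb1 : b ∈ face true δ) (ha2 : a ∈ face false δ)
    (hb2 : b ∈ face false δ) : faceClass true δ ha1 hb1 = faceClass false δ ha2 hb2 :=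
  faceClass_oval (planeFun_nonneg_of_oval k) ha.2 hb.2 _ _ _ _

lemma faceClass_eq_of_circSet {k : Fin 3} {ε : Bool} {a b : Surf} (ha : a ∈ circSet k)
    (hb : b ∈ circSet k) (ha1 : a ∈ face ε true) (hb1 : b ∈ face ε true) (ha2 : a ∈ face ε false)
    (hb2 : b ∈ face ε false) : faceClass ε true ha1 hb1 = faceClass ε false ha2 hb2 :=
  faceClass_circ (planeFun_eq_zero_of_circ k) ha.2 hb.2 _ _ _ _

/-- The class of the paths from the `i`-th to the `j`-th vertex in a face. -/
def vtxClass (ε δ : Bool) (i j : Fin 6) :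
    FundamentalGroupoid.mk (vtx i) ⟶ FundamentalGroupoid.mk (vtx j) :=
  faceClass ε δ (vtx_mem_face i ε δ) (vtx_mem_face j ε δ)

@[simp] lemma vtxClass_self (ε δ : Bool) (i : Fin 6) : vtxClass ε δ i i = 𝟙 _ := faceClass_self _

@[simp] lemma vtxClass_comp (ε δ : Bool) (i j k : Fin 6) :
    vtxClass ε δ i j ≫ vtxClass ε δ j k = vtxClass ε δ i k := faceClass_comp _ _ _

@[simp] lemma vtxClass_comp_assoc (ε δ : Bool) (i j k : Fin 6) {Z : FundamentalGroupoid Surf}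
    (h : FundamentalGroupoid.mk (vtx k) ⟶ Z) :
    vtxClass ε δ i j ≫ vtxClass ε δ j k ≫ h = vtxClass ε δ i k ≫ h := by
  rw [← Category.assoc, vtxClass_comp]

/-- Two vertices of the same oval are joined in it, hence in the same way in the two faces that meet
in the oval. -/
lemma vtxClass_oval {i j : Fin 6} (h : ovalIdx i = ovalIdx j) (δ : Bool) :
    vtxClass true δ i j = vtxClass false δ i j :=
  faceClass_eq_of_ovalSet (vtx_mem_ovalSet i) (h ▸ vtx_mem_ovalSet j) _ _ _ _

lemma vtxClass_circ {i j : Fin 6} (h : circIdx i = circIdx j) (ε : Bool) :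
    vtxClass ε true i j = vtxClass ε false i j :=
  faceClass_eq_of_circSet (vtx_mem_circSet i) (h ▸ vtx_mem_circSet j) _ _ _ _

/-- The loop at the leftmost vertex that goes to the `i`-th vertex in the face `(ε, δ)` and returns
in the face with `y, z ≥ 0`. -/
def loopLabel (i : Fin 6) (ε δ : Bool) : FundamentalGroup Surf (vtx 0) :=
  vtxClass ε δ 0 i ≫ vtxClass true true i 0

lemma loopLabel_inv (i : Fin 6) (ε δ : Bool) :
    (loopLabel i ε δ)⁻¹ = vtxClass true true 0 i ≫ vtxClass ε δ i 0 := by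
  have h : (vtxClass true true 0 i ≫ vtxClass ε δ i 0) ≫
      (vtxClass ε δ 0 i ≫ vtxClass true true i 0) = 𝟙 _ := by simp
  rw [inv_eq_iff_mul_eq_one]
  exact h

lemma loopLabel_mul_inv (i j : Fin 6) (ε δ : Bool) : loopLabel i ε δ * (loopLabel j ε δ)⁻¹ =
    vtxClass true true 0 j ≫ vtxClass ε δ j i ≫ vtxClass true true i 0 := by
  have h : (vtxClass true true 0 j ≫ vtxClass ε δ j 0) ≫
      (vtxClass ε δ 0 i ≫ vtxClass true true i 0) =
      vtxClass true true 0 j ≫ vtxClass ε δ j i ≫ vtxClass true true i 0 := by simp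
  rw [loopLabel_inv]
  exact h

/-- In the fundamental group the product `p * q` is the class of the loop `q` followed by `p`. -/
lemma isLabelling_loopLabel : IsLabelling loopLabel where
  base ε δ := by simp [loopLabel]
  front i := by simp [loopLabel]
  oval i j hij δ := by
    rw [loopLabel_mul_inv, loopLabel_mul_inv, vtxClass_oval hij.symm]
  circ i j hij ε := by
    rw [loopLabel_mul_inv, loopLabel_mul_inv, vtxClass_circ hij.symm]

/-- The homomorphism from the surface group to the fundamental group. -/
def gamma2ToPi : Gamma2 →* FundamentalGroup Surf (vtx 0) :=
  gamma2Hom (IsLabelling.quad loopLabel) isLabelling_loopLabel.quad_relation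

lemma gamma2ToPi_gen (j : Fin 4) : gamma2ToPi (gamma2Gen j) = IsLabelling.quad loopLabel j :=
  gamma2Hom_gen _ _ _

/-! ### The covering of the surface given by a labelling -/

lemma isClosed_face (ε δ : Bool) : IsClosed (face ε δ) :=
  (isClosed_le continuous_const (continuous_const.mul (Surf.continuous_coord 1))).inter
    (isClosed_le continuous_const (continuous_const.mul (Surf.continuous_coord 2)))

lemma isClosed_ovalSet (k : Fin 3) : IsClosed (ovalSet k) :=
  (isClosed_eq (Surf.continuous_coord 1) continuous_const).inter
    ((isClosed_le continuous_const (Surf.continuous_coord 0)).inter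
      (isClosed_le (Surf.continuous_coord 0) continuous_const))

lemma isClosed_circSet (k : Fin 3) : IsClosed (circSet k) :=
  (isClosed_eq (Surf.continuous_coord 2) continuous_const).inter
    (isClosed_eq ((((Surf.continuous_coord 0).sub continuous_const).pow 2).add
      ((Surf.continuous_coord 1).pow 2)) continuous_const)

lemma ovalSet_disjoint {q : Surf} {k l : Fin 3} (hk : q ∈ ovalSet k) (hl : q ∈ ovalSet l) :
    k = l := by
  obtain ⟨-, h1, h2⟩ := hk
  obtain ⟨-, h3, h4⟩ := hl
  fin_cases k <;> fin_cases l <;> first | rfl | (simp [ovalL, ovalR] at h1 h2 h3 h4; linarith)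

lemma circSet_disjoint {q : Surf} {k l : Fin 3} (hk : q ∈ circSet k) (hl : q ∈ circSet l) :
    k = l := by
  obtain ⟨-, h1⟩ := hk
  obtain ⟨-, h2⟩ := hl
  fin_cases k <;> fin_cases l <;> first
    | rfl
    | (simp [circC, circR] at h1 h2
       nlinarith [sq_nonneg (q.1 1)])

/-- The open star of a vertex: the complement of the ovals and circles not containing the vertex. -/
def vtxStar (i : Fin 6) : Set Surf :=
  {q | (∀ k, q ∈ ovalSet k → ovalIdx i = k) ∧ ∀ k, q ∈ circSet k → circIdx i = k}

lemma isOpen_vtxStar (i : Fin 6) : IsOpen (vtxStar i) := by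
  have : vtxStar i = (⋂ k, {q | ovalIdx i = k} ∪ (ovalSet k)ᶜ) ∩
      ⋂ k, {q | circIdx i = k} ∪ (circSet k)ᶜ := by
    ext q
    simp [vtxStar, imp_iff_or_not]
  rw [this]
  refine (isOpen_iInter_of_finite fun k => ?_).inter (isOpen_iInter_of_finite fun k => ?_)
  · exact isOpen_const.union (isClosed_ovalSet k).isOpen_compl
  · exact isOpen_const.union (isClosed_circSet k).isOpen_compl

lemma exists_mem_vtxStar (q : Surf) : ∃ i, q ∈ vtxStar i := by
  have main : ∀ k l, (∀ k', q ∈ ovalSet k' → k = k') → (∀ l', q ∈ circSet l' → l = l') →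
      (∃ i, ovalIdx i = k ∧ circIdx i = l) → ∃ i, q ∈ vtxStar i := by
    rintro k l hk hl ⟨i, rfl, rfl⟩
    exact ⟨i, hk, hl⟩
  by_cases hy : q.1 1 = 0
  · obtain ⟨k, hk⟩ := exists_mem_ovalSet hy
    have hk' : ∀ k', q ∈ ovalSet k' → k = k' := fun k' h => ovalSet_disjoint hk h
    by_cases hz : q.1 2 = 0
    · obtain ⟨l, hl⟩ := exists_mem_circSet hz
      refine main k l hk' (fun l' h => circSet_disjoint hl h) ?_
      obtain ⟨-, h1, h2⟩ := hk
      obtain ⟨-, h3⟩ := hl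
      rw [hy] at h3
      fin_cases k <;> fin_cases l <;> first
        | decide
        | (exfalso
           simp [circC, circR, ovalL, ovalR] at h1 h2 h3
           nlinarith)
    · refine main k (circIdx (![0, 2, 4] k)) hk' (fun l' h => absurd h.1 hz) ⟨_, ?_, rfl⟩
      fin_cases k <;> rfl
  · by_cases hz : q.1 2 = 0
    · obtain ⟨l, hl⟩ := exists_mem_circSet hz
      refine main (ovalIdx (![1, 3, 5] l)) l (fun l' h => absurd h.1 hy)
        (fun l' h => circSet_disjoint hl h) ⟨_, rfl, ?_⟩
      fin_cases l <;> rfl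
    · exact main 0 0 (fun l' h => absurd h.1 hy) (fun l' h => absurd h.1 hz) ⟨1, rfl, rfl⟩

lemma eq_of_vtx_mem_vtxStar {i j : Fin 6} (h : vtx i ∈ vtxStar j) : j = i := by
  have h1 := h.1 _ (vtx_mem_ovalSet i)
  have h2 := h.2 _ (vtx_mem_circSet i)
  revert h1 h2
  clear h
  revert i j
  decide

/-- Some face that contains a given point. -/
lemma exists_mem_face (q : Surf) : q ∈ face (decide (0 ≤ q.1 1)) (decide (0 ≤ q.1 2)) := by
  constructor
  · by_cases h : 0 ≤ q.1 1
    · simp [sg, h]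
    · simp only [h, sg]
      push Not at h
      simpa using h.le
  · by_cases h : 0 ≤ q.1 2
    · simp [sg, h]
    · simp only [h, sg]
      push Not at h
      simpa using h.le

/-- Near a point there are only the faces that contain it. -/
lemma eventually_face (q₀ : Surf) :
    ∀ᶠ q in 𝓝 q₀, ∀ ε δ, q ∈ face ε δ → q₀ ∈ face ε δ := by
  simp only [Filter.eventually_all]
  intro ε δ
  by_cases h : q₀ ∈ face ε δ
  · exact Filter.Eventually.of_forall fun _ _ => h
  · filter_upwards [(isClosed_face ε δ).isOpen_compl.mem_nhds h] with q hq hq'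
    exact absurd hq' hq

section Covering

variable {G : Type*} [Group G] {P : Fin 6 → Bool → Bool → G}

/-- The transition from the chart at the vertex `j` to the chart at `i`. It is computed in one of the
faces that contain the point; by `IsLabelling.labelTrans_eq` every other one gives the same. -/
def labelTrans (P : Fin 6 → Bool → Bool → G) (i j : Fin 6) (q : Surf) : G :=
  P i (decide (0 ≤ q.1 1)) (decide (0 ≤ q.1 2)) *
    (P j (decide (0 ≤ q.1 1)) (decide (0 ≤ q.1 2)))⁻¹

lemma IsLabelling.labelTrans_eq (hP : IsLabelling P) {i j : Fin 6} {q : Surf}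
    (hi : q ∈ vtxStar i) (hj : q ∈ vtxStar j) {ε δ : Bool} (h : q ∈ face ε δ) :
    labelTrans P i j q = P i ε δ * (P j ε δ)⁻¹ := by
  have hq := exists_mem_face q
  rw [labelTrans]
  generalize decide (0 ≤ q.1 1) = ε' at *
  generalize decide (0 ≤ q.1 2) = δ' at *
  have hy : ε' ≠ ε → ovalIdx i = ovalIdx j := by
    intro hne
    have hy : q.1 1 = 0 := by
      have h1 := h.1
      have h2 := hq.1
      cases ε <;> cases ε' <;> simp [sg] at * <;> linarith
    obtain ⟨k, hk⟩ := exists_mem_ovalSet hy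
    rw [hi.1 k hk, hj.1 k hk]
  have hz : δ' ≠ δ → circIdx i = circIdx j := by
    intro hne
    have hz : q.1 2 = 0 := by
      have h1 := h.2
      have h2 := hq.2
      cases δ <;> cases δ' <;> simp [sg] at * <;> linarith
    obtain ⟨k, hk⟩ := exists_mem_circSet hz
    rw [hi.2 k hk, hj.2 k hk]
  have e1 : P i ε' δ' * (P j ε' δ')⁻¹ = P i ε δ' * (P j ε δ')⁻¹ := by
    rcases eq_or_ne ε' ε with rfl | hne
    · rfl
    · have := hP.oval i j (hy hne) δ'
      cases ε <;> cases ε' <;> first | exact absurd rfl hne | exact this | exact this.symm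
  have e2 : P i ε δ' * (P j ε δ')⁻¹ = P i ε δ * (P j ε δ)⁻¹ := by
    rcases eq_or_ne δ' δ with rfl | hne
    · rfl
    · have := hP.circ i j (hz hne) ε
      cases δ <;> cases δ' <;> first | exact absurd rfl hne | exact this | exact this.symm
  rw [e1, e2]

variable [TopologicalSpace G] [DiscreteTopology G]

/-- The principal `G`-bundle of a labelling, with one chart for the star of every vertex. -/
def IsLabelling.bundle (hP : IsLabelling P) : FiberBundleCore (Fin 6) Surf G where
  baseSet := vtxStar
  isOpen_baseSet := isOpen_vtxStar
  indexAt q := (exists_mem_vtxStar q).choose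
  mem_baseSet_at q := (exists_mem_vtxStar q).choose_spec
  coordChange i j q v := labelTrans P j i q * v
  coordChange_self i q _ v := by simp [labelTrans]
  continuousOn_coordChange i j := by
    rintro ⟨q₀, v₀⟩ ⟨⟨hi, hj⟩, -⟩
    refine ContinuousAt.continuousWithinAt ?_
    have hev : ∀ᶠ p : Surf × G in 𝓝 (q₀, v₀),
        labelTrans P j i q₀ * p.2 = labelTrans P j i p.1 * p.2 := by
      have : ∀ᶠ q in 𝓝 q₀, labelTrans P j i q₀ = labelTrans P j i q := by
        filter_upwards [eventually_face q₀] with q h3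
        exact hP.labelTrans_eq hj hi (h3 _ _ (exists_mem_face q))
      filter_upwards [(continuous_fst.tendsto (q₀, v₀)).eventually this] with p hp
      rw [hp]
    refine ContinuousAt.congr ?_ hev
    exact (continuous_of_discreteTopology (f := fun v : G => labelTrans P j i q₀ * v)).continuousAt.comp
      continuousAt_snd
  coordChange_comp i j k q hq v := by
    simp [labelTrans, ← mul_assoc]

variable (hP : IsLabelling P)

lemma IsLabelling.isCoveringMap : IsCoveringMap (Bundle.TotalSpace.proj (F := G) (E := hP.bundle.Fiber)) :=
  FiberBundle.isCoveringMap

/-- The point over `q` with the coordinate `u` with respect to the face `(ε, δ)`. -/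
def IsLabelling.pt (ε δ : Bool) (q : Surf) (u : G) :
    (Bundle.TotalSpace.proj (F := G) (E := hP.bundle.Fiber)) ⁻¹' {q} :=
  ⟨⟨q, P (hP.bundle.indexAt q) ε δ * u⟩, rfl⟩

/-- Paths in a face keep the coordinate with respect to this face. -/
lemma IsLabelling.monodromy_faceClass {ε δ : Bool} {a b : Surf} (ha : a ∈ face ε δ)
    (hb : b ∈ face ε δ) (u : G) :
    hP.isCoveringMap.monodromy (faceClass ε δ ha hb) (hP.pt ε δ a u) = hP.pt ε δ b u := by
  obtain ⟨γ, hγ, e⟩ := exists_path_faceClass ha hb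
  rw [← e]
  refine Subtype.ext ?_
  let Γ : C(I, Bundle.TotalSpace G hP.bundle.Fiber) :=
    ⟨fun t => (hP.pt ε δ (γ t) u).1, by
      rw [continuous_iff_continuousAt]
      intro t₀
      rw [FiberBundle.continuousAt_totalSpace G]
      refine ⟨γ.continuous.continuousAt, ?_⟩
      have hev : ∀ᶠ t in 𝓝 t₀, P (hP.bundle.indexAt (γ t₀)) ε δ * u =
          labelTrans P (hP.bundle.indexAt (γ t₀)) (hP.bundle.indexAt (γ t)) (γ t) *
            (P (hP.bundle.indexAt (γ t)) ε δ * u) := by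
        filter_upwards [γ.continuous.continuousAt.eventually
          ((isOpen_vtxStar _).mem_nhds (hP.bundle.mem_baseSet_at (γ t₀)))] with t ht
        rw [hP.labelTrans_eq ht (hP.bundle.mem_baseSet_at (γ t)) (hγ t)]
        simp [mul_assoc]
      exact continuousAt_const.congr hev⟩
  have key : Γ = hP.isCoveringMap.liftPath γ (hP.pt ε δ a u).1
      (γ.source.trans (hP.pt ε δ a u).2.symm) := by
    rw [IsCoveringMap.eq_liftPath_iff']
    exact ⟨rfl, congrArg (fun q => (hP.pt ε δ q u).1) γ.source⟩
  change hP.isCoveringMap.liftPath γ (hP.pt ε δ a u).1 _ 1 = _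
  rw [← key]
  exact congrArg (fun q => (hP.pt ε δ q u).1) γ.target

lemma IsLabelling.pt_vtx (ε δ ε' δ' : Bool) (i : Fin 6) (u : G) :
    hP.pt ε δ (vtx i) u = hP.pt ε' δ' (vtx i) ((P i ε' δ')⁻¹ * P i ε δ * u) := by
  have : hP.bundle.indexAt (vtx i) = i :=
    eq_of_vtx_mem_vtxStar (hP.bundle.mem_baseSet_at (vtx i))
  simp only [IsLabelling.pt, this]
  simp [mul_assoc]

/-- The loops of the vertices act on the fibre over the base point by left multiplication with the
labels. -/
lemma IsLabelling.monodromy_loopLabel (i : Fin 6) (ε δ : Bool) (u : G) :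
    hP.isCoveringMap.monodromy (loopLabel i ε δ) (hP.pt true true (vtx 0) u) =
      hP.pt true true (vtx 0) (P i ε δ * u) := by
  change hP.isCoveringMap.monodromy (Path.Homotopic.Quotient.trans (vtxClass ε δ 0 i)
    (vtxClass true true i 0)) _ = _
  rw [IsCoveringMap.monodromy_trans_apply, hP.pt_vtx _ _ ε δ, vtxClass, vtxClass,
    hP.monodromy_faceClass, hP.pt_vtx ε δ true true, hP.monodromy_faceClass]
  simp [hP.base, hP.front]

/-- The pairs of an element of the fundamental group and the element of `G` by which it acts on the
fibre over the base point. -/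
def IsLabelling.graph : Subgroup (FundamentalGroup Surf (vtx 0) × G) where
  carrier := {x | ∀ u, hP.isCoveringMap.monodromyPerm (vtx 0) x.1 (hP.pt true true (vtx 0) u) =
    hP.pt true true (vtx 0) (x.2 * u)}
  mul_mem' {x y} hx hy u := by
    simp only [Prod.fst_mul, map_mul, Equiv.Perm.mul_apply, Prod.snd_mul, mul_assoc]
    rw [hy, hx]
  one_mem' u := by
    refine (congrFun hP.isCoveringMap.monodromy_refl (hP.pt true true (vtx 0) u)).trans ?_
    simp
  inv_mem' {x} hx u := by
    simp only [Prod.fst_inv, map_inv, Prod.snd_inv]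
    rw [Equiv.Perm.inv_eq_iff_eq, hx]
    simp

lemma IsLabelling.quad_mem_graph (j : Fin 4) :
    (IsLabelling.quad loopLabel j, IsLabelling.quad P j) ∈ hP.graph := by
  have h : ∀ i ε δ, (loopLabel i ε δ, P i ε δ) ∈ hP.graph := hP.monodromy_loopLabel
  have hi : ∀ i ε δ, ((loopLabel i ε δ)⁻¹, (P i ε δ)⁻¹) ∈ hP.graph := fun i ε δ =>
    hP.graph.inv_mem (h i ε δ)
  fin_cases j
  · exact hi 2 false true
  · exact hi 1 true false
  · exact hP.graph.mul_mem (hi 4 false true) (h 2 false true)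
  · exact hP.graph.mul_mem (hP.graph.mul_mem (hi 2 false true) (hi 3 true false)) (h 2 false true)

end Covering

/-- The labelling by elements of the surface group, found by solving `IsLabelling.quad P = gamma2Gen`
for the four free labels. -/
lemma exists_gamma2_labelling : ∃ P : Fin 6 → Bool → Bool → Gamma2,
    IsLabelling P ∧ IsLabelling.quad P = gamma2Gen := by
  refine ⟨stdLabel (gamma2Gen 1)⁻¹ (gamma2Gen 0)⁻¹
    ((gamma2Gen 0)⁻¹ * (gamma2Gen 3)⁻¹ * gamma2Gen 0) ((gamma2Gen 0)⁻¹ * (gamma2Gen 2)⁻¹),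
    isLabelling_stdLabel ?_, ?_⟩
  · have h := gamma2Gen_relation
    rw [mul_eq_one_iff_eq_inv] at h
    generalize gamma2Gen 0 = a at *
    generalize gamma2Gen 1 = b at *
    generalize gamma2Gen 2 = c at *
    generalize gamma2Gen 3 = d at *
    calc _ = a⁻¹ * c⁻¹ * d⁻¹ * ⁅c, d⁆⁻¹ := by rw [commutatorElement_def]; group
      _ = a⁻¹ * c⁻¹ * d⁻¹ * ⁅a, b⁆ := by rw [h]
      _ = _ := by rw [commutatorElement_def]; group
  · funext j
    fin_cases j <;> simp [IsLabelling.quad, stdLabel, mul_assoc]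

/-- The surface group acts freely on the fibre of the covering given by its own labelling. -/
lemma gamma2ToPi_injective : Function.Injective gamma2ToPi := by
  obtain ⟨P, hP, hquad⟩ := exists_gamma2_labelling
  let _ : TopologicalSpace Gamma2 := ⊥
  have : DiscreteTopology Gamma2 := ⟨rfl⟩
  have key : ∀ w, (gamma2ToPi w, w) ∈ hP.graph := by
    have : (⊤ : Subgroup Gamma2) ≤ hP.graph.comap (gamma2ToPi.prod (MonoidHom.id _)) := by
      rw [← closure_range_gamma2Gen, Subgroup.closure_le]
      rintro _ ⟨j, rfl⟩
      have := hP.quad_mem_graph j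
      rwa [hquad, ← gamma2ToPi_gen] at this
    exact fun w => this (Subgroup.mem_top w)
  rw [injective_iff_map_eq_one]
  intro w hw
  have h := key w 1
  simp only [hw, map_one, Equiv.Perm.coe_one, id_eq, mul_one] at h
  have h2 := congrArg (fun x => x.1.2) h
  have h3 := h2.symm
  simp only [IsLabelling.pt, hP.front, one_mul] at h3
  exact h3

/-! ### Annuli in the surface -/

lemma contDiff_surfFun : ContDiff ℝ ∞ surfFun := by
  unfold surfFun; fun_prop

lemma fderiv_surfFun_apply (p u : R3) :
    fderiv ℝ surfFun p u = ∑ i, surfNormal p i * u i := by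
  conv_lhs => rw [pi_eq_sum_univ' u, map_sum]
  refine Finset.sum_congr rfl fun i _ => ?_
  rw [map_smul, smul_eq_mul, mul_comm, surfNormal]

/-- On a convex set where `surfFun` increases in the direction `n`, a line in that direction meets
the surface at most once. -/
lemma eq_zero_of_add_smul_mem {B : Set R3} (hB : Convex ℝ B) {n : R3}
    (hn : ∀ y ∈ B, 0 < fderiv ℝ surfFun y n) {x : R3} {r : ℝ} (hx : x ∈ B) (hxr : x + r • n ∈ B)
    (h : surfFun x = surfFun (x + r • n)) : r = 0 := by
  have hd : ∀ t : ℝ, HasDerivAt (fun t : ℝ => surfFun (x + t • (r • n)))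
      (fderiv ℝ surfFun (x + t • (r • n)) (r • n)) t := by
    intro t
    have h1 : HasDerivAt (fun t : ℝ => x + t • (r • n)) (r • n) t := by
      simpa using ((hasDerivAt_id t).smul_const (r • n)).const_add x
    exact (contDiff_surfFun.differentiable (by simp) _).hasFDerivAt.comp_hasDerivAt t h1
  obtain ⟨t, ht, h0⟩ := exists_hasDerivAt_eq_zero (a := (0 : ℝ)) (b := 1) zero_lt_one
    (fun t _ => (hd t).continuousAt.continuousWithinAt) (by simpa using h) (fun t _ => hd t)
  rw [map_smul, smul_eq_mul, mul_eq_zero] at h0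
  refine h0.resolve_right (hn _ ?_).ne'
  have := hB.add_smul_mem hx hxr (Ioo_subset_Icc_self ht)
  exact this

namespace IsAnnulus

variable {φ : ℝ → ℝ → Surf} {C : Set Surf}

lemma isOpen_strip : IsOpen ((univ : Set ℝ) ×ˢ Ioo (-1 : ℝ) 1) := isOpen_univ.prod isOpen_Ioo

lemma hasFDerivAt (hφ : IsAnnulus φ C) {θ s : ℝ} (hs : s ∈ Ioo (-1 : ℝ) 1) :
    HasFDerivAt (fun q : ℝ × ℝ => (φ q.1 q.2 : R3))
      (fderiv ℝ (fun q : ℝ × ℝ => (φ q.1 q.2 : R3)) (θ, s)) (θ, s) :=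
  ((hφ.smooth.contDiffAt (isOpen_strip.mem_nhds ⟨mem_univ _, hs⟩)).differentiableAt
    (by simp)).hasFDerivAt

lemma hasDerivAt_left (hφ : IsAnnulus φ C) (θ : ℝ) {s : ℝ} (hs : s ∈ Ioo (-1 : ℝ) 1) :
    HasDerivAt (fun a => (φ a s : R3))
      (fderiv ℝ (fun q : ℝ × ℝ => (φ q.1 q.2 : R3)) (θ, s) (1, 0)) θ :=
  (hφ.hasFDerivAt hs).comp_hasDerivAt (f := fun a => (a, s)) θ
    ((hasDerivAt_id θ).prodMk (hasDerivAt_const θ s))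

lemma hasDerivAt_right (hφ : IsAnnulus φ C) (θ : ℝ) {s : ℝ} (hs : s ∈ Ioo (-1 : ℝ) 1) :
    HasDerivAt (fun b => (φ θ b : R3))
      (fderiv ℝ (fun q : ℝ × ℝ => (φ q.1 q.2 : R3)) (θ, s) (0, 1)) s :=
  (hφ.hasFDerivAt hs).comp_hasDerivAt (f := fun b => (θ, b)) s
    ((hasDerivAt_const s θ).prodMk (hasDerivAt_id s))

lemma fderiv_apply (hφ : IsAnnulus φ C) (θ : ℝ) {s : ℝ} (hs : s ∈ Ioo (-1 : ℝ) 1) (a b : ℝ) :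
    fderiv ℝ (fun q : ℝ × ℝ => (φ q.1 q.2 : R3)) (θ, s) (a, b) =
      a • deriv (fun a => (φ a s : R3)) θ + b • deriv (fun b => (φ θ b : R3)) s := by
  rw [(hφ.hasDerivAt_left θ hs).deriv, (hφ.hasDerivAt_right θ hs).deriv, ← map_smul, ← map_smul,
    ← map_add]
  simp

/-- An annulus has smooth local coordinates, defined on an open set of the ambient space: the inverse
of the thickened annulus `(θ, s, r) ↦ φ θ s + r N`, with `N` the normal at the given point. -/
lemma exists_chart (hφ : IsAnnulus φ C) (θ₀ : ℝ) {s₀ : ℝ} (hs₀ : s₀ ∈ Ioo (-1 : ℝ) 1) :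
    ∃ (Θ : R3 → ℝ × ℝ) (U : Set R3), IsOpen U ∧ (φ θ₀ s₀ : R3) ∈ U ∧ ContDiffOn ℝ ∞ Θ U ∧
      Θ (φ θ₀ s₀) = (θ₀, s₀) ∧ (∀ q ∈ U, (Θ q).2 ∈ Ioo (-1 : ℝ) 1) ∧
      ∀ q : Surf, (q : R3) ∈ U → φ (Θ q).1 (Θ q).2 = q := by
  set Φ : ℝ × ℝ → R3 := fun q => (φ q.1 q.2 : R3) with hΦ
  set N : R3 := surfNormal (φ θ₀ s₀) with hN
  have hor := hφ.oriented θ₀ s₀ hs₀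
  rw [surfOrient, ← hN] at hor
  -- the surface is transverse to `N` near the given point
  have hNN : 0 < fderiv ℝ surfFun (φ θ₀ s₀) N := by
    rw [fderiv_surfFun_apply, ← hN]
    have hnn : ∀ i ∈ Finset.univ, 0 ≤ N i * N i := fun i _ => mul_self_nonneg (N i)
    refine (Finset.sum_nonneg hnn).lt_of_ne fun h0 => hor.ne' ?_
    have hz : N = 0 := funext fun i =>
      mul_self_eq_zero.1 ((Finset.sum_eq_zero_iff_of_nonneg hnn).1 h0.symm i (Finset.mem_univ i))
    exact Matrix.det_eq_zero_of_row_eq_zero 0 fun j => by simp [hz]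
  have hev : ∀ᶠ y in 𝓝 (φ θ₀ s₀ : R3), 0 < fderiv ℝ surfFun y N :=
    (((contDiff_surfFun.continuous_fderiv (by simp)).clm_apply
      continuous_const).continuousAt).eventually (lt_mem_nhds hNN)
  obtain ⟨ε, hε, hB⟩ := Metric.eventually_nhds_iff_ball.1 hev
  set B := Metric.ball (φ θ₀ s₀ : R3) ε
  let Ξ : (ℝ × ℝ) × ℝ → R3 := fun w => Φ w.1 + w.2 • N
  let D : Set ((ℝ × ℝ) × ℝ) := ((univ : Set ℝ) ×ˢ Ioo (-1 : ℝ) 1) ×ˢ univ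
  have hD : IsOpen D := isOpen_strip.prod isOpen_univ
  have hΞ : ContDiffOn ℝ ∞ Ξ D :=
    (hφ.smooth.comp contDiff_fst.contDiffOn fun w hw => hw.1).add
      (contDiff_snd.smul contDiff_const).contDiffOn
  let w₀ : (ℝ × ℝ) × ℝ := ((θ₀, s₀), 0)
  have hw₀ : w₀ ∈ D := ⟨⟨mem_univ _, hs₀⟩, mem_univ _⟩
  let L : (ℝ × ℝ) × ℝ →L[ℝ] R3 := (fderiv ℝ Φ (θ₀, s₀)).comp (ContinuousLinearMap.fst ℝ _ _) +
    (ContinuousLinearMap.snd ℝ (ℝ × ℝ) ℝ).smulRight N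
  have hL : HasFDerivAt Ξ L w₀ :=
    (HasFDerivAt.comp (f := Prod.fst) w₀ (hφ.hasFDerivAt hs₀) hasFDerivAt_fst).add
      ((hasFDerivAt_snd (p := w₀)).smul_const N)
  have hinj : Function.Injective (L : (ℝ × ℝ) × ℝ →ₗ[ℝ] R3) := by
    rw [← LinearMap.ker_eq_bot, LinearMap.ker_eq_bot']
    rintro ⟨⟨a, b⟩, r⟩ h
    have h' : a • deriv (fun a => (φ a s₀ : R3)) θ₀ + b • deriv (fun b => (φ θ₀ b : R3)) s₀ +
        r • N = 0 := by
      rw [← hφ.fderiv_apply θ₀ hs₀]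
      exact h
    have h2 := Matrix.eq_zero_of_vecMul_eq_zero hor.ne' (v := ![r, b, a]) (by
      rw [← h']
      funext j
      simp [Matrix.vecMul, dotProduct, Fin.sum_univ_three]
      ring)
    have e0 : r = 0 := congrFun h2 0
    have e1 : b = 0 := congrFun h2 1
    have e2 : a = 0 := congrFun h2 2
    rw [e0, e1, e2]
    rfl
  let E : ((ℝ × ℝ) × ℝ) ≃L[ℝ] R3 :=
    ((L : (ℝ × ℝ) × ℝ →ₗ[ℝ] R3).linearEquivOfInjective hinj (by simp)).toContinuousLinearEquiv
  have hE : (E : (ℝ × ℝ) × ℝ →L[ℝ] R3) = L := by ext <;> rfl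
  have hst : HasStrictFDerivAt Ξ (E : (ℝ × ℝ) × ℝ →L[ℝ] R3) w₀ := by
    rw [hE]
    exact (hΞ.contDiffAt (hD.mem_nhds hw₀)).hasStrictFDerivAt' hL (by simp)
  let f := hst.toOpenPartialHomeomorph
  let W : Set ((ℝ × ℝ) × ℝ) := (D ∩ fderiv ℝ Ξ ⁻¹' range ContinuousLinearEquiv.toContinuousLinearMap)
    ∩ (D ∩ (fun w => Φ w.1) ⁻¹' B)
  have hW : IsOpen W :=
    ((hΞ.continuousOn_fderiv_of_isOpen hD (by simp)).isOpen_inter_preimage hD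
      ContinuousLinearEquiv.isOpen).inter
    (((hφ.smooth.continuousOn.comp continuousOn_fst fun w hw => hw.1)).isOpen_inter_preimage hD
      Metric.isOpen_ball)
  have hw₀W : w₀ ∈ W := ⟨⟨hw₀, E, by rw [hL.fderiv, hE]⟩, hw₀, Metric.mem_ball_self hε⟩
  have hfw₀ : f w₀ = φ θ₀ s₀ := by
    change Φ (θ₀, s₀) + (0 : ℝ) • N = _
    simp [hΦ]
  have hsource : w₀ ∈ f.source := hst.mem_toOpenPartialHomeomorph_source
  have hsymm : f.symm (φ θ₀ s₀) = w₀ := by rw [← hfw₀, f.left_inv hsource]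
  refine ⟨fun x => (f.symm x).1, (f.target ∩ f.symm ⁻¹' W) ∩ B,
    (f.isOpen_inter_preimage_symm hW).inter Metric.isOpen_ball,
    ⟨⟨hfw₀ ▸ f.map_source hsource, by rwa [mem_preimage, hsymm]⟩, Metric.mem_ball_self hε⟩,
    ?_, congrArg Prod.fst hsymm, fun q hq => hq.1.2.1.1.1.2, ?_⟩
  · intro x hx
    obtain ⟨⟨hxt, ⟨hxD, E', hE'⟩, -⟩, -⟩ := hx
    have hsm := hΞ.contDiffAt (hD.mem_nhds hxD)
    refine (contDiff_fst.contDiffAt.comp x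
      (f.contDiffAt_symm hxt (f₀' := E') ?_ hsm)).contDiffWithinAt
    rw [hE']
    exact (hsm.differentiableAt (by simp)).hasFDerivAt
  · rintro q ⟨⟨hqt, -, -, hqB⟩, hqB'⟩
    have hr : Φ (f.symm q).1 + (f.symm q).2 • N = q := f.right_inv hqt
    have h0 : (f.symm q).2 = 0 := by
      refine eq_zero_of_add_smul_mem (convex_ball _ _) hB hqB (by rw [hr]; exact hqB') ?_
      rw [hr]
      exact (φ (f.symm q).1.1 (f.symm q).1.2).2.trans q.2.symm
    rw [h0, zero_smul, add_zero] at hr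
    exact Subtype.ext hr

lemma continuousOn (hφ : IsAnnulus φ C) :
    ContinuousOn (fun q : ℝ × ℝ => φ q.1 q.2) ((univ : Set ℝ) ×ˢ Ioo (-1 : ℝ) 1) :=
  Topology.IsInducing.subtypeVal.continuousOn_iff.2 hφ.smooth.continuousOn

lemma add_int (hφ : IsAnnulus φ C) (θ : ℝ) (n : ℤ) {s : ℝ} (hs : s ∈ Ioo (-1 : ℝ) 1) :
    φ (θ + n) s = φ θ s :=
  ((hφ.inj _ _ s hs s hs).2 ⟨rfl, n, rfl⟩).symm

/-- The closed subannuli are closed in the surface. -/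
lemma isClosed_band (hφ : IsAnnulus φ C) {c : ℝ} (hc : c < 1) :
    IsClosed {q | ∃ θ : ℝ, ∃ s ∈ Icc (-c) c, φ θ s = q} := by
  have hsub : Icc (-c) c ⊆ Ioo (-1 : ℝ) 1 := fun s hs => ⟨by linarith [hs.1], by linarith [hs.2]⟩
  have : {q | ∃ θ : ℝ, ∃ s ∈ Icc (-c) c, φ θ s = q} =
      (fun q : ℝ × ℝ => φ q.1 q.2) '' (Icc (0 : ℝ) 1 ×ˢ Icc (-c) c) := by
    ext q
    constructor
    · rintro ⟨θ, s, hs, rfl⟩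
      refine ⟨(Int.fract θ, s), ⟨⟨Int.fract_nonneg _, (Int.fract_lt_one _).le⟩, hs⟩, ?_⟩
      have := hφ.add_int (Int.fract θ) ⌊θ⌋ (hsub hs)
      rw [Int.fract_add_floor] at this
      exact this.symm
    · rintro ⟨⟨θ, s⟩, ⟨-, hs⟩, rfl⟩
      exact ⟨θ, s, hs, rfl⟩
  rw [this]
  exact ((isCompact_Icc.prod isCompact_Icc).image_of_continuousOn
    (hφ.continuousOn.mono fun q hq => ⟨mem_univ _, hsub hq.2⟩)).isClosed

open Classical in
/-- The map that turns the circle `s` of the annulus `φ` by `c s` and is the identity off the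
annulus. -/
def twist (φ : ℝ → ℝ → Surf) (c : ℝ → ℝ) (q : Surf) : Surf :=
  if h : ∃ x : ℝ × ℝ, x.2 ∈ Ioo (-1 : ℝ) 1 ∧ φ x.1 x.2 = q then
    φ (h.choose.1 + c h.choose.2) h.choose.2 else q

lemma twist_apply (hφ : IsAnnulus φ C) (c : ℝ → ℝ) (θ : ℝ) {s : ℝ} (hs : s ∈ Ioo (-1 : ℝ) 1) :
    twist φ c (φ θ s) = φ (θ + c s) s := by
  have h : ∃ x : ℝ × ℝ, x.2 ∈ Ioo (-1 : ℝ) 1 ∧ φ x.1 x.2 = φ θ s := ⟨(θ, s), hs, rfl⟩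
  rw [twist, dif_pos h]
  obtain ⟨h1, h2⟩ := h.choose_spec
  generalize h.choose = x at h1 h2
  obtain ⟨e, n, hn⟩ := (hφ.inj _ _ _ h1 _ hs).1 h2
  rw [e, hn, add_right_comm, hφ.add_int _ _ hs]

lemma twist_of_forall_ne {c : ℝ → ℝ} {q : Surf}
    (h : ∀ θ : ℝ, ∀ s ∈ Ioo (-1 : ℝ) 1, q ≠ φ θ s) : twist φ c q = q := by
  rw [twist, dif_neg]
  rintro ⟨x, hx, e⟩
  exact h _ _ hx e.symm

/-- A map `t` that agrees with a twist in the annulus and is the identity off it is this twist. -/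
lemma eq_twist (hφ : IsAnnulus φ C) {c : ℝ → ℝ} {t : Surf → Surf}
    (h1 : ∀ θ : ℝ, ∀ s ∈ Ioo (-1 : ℝ) 1, t (φ θ s) = φ (θ + c s) s)
    (h2 : ∀ p : Surf, (∀ θ : ℝ, ∀ s ∈ Ioo (-1 : ℝ) 1, p ≠ φ θ s) → t p = p) : t = twist φ c := by
  funext q
  by_cases h : ∀ θ : ℝ, ∀ s ∈ Ioo (-1 : ℝ) 1, q ≠ φ θ s
  · rw [h2 q h, twist_of_forall_ne h]
  · push Not at h
    obtain ⟨θ, s, hs, rfl⟩ := h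
    rw [h1 θ s hs, hφ.twist_apply c θ hs]

lemma twist_comp (hφ : IsAnnulus φ C) (c d : ℝ → ℝ) (q : Surf) :
    twist φ c (twist φ d q) = twist φ (fun s => c s + d s) q := by
  by_cases h : ∀ θ : ℝ, ∀ s ∈ Ioo (-1 : ℝ) 1, q ≠ φ θ s
  · simp only [twist_of_forall_ne h]
  · push Not at h
    obtain ⟨θ, s, hs, rfl⟩ := h
    rw [hφ.twist_apply _ _ hs, hφ.twist_apply _ _ hs, hφ.twist_apply _ _ hs, add_assoc,
      add_comm (d s)]

lemma twist_zero (hφ : IsAnnulus φ C) (q : Surf) : twist φ (fun _ => 0) q = q := by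
  by_cases h : ∀ θ : ℝ, ∀ s ∈ Ioo (-1 : ℝ) 1, q ≠ φ θ s
  · rw [twist_of_forall_ne h]
  · push Not at h
    obtain ⟨θ, s, hs, rfl⟩ := h
    rw [hφ.twist_apply _ _ hs, add_zero]

/-- A twist moves no point outside of the closed subannulus `|s| ≤ 1/2`. -/
lemma twist_eq_self (hφ : IsAnnulus φ C) {c : ℝ → ℝ} {n : ℤ} (h0 : ∀ s ≤ -(1 / 2 : ℝ), c s = 0)
    (h1 : ∀ s ≥ (1 / 2 : ℝ), c s = n) {q : Surf}
    (hq : ¬ ∃ θ : ℝ, ∃ s ∈ Icc (-(1 / 2) : ℝ) (1 / 2), φ θ s = q) : twist φ c q = q := by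
  by_cases h : ∀ θ : ℝ, ∀ s ∈ Ioo (-1 : ℝ) 1, q ≠ φ θ s
  · rw [twist_of_forall_ne h]
  · push Not at h
    obtain ⟨θ, s, hs, rfl⟩ := h
    rw [hφ.twist_apply _ _ hs]
    rcases le_or_gt s (-(1 / 2)) with h2 | h2
    · rw [h0 s h2, add_zero]
    · rcases le_or_gt (1 / 2) s with h3 | h3
      · rw [h1 s h3, hφ.add_int _ _ hs]
      · exact absurd ⟨θ, s, ⟨h2.le, h3.le⟩, rfl⟩ hq

/-- A continuous family of turning functions gives a continuous family of twists. -/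
lemma continuous_twist (hφ : IsAnnulus φ C) {X : Type*} [TopologicalSpace X] {c : X → ℝ → ℝ}
    (hc : Continuous fun x : X × ℝ => c x.1 x.2) {n : ℤ}
    (h0 : ∀ x, ∀ s ≤ -(1 / 2 : ℝ), c x s = 0) (h1 : ∀ x, ∀ s ≥ (1 / 2 : ℝ), c x s = n) :
    Continuous fun x : X × Surf => twist φ (c x.1) x.2 := by
  rw [continuous_iff_continuousAt]
  rintro ⟨x₀, q₀⟩
  by_cases h : ∃ θ : ℝ, ∃ s ∈ Icc (-(1 / 2) : ℝ) (1 / 2), φ θ s = q₀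
  · obtain ⟨θ₀, s₀, hs₀, rfl⟩ := h
    have hs₀' : s₀ ∈ Ioo (-1 : ℝ) 1 := ⟨by linarith [hs₀.1], by linarith [hs₀.2]⟩
    obtain ⟨Θ, U, hU, hmem, hΘ, -, hΘs, hΘq⟩ := hφ.exists_chart θ₀ hs₀'
    let V : Set (X × Surf) := (fun x => (x.2 : R3)) ⁻¹' U
    have hV : IsOpen V := hU.preimage (continuous_subtype_val.comp continuous_snd)
    have hΘc : ContinuousOn (fun x : X × Surf => Θ x.2) V :=
      hΘ.continuousOn.comp (continuous_subtype_val.comp continuous_snd).continuousOn fun x hx => hx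
    have hmain : ContinuousOn (fun x : X × Surf =>
        φ ((Θ x.2).1 + c x.1 (Θ x.2).2) (Θ x.2).2) V := by
      have hc2 : ContinuousOn (fun x : X × Surf => c x.1 (Θ x.2).2) V :=
        hc.comp_continuousOn (f := fun x : X × Surf => (x.1, (Θ x.2).2))
          (continuous_fst.continuousOn.prodMk (continuous_snd.comp_continuousOn hΘc))
      exact hφ.continuousOn.comp (f := fun x : X × Surf => ((Θ x.2).1 + c x.1 (Θ x.2).2, (Θ x.2).2))
        (((continuous_fst.comp_continuousOn hΘc).add hc2).prodMk
          (continuous_snd.comp_continuousOn hΘc)) fun x hx => ⟨mem_univ _, hΘs _ hx⟩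
    refine (hmain.continuousAt (hV.mem_nhds hmem)).congr ?_
    filter_upwards [hV.mem_nhds hmem] with x hx
    rw [← hφ.twist_apply _ _ (hΘs _ hx), hΘq _ hx]
  · have hcl := hφ.isClosed_band (c := 1 / 2) (by norm_num)
    refine continuous_snd.continuousAt.congr ?_
    filter_upwards [(hcl.isOpen_compl.preimage continuous_snd).mem_nhds h] with x hx
    exact (hφ.twist_eq_self (h0 _) (h1 _) hx).symm

end IsAnnulus

/-! ### Dehn twists are diffeomorphisms -/

namespace IsAnnulus

variable {φ : ℝ → ℝ → Surf} {C : Set Surf}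

lemma _root_.surfOrient_add_smul (p u v : R3) (a b c d : ℝ) :
    surfOrient p (a • u + b • v) (c • u + d • v) = (b * c - a * d) * surfOrient p v u := by
  simp only [surfOrient, Matrix.det_fin_three, Matrix.of_apply, Matrix.cons_val', Matrix.cons_val,
    Pi.add_apply, Pi.smul_apply, smul_eq_mul]
  ring

/-- In the coordinates of the annulus a twist is the shear `(θ, s) ↦ (θ + c s, s)`, which has
determinant `1`. -/
lemma isSmoothOriented_twist (hφ : IsAnnulus φ C) {c : ℝ → ℝ} (hc : ContDiff ℝ ∞ c) {n : ℤ}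
    (h0 : ∀ s ≤ -(1 / 2 : ℝ), c s = 0) (h1 : ∀ s ≥ (1 / 2 : ℝ), c s = n) :
    IsSmoothOriented (twist φ c) := by
  intro p
  by_cases h : ∃ θ : ℝ, ∃ s ∈ Icc (-(1 / 2) : ℝ) (1 / 2), φ θ s = p
  · obtain ⟨θ₀, s₀, hs₀', rfl⟩ := h
    have hs₀ : s₀ ∈ Ioo (-1 : ℝ) 1 := ⟨by linarith [hs₀'.1], by linarith [hs₀'.2]⟩
    obtain ⟨Θ, U, hU, hmem, hΘ, hΘ₀, hΘs, hΘq⟩ := hφ.exists_chart θ₀ hs₀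
    set Φ : ℝ × ℝ → R3 := fun q => (φ q.1 q.2 : R3) with hΦ
    let τ : ℝ × ℝ → ℝ × ℝ := fun q => (q.1 + c q.2, q.2)
    have hτ : ContDiff ℝ ∞ τ := (contDiff_fst.add (hc.comp contDiff_snd)).prodMk contDiff_snd
    refine ⟨U, fun x => Φ (τ (Θ x)), hU, hmem, ?_, ?_, ?_⟩
    · exact hφ.smooth.comp (hτ.comp_contDiffOn hΘ) fun x hx => ⟨mem_univ _, hΘs x hx⟩
    · intro q hq
      conv_rhs => rw [← hΘq q hq, hφ.twist_apply _ _ (hΘs q hq)]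
    · have hdΘ : HasFDerivAt Θ (fderiv ℝ Θ (φ θ₀ s₀)) (φ θ₀ s₀) :=
        ((hΘ.contDiffAt (hU.mem_nhds hmem)).differentiableAt (by simp)).hasFDerivAt
      have hdτ : HasFDerivAt τ ((ContinuousLinearMap.fst ℝ ℝ ℝ +
          (ContinuousLinearMap.snd ℝ ℝ ℝ).smulRight (deriv c s₀)).prod
            (ContinuousLinearMap.snd ℝ ℝ ℝ)) (Θ (φ θ₀ s₀)) := by
        rw [hΘ₀]
        refine (hasFDerivAt_fst.add ?_).prodMk hasFDerivAt_snd
        have h2 := ((hc.differentiable (by simp) s₀).hasDerivAt.hasFDerivAt).comp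
          (θ₀, s₀) (f := Prod.snd) hasFDerivAt_snd
        exact h2.congr_fderiv (ContinuousLinearMap.ext fun x => by simp)
      have hτ₀ : τ (Θ (φ θ₀ s₀)) = (θ₀ + c s₀, s₀) := by rw [hΘ₀]
      have hdΦ' := hφ.hasFDerivAt (θ := θ₀ + c s₀) hs₀
      rw [← hτ₀] at hdΦ'
      have hH := hdΦ'.comp (φ θ₀ s₀ : R3) (hdτ.comp (φ θ₀ s₀ : R3) hdΘ)
      have hdΦ := hφ.hasFDerivAt (θ := θ₀) hs₀
      rw [← hΘ₀] at hdΦ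
      have hid := (hdΦ.comp (φ θ₀ s₀ : R3) hdΘ).hasFDerivWithinAt (s := surfSet)
      -- on tangent vectors the derivative of `Φ ∘ Θ` is the identity, as `Φ ∘ Θ` fixes the surface
      have htan : ∀ u ∈ tangentConeAt ℝ surfSet (φ θ₀ s₀ : R3),
          fderiv ℝ Φ (θ₀, s₀) (fderiv ℝ Θ (φ θ₀ s₀) u) = u := by
        intro u hu
        have hid' : HasFDerivWithinAt (Φ ∘ Θ) (ContinuousLinearMap.id ℝ R3) surfSet
            (φ θ₀ s₀ : R3) := by
          refine (hasFDerivWithinAt_id _ _).congr_of_eventuallyEq ?_ ?_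
          · filter_upwards [mem_nhdsWithin_of_mem_nhds (hU.mem_nhds hmem), self_mem_nhdsWithin]
              with q hqU hq
            exact congrArg Subtype.val (hΘq ⟨q, hq⟩ hqU)
          · exact congrArg Subtype.val (hΘq _ hmem)
        have := hid.unique_on hid' hu
        rwa [hΘ₀] at this
      intro u hu v hv huv
      have hu' := htan u hu
      have hv' := htan v hv
      have e : fderiv ℝ (fun x => Φ (τ (Θ x))) (φ θ₀ s₀) = _ := hH.fderiv
      rw [e]
      simp only [ContinuousLinearMap.comp_apply, ContinuousLinearMap.prod_apply,
        add_apply, ContinuousLinearMap.smulRight_apply,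
        ContinuousLinearMap.coe_fst', ContinuousLinearMap.coe_snd', smul_eq_mul, hτ₀]
      rw [← hu', ← hv'] at huv
      generalize fderiv ℝ Θ (φ θ₀ s₀) u = x at *
      generalize fderiv ℝ Θ (φ θ₀ s₀) v = y at *
      obtain ⟨a, b⟩ := x
      obtain ⟨a', b'⟩ := y
      rw [hφ.fderiv_apply _ hs₀, hφ.fderiv_apply _ hs₀, surfOrient_add_smul] at huv
      rw [hφ.fderiv_apply _ hs₀, hφ.fderiv_apply _ hs₀, hφ.twist_apply _ _ hs₀,
        surfOrient_add_smul]
      have h3 := pos_of_mul_pos_left huv (hφ.oriented θ₀ s₀ hs₀).le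
      refine mul_pos ?_ (hφ.oriented _ s₀ hs₀)
      linarith
  · -- near a point off the band `|s| ≤ 1/2` the twist is the identity
    have hcl := hφ.isClosed_band (c := 1 / 2) (by norm_num)
    obtain ⟨U, hU, hUe⟩ := isOpen_induced_iff.1 hcl.isOpen_compl
    have hq : ∀ q : Surf, (q : R3) ∈ U → twist φ c q = q := fun q hq => by
      refine hφ.twist_eq_self h0 h1 ?_
      have : q ∈ Subtype.val ⁻¹' U := hq
      rwa [hUe] at this
    have hpU : p ∈ Subtype.val ⁻¹' U := by rwa [hUe]
    refine ⟨U, fun x => x, hU, hpU, contDiff_id.contDiffOn, fun q hq' => by rw [hq q hq'], ?_⟩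
    intro u _ v _ huv
    have : fderiv ℝ (fun q : R3 => q) (p : R3) = ContinuousLinearMap.id ℝ R3 := fderiv_id
    simpa [this, hq p hpU] using huv

/-- There is a Dehn twist for every annulus. -/
lemma exists_isDehnTwist (hφ : IsAnnulus φ C) : ∃ t : DiffPlus, IsDehnTwist t C := by
  let f : ℝ → ℝ := fun s => Real.smoothTransition (s + 1 / 2)
  have hf : ContDiff ℝ ∞ f := Real.smoothTransition.contDiff.comp (contDiff_id.add contDiff_const)
  have hf0 : ∀ s ≤ -(1 / 2 : ℝ), f s = 0 := fun s hs =>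
    Real.smoothTransition.zero_of_nonpos (by linarith)
  have hf1 : ∀ s ≥ (1 / 2 : ℝ), f s = 1 := fun s hs =>
    Real.smoothTransition.one_of_one_le (by linarith)
  have hs : IsSmoothOriented (twist φ f) :=
    hφ.isSmoothOriented_twist hf hf0 (n := 1) fun s hs => by simp [hf1 s hs]
  have hs' : IsSmoothOriented (twist φ fun s => -f s) :=
    hφ.isSmoothOriented_twist hf.neg (fun s hs => by simp [hf0 s hs]) (n := -1)
      fun s hs => by simp [hf1 s hs]
  have cont : ∀ {g : Surf → Surf}, IsSmoothOriented g → Continuous g := by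
    intro g hg
    rw [continuous_iff_continuousAt]
    intro p
    obtain ⟨U, H, hU, hpU, hH, hHg, -⟩ := hg p
    refine Topology.IsInducing.subtypeVal.continuousAt_iff.2 ?_
    refine ((hH.continuousOn.continuousAt (hU.mem_nhds hpU)).comp
      continuous_subtype_val.continuousAt).congr ?_
    filter_upwards [(hU.preimage continuous_subtype_val).mem_nhds hpU] with q hq
    exact hHg q hq
  let t : Surf ≃ₜ Surf :=
    { toFun := twist φ f
      invFun := twist φ fun s => -f s
      left_inv := fun q => by rw [hφ.twist_comp]; simpa using hφ.twist_zero q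
      right_inv := fun q => by rw [hφ.twist_comp]; simpa using hφ.twist_zero q
      continuous_toFun := cont hs
      continuous_invFun := cont hs' }
  exact ⟨⟨t, hs, hs'⟩, φ, f, hφ, hf, hf0, hf1, fun θ s h => hφ.twist_apply f θ h,
    fun p hp => twist_of_forall_ne hp⟩

end IsAnnulus

/-! ### Standard annuli -/

/-- Two tangent vectors are positively oriented if they are so with respect to some vector `w` that
points outwards. -/
lemma surfOrient_pos_of_transverse {p u v w : R3} (hu : fderiv ℝ surfFun p u = 0)
    (hv : fderiv ℝ surfFun p v = 0)
    (h : 0 < fderiv ℝ surfFun p w * (Matrix.of ![w, u, v]).det) : 0 < surfOrient p u v := by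
  rw [fderiv_surfFun_apply] at hu hv h
  rw [surfOrient]
  simp only [Matrix.det_fin_three, Matrix.of_apply, Matrix.cons_val', Matrix.cons_val,
    Fin.sum_univ_three] at *
  generalize surfNormal p 0 = n0 at *
  generalize surfNormal p 1 = n1 at *
  generalize surfNormal p 2 = n2 at *
  set c0 := u 1 * v 2 - u 2 * v 1 with hc0
  set c1 := u 2 * v 0 - u 0 * v 2 with hc1
  set c2 := u 0 * v 1 - u 1 * v 0 with hc2
  -- the normal is parallel to the cross product of the tangent vectors
  have e01 : n0 * c1 = n1 * c0 := by
    rw [hc0, hc1]; linear_combination u 2 * hv - v 2 * hu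
  have e02 : n0 * c2 = n2 * c0 := by
    rw [hc0, hc2]; linear_combination v 1 * hu - u 1 * hv
  have e12 : n1 * c2 = n2 * c1 := by
    rw [hc1, hc2]; linear_combination u 0 * hv - v 0 * hu
  clear_value c0 c1 c2
  have key : (n0 * w 0 + n1 * w 1 + n2 * w 2) * (c0 * w 0 + c1 * w 1 + c2 * w 2) *
      (c0 ^ 2 + c1 ^ 2 + c2 ^ 2) =
      (n0 * c0 + n1 * c1 + n2 * c2) * (c0 * w 0 + c1 * w 1 + c2 * w 2) ^ 2 := by
    linear_combination (c0 * w 0 + c1 * w 1 + c2 * w 2) *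
      (w 0 * (c1 * e01 + c2 * e02) + w 1 * (- c0 * e01 + c2 * e12) +
        w 2 * (-c0 * e02 - c1 * e12))
  have h' : 0 < (n0 * w 0 + n1 * w 1 + n2 * w 2) * (c0 * w 0 + c1 * w 1 + c2 * w 2) := by
    refine h.trans_eq ?_
    rw [hc0, hc1, hc2]; ring
  have hne : c0 * w 0 + c1 * w 1 + c2 * w 2 ≠ 0 := right_ne_zero_of_mul h'.ne'
  have hc : 0 < c0 ^ 2 + c1 ^ 2 + c2 ^ 2 := by
    by_contra hc
    have z0 : c0 = 0 := pow_eq_zero_iff two_ne_zero |>.1 (by linarith [sq_nonneg c0, sq_nonneg c1, sq_nonneg c2])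
    have z1 : c1 = 0 := pow_eq_zero_iff two_ne_zero |>.1 (by linarith [sq_nonneg c0, sq_nonneg c1, sq_nonneg c2])
    have z2 : c2 = 0 := pow_eq_zero_iff two_ne_zero |>.1 (by linarith [sq_nonneg c0, sq_nonneg c1, sq_nonneg c2])
    exact hne (by rw [z0, z1, z2]; ring)
  have h2 : 0 < n0 * c0 + n1 * c1 + n2 * c2 := by
    have h3 := mul_pos h' hc
    rw [key] at h3
    exact pos_of_mul_pos_left h3 (sq_nonneg _)
  refine h2.trans_eq ?_
  rw [hc0, hc1, hc2]; ring

lemma surfFun_eq (p : R3) : surfFun p = p 2 ^ 2 - planeFun (p 0) (p 1) := rfl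

/-- The points of the surface with given coordinate functions (with a junk value off the surface).
-/
def coordMap (X Y Z : ℝ × ℝ → ℝ) (θ s : ℝ) : Surf := by
  classical
  exact if h : Z (θ, s) ^ 2 = planeFun (X (θ, s)) (Y (θ, s)) then Surf.mk _ _ _ h else vtx 0

/-- A criterion for an annulus that is given by its coordinate functions. The orientation can be
tested with any vector `w` in place of the normal. -/
lemma isAnnulus_coordMap {X Y Z : ℝ × ℝ → ℝ} {C : Set Surf}
    (hX : ContDiffOn ℝ ∞ X (univ ×ˢ Ioo (-1) 1)) (hY : ContDiffOn ℝ ∞ Y (univ ×ˢ Ioo (-1) 1))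
    (hZ : ContDiffOn ℝ ∞ Z (univ ×ˢ Ioo (-1) 1))
    (heq : ∀ θ : ℝ, ∀ s ∈ Ioo (-1 : ℝ) 1, Z (θ, s) ^ 2 = planeFun (X (θ, s)) (Y (θ, s)))
    (hper : ∀ θ : ℝ, ∀ s ∈ Ioo (-1 : ℝ) 1, ∀ n : ℤ, X (θ + n, s) = X (θ, s) ∧
      Y (θ + n, s) = Y (θ, s) ∧ Z (θ + n, s) = Z (θ, s))
    (hinj : ∀ θ θ' : ℝ, ∀ s ∈ Ioo (-1 : ℝ) 1, ∀ s' ∈ Ioo (-1 : ℝ) 1, X (θ, s) = X (θ', s') →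
      Y (θ, s) = Y (θ', s') → Z (θ, s) = Z (θ', s') → s = s' ∧ ∃ n : ℤ, θ' = θ + n)
    (hor : ∀ θ : ℝ, ∀ s ∈ Ioo (-1 : ℝ) 1, ∃ w : R3,
      0 < fderiv ℝ surfFun ![X (θ, s), Y (θ, s), Z (θ, s)] w * (Matrix.of ![w,
        ![deriv (fun b => X (θ, b)) s, deriv (fun b => Y (θ, b)) s, deriv (fun b => Z (θ, b)) s],
        ![deriv (fun a => X (a, s)) θ, deriv (fun a => Y (a, s)) θ,
          deriv (fun a => Z (a, s)) θ]]).det)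
    (hcore : ∀ q : Surf, q ∈ C ↔ ∃ θ, q.1 = ![X (θ, 0), Y (θ, 0), Z (θ, 0)]) :
    IsAnnulus (coordMap X Y Z) C := by
  have hval : ∀ θ : ℝ, ∀ s ∈ Ioo (-1 : ℝ) 1,
      (coordMap X Y Z θ s : R3) = ![X (θ, s), Y (θ, s), Z (θ, s)] := by
    intro θ s hs
    rw [coordMap, dif_pos (heq θ s hs)]
    rfl
  have hsm : ContDiffOn ℝ ∞ (fun q : ℝ × ℝ => (![X q, Y q, Z q] : R3)) (univ ×ˢ Ioo (-1) 1) :=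
    contDiffOn_pi.2 fun i => by fin_cases i <;> assumption
  have diff : ∀ {F : ℝ × ℝ → ℝ}, ContDiffOn ℝ ∞ F (univ ×ˢ Ioo (-1) 1) → ∀ θ : ℝ,
      ∀ s ∈ Ioo (-1 : ℝ) 1, HasDerivAt (fun b => F (θ, b)) (deriv (fun b => F (θ, b)) s) s ∧
        HasDerivAt (fun a => F (a, s)) (deriv (fun a => F (a, s)) θ) θ := by
    intro F hF θ s hs
    have hd := (hF.contDiffAt (IsAnnulus.isOpen_strip.mem_nhds
      (show (θ, s) ∈ (univ : Set ℝ) ×ˢ Ioo (-1 : ℝ) 1 from ⟨mem_univ θ, hs⟩))).differentiableAt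
      (by simp)
    constructor
    · exact (DifferentiableAt.comp (f := fun b => (θ, b)) s hd (by fun_prop)).hasDerivAt
    · exact (DifferentiableAt.comp (f := fun a => (a, s)) θ hd (by fun_prop)).hasDerivAt
  have hds : ∀ θ : ℝ, ∀ s ∈ Ioo (-1 : ℝ) 1, HasDerivAt (fun b => (coordMap X Y Z θ b : R3))
      ![deriv (fun b => X (θ, b)) s, deriv (fun b => Y (θ, b)) s, deriv (fun b => Z (θ, b)) s]
      s := by
    intro θ s hs
    have : HasDerivAt (fun b => (![X (θ, b), Y (θ, b), Z (θ, b)] : R3)) ![deriv (fun b => X (θ, b)) s,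
        deriv (fun b => Y (θ, b)) s, deriv (fun b => Z (θ, b)) s] s :=
      hasDerivAt_pi.2 fun i => by
        fin_cases i
        exacts [(diff hX θ s hs).1, (diff hY θ s hs).1, (diff hZ θ s hs).1]
    refine this.congr_of_eventuallyEq ?_
    filter_upwards [isOpen_Ioo.mem_nhds hs] with b hb using hval θ b hb
  have hdθ : ∀ θ : ℝ, ∀ s ∈ Ioo (-1 : ℝ) 1, HasDerivAt (fun a => (coordMap X Y Z a s : R3))
      ![deriv (fun a => X (a, s)) θ, deriv (fun a => Y (a, s)) θ, deriv (fun a => Z (a, s)) θ]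
      θ := by
    intro θ s hs
    have : HasDerivAt (fun a => (![X (a, s), Y (a, s), Z (a, s)] : R3)) ![deriv (fun a => X (a, s)) θ,
        deriv (fun a => Y (a, s)) θ, deriv (fun a => Z (a, s)) θ] θ :=
      hasDerivAt_pi.2 fun i => by
        fin_cases i
        exacts [(diff hX θ s hs).2, (diff hY θ s hs).2, (diff hZ θ s hs).2]
    refine this.congr_of_eventuallyEq (Filter.Eventually.of_forall fun a => hval a s hs)
  have htan : ∀ {g : ℝ → Surf} {g' : R3} {t : ℝ}, HasDerivAt (fun a => (g a : R3)) g' t →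
      fderiv ℝ surfFun (g t) g' = 0 := by
    intro g g' t hg
    have h1 := (contDiff_surfFun.differentiable (by simp) (g t)).hasFDerivAt.comp_hasDerivAt t hg
    have h2 : surfFun ∘ (fun a => (g a : R3)) = fun _ => 0 := funext fun a => (g a).2
    rw [h2] at h1
    exact h1.unique (hasDerivAt_const t 0)
  refine ⟨hsm.congr fun q hq => hval q.1 q.2 hq.2, ?_, ?_, ?_⟩
  · intro θ θ' s hs s' hs'
    rw [Subtype.ext_iff, hval θ s hs, hval θ' s' hs']
    constructor
    · intro h
      exact hinj θ θ' s hs s' hs' (congrFun h 0) (congrFun h 1) (congrFun h 2)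
    · rintro ⟨rfl, n, rfl⟩
      obtain ⟨e1, e2, e3⟩ := hper θ s hs n
      rw [e1, e2, e3]
  · intro θ s hs
    rw [(hds θ s hs).deriv, (hdθ θ s hs).deriv]
    obtain ⟨w, hw⟩ := hor θ s hs
    rw [← hval θ s hs] at hw
    exact surfOrient_pos_of_transverse (htan (hds θ s hs))
      (htan (g := fun a => coordMap X Y Z a s) (hdθ θ s hs)) hw
  · ext q
    rw [hcore]
    constructor
    · rintro ⟨θ, rfl⟩
      exact ⟨θ, hval θ 0 (by simp)⟩
    · rintro ⟨θ, h⟩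
      exact ⟨θ, Subtype.ext ((hval θ 0 (by simp)).trans h.symm)⟩

lemma coordMap_val {X Y Z : ℝ × ℝ → ℝ} {θ s : ℝ}
    (h : Z (θ, s) ^ 2 = planeFun (X (θ, s)) (Y (θ, s))) :
    (coordMap X Y Z θ s : R3) = ![X (θ, s), Y (θ, s), Z (θ, s)] := by
  rw [coordMap, dif_pos h]
  rfl

lemma exists_int_of_cos_sin_eq {θ θ' : ℝ} (hc : Real.cos (2 * Real.pi * θ) = Real.cos (2 * Real.pi * θ'))
    (hs : Real.sin (2 * Real.pi * θ) = Real.sin (2 * Real.pi * θ')) : ∃ n : ℤ, θ' = θ + n := by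
  obtain ⟨n, hn⟩ := Real.Angle.angle_eq_iff_two_pi_dvd_sub.1 (Real.Angle.cos_sin_inj hc.symm hs.symm)
  refine ⟨n, ?_⟩
  have hpi := Real.pi_pos
  have : 2 * Real.pi * (θ' - θ - n) = 0 := by linear_combination hn
  have := (mul_eq_zero.1 this).resolve_left (by positivity)
  linarith

lemma cos_add_int (θ : ℝ) (n : ℤ) : Real.cos (2 * Real.pi * (θ + n)) = Real.cos (2 * Real.pi * θ) := by
  rw [mul_add, mul_comm (2 * Real.pi) (n : ℝ), Real.cos_add_int_mul_two_pi]

lemma sin_add_int (θ : ℝ) (n : ℤ) : Real.sin (2 * Real.pi * (θ + n)) = Real.sin (2 * Real.pi * θ) := by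
  rw [mul_add, mul_comm (2 * Real.pi) (n : ℝ), Real.sin_add_int_mul_two_pi]

lemma exists_cos_sin_eq {x y : ℝ} (h : x ^ 2 + y ^ 2 = 1) :
    ∃ θ, Real.cos (2 * Real.pi * θ) = x ∧ Real.sin (2 * Real.pi * θ) = y := by
  have hx1 : -1 ≤ x := by nlinarith
  have hx2 : x ≤ 1 := by nlinarith
  have e : ∀ t : ℝ, 2 * Real.pi * (t / (2 * Real.pi)) = t := fun t => by
    field_simp
  rcases le_total 0 y with hy | hy
  · refine ⟨Real.arccos x / (2 * Real.pi), ?_, ?_⟩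
    · rw [e, Real.cos_arccos hx1 hx2]
    · rw [e, Real.sin_arccos, show 1 - x ^ 2 = y ^ 2 by linarith, Real.sqrt_sq hy]
  · refine ⟨-Real.arccos x / (2 * Real.pi), ?_, ?_⟩
    · rw [e, Real.cos_neg, Real.cos_arccos hx1 hx2]
    · rw [e, Real.sin_neg, Real.sin_arccos, show 1 - x ^ 2 = (-y) ^ 2 by linarith,
        Real.sqrt_sq (by linarith)]
      ring

lemma contDiff_cos_fst : ContDiff ℝ ∞ fun q : ℝ × ℝ => Real.cos (2 * Real.pi * q.1) :=
  Real.contDiff_cos.comp (contDiff_const.mul contDiff_fst)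

lemma contDiff_sin_fst : ContDiff ℝ ∞ fun q : ℝ × ℝ => Real.sin (2 * Real.pi * q.1) :=
  Real.contDiff_sin.comp (contDiff_const.mul contDiff_fst)

lemma hasDerivAt_cos_two_pi (θ : ℝ) : HasDerivAt (fun a => Real.cos (2 * Real.pi * a))
    (-(2 * Real.pi * Real.sin (2 * Real.pi * θ))) θ := by
  have := (Real.hasDerivAt_cos (2 * Real.pi * θ)).comp θ ((hasDerivAt_id θ).const_mul (2 * Real.pi))
  refine this.congr_deriv ?_
  simp; ring

lemma hasDerivAt_sin_two_pi (θ : ℝ) : HasDerivAt (fun a => Real.sin (2 * Real.pi * a))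
    (2 * Real.pi * Real.cos (2 * Real.pi * θ)) θ := by
  have := (Real.hasDerivAt_sin (2 * Real.pi * θ)).comp θ ((hasDerivAt_id θ).const_mul (2 * Real.pi))
  refine this.congr_deriv ?_
  simp; ring

/-- The position of an annulus with respect to two coordinate planes: the core curve lies in the
plane in which the `m`-th coordinate vanishes, and the sides of the annulus lie on the two sides of
this plane; the `n`-th coordinate has the sign of `κ sin (2 π θ)`. -/
def IsAligned (φ : ℝ → ℝ → Surf) (m n : Fin 3) (κ : ℝ) : Prop :=
  ∀ θ : ℝ, ∀ s ∈ Ioo (-1 : ℝ) 1, (∃ a > 0, (φ θ s).1 m = s * a) ∧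
    ∃ b > 0, (φ θ s).1 n = κ * Real.sin (2 * Real.pi * θ) * b

lemma fderiv_surfFun_of_line {p w : R3} {d : ℝ}
    (h : HasDerivAt (fun t : ℝ => surfFun (p + t • w)) d 0) : fderiv ℝ surfFun p w = d := by
  have h1 : HasDerivAt (fun t : ℝ => p + t • w) w 0 := by
    simpa using ((hasDerivAt_id (0 : ℝ)).smul_const w).const_add p
  have h2 := (contDiff_surfFun.differentiable (by simp)
    (p + (0 : ℝ) • w)).hasFDerivAt.comp_hasDerivAt 0 h1
  have h3 := h2.unique h
  simpa using h3

lemma fderiv_surfFun_vertical (x y z : ℝ) :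
    fderiv ℝ surfFun ![x, y, z] ![0, 0, 1] = 2 * z := by
  refine fderiv_surfFun_of_line ?_
  have : (fun t : ℝ => surfFun (![x, y, z] + t • ![0, 0, 1])) =
      fun t => (z + t) ^ 2 - planeFun x y := by
    funext t
    simp [surfFun_eq]
  rw [this]
  have h := (((hasDerivAt_id (0 : ℝ)).const_add z).pow 2).sub_const (planeFun x y)
  refine h.congr_deriv ?_
  simp

/-- An annulus around the circle of squared radius `R` about `(c, 0)` in the plane `z = 0`. The
surface is `z² = κ ((x - c)² + y² - R) K`, with `K > 0` near the circle. Over the circle of squared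
radius `R + κ s²` the right hand side is `s² K`, with the smooth solution `z = s √K`. -/
lemma exists_isAnnulus_circle (c R κ : ℝ) (K : ℝ × ℝ → ℝ) (hκ : κ = 1 ∨ κ = -1)
    (hK : ContDiff ℝ ∞ K) (hplane : ∀ x y, planeFun x y = κ * ((x - c) ^ 2 + y ^ 2 - R) * K (x, y))
    (hR : ∀ s ∈ Ioo (-1 : ℝ) 1, 0 < R + κ * s ^ 2)
    (hpos : ∀ x y, ∀ s ∈ Ioo (-1 : ℝ) 1, (x - c) ^ 2 + y ^ 2 = R + κ * s ^ 2 → 0 < K (x, y)) :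
    ∃ φ, IsAnnulus φ {q | q.1 2 = 0 ∧ (q.1 0 - c) ^ 2 + q.1 1 ^ 2 = R} ∧ IsAligned φ 2 1 κ := by
  have hκ2 : κ ^ 2 = 1 := by rcases hκ with rfl | rfl <;> norm_num
  set ρ : ℝ → ℝ := fun s => √(R + κ * s ^ 2) with hρ
  have hρpos : ∀ s ∈ Ioo (-1 : ℝ) 1, 0 < ρ s := fun s hs => Real.sqrt_pos.2 (hR s hs)
  have hρsq : ∀ s ∈ Ioo (-1 : ℝ) 1, ρ s ^ 2 = R + κ * s ^ 2 := fun s hs => Real.sq_sqrt (hR s hs).le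
  have hρd : ∀ s ∈ Ioo (-1 : ℝ) 1, HasDerivAt ρ (κ * s / ρ s) s := by
    intro s hs
    have h1 : HasDerivAt (fun s : ℝ => R + κ * s ^ 2) (κ * (2 * s)) s := by
      simpa using (((hasDerivAt_id s).pow 2).const_mul κ).const_add R
    refine (h1.sqrt (hR s hs).ne').congr_deriv ?_
    change κ * (2 * s) / (2 * ρ s) = _
    have := (hρpos s hs).ne'
    field_simp
  have hρsm : ContDiffOn ℝ ∞ (fun q : ℝ × ℝ => ρ q.2) (univ ×ˢ Ioo (-1) 1) :=
    ContDiffOn.sqrt (contDiff_const.add (contDiff_const.mul (contDiff_snd.pow 2))).contDiffOn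
      fun q hq => (hR q.2 hq.2).ne'
  set X : ℝ × ℝ → ℝ := fun q => c + ρ q.2 * Real.cos (2 * Real.pi * q.1) with hX
  set Y : ℝ × ℝ → ℝ := fun q => κ * (ρ q.2 * Real.sin (2 * Real.pi * q.1)) with hY
  set Z : ℝ × ℝ → ℝ := fun q => q.2 * √(K (X q, Y q)) with hZ
  have hcs : ∀ θ, Real.sin (2 * Real.pi * θ) ^ 2 + Real.cos (2 * Real.pi * θ) ^ 2 = 1 := fun θ =>
    Real.sin_sq_add_cos_sq _
  have hXY : ∀ θ : ℝ, ∀ s ∈ Ioo (-1 : ℝ) 1,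
      (X (θ, s) - c) ^ 2 + Y (θ, s) ^ 2 = R + κ * s ^ 2 := by
    intro θ s hs
    rw [← hρsq s hs]
    simp only [hX, hY]
    linear_combination ρ s ^ 2 * hcs θ + ρ s ^ 2 * Real.sin (2 * Real.pi * θ) ^ 2 * hκ2
  have hKpos : ∀ θ : ℝ, ∀ s ∈ Ioo (-1 : ℝ) 1, 0 < K (X (θ, s), Y (θ, s)) := fun θ s hs =>
    hpos _ _ s hs (hXY θ s hs)
  have hXsm : ContDiffOn ℝ ∞ X (univ ×ˢ Ioo (-1) 1) :=
    contDiffOn_const.add (hρsm.mul contDiff_cos_fst.contDiffOn)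
  have hYsm : ContDiffOn ℝ ∞ Y (univ ×ˢ Ioo (-1) 1) :=
    contDiffOn_const.mul (hρsm.mul contDiff_sin_fst.contDiffOn)
  have hGsm : ContDiffOn ℝ ∞ (fun q => √(K (X q, Y q))) (univ ×ˢ Ioo (-1) 1) :=
    (hK.comp_contDiffOn (hXsm.prodMk hYsm)).sqrt fun q hq => (hKpos q.1 q.2 hq.2).ne'
  have hZsm : ContDiffOn ℝ ∞ Z (univ ×ˢ Ioo (-1) 1) := contDiffOn_snd.mul hGsm
  have heq : ∀ θ : ℝ, ∀ s ∈ Ioo (-1 : ℝ) 1, Z (θ, s) ^ 2 = planeFun (X (θ, s)) (Y (θ, s)) := by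
    intro θ s hs
    rw [hplane, hXY θ s hs]
    simp only [hZ]
    rw [mul_pow, Real.sq_sqrt (hKpos θ s hs).le]
    linear_combination -s ^ 2 * K (X (θ, s), Y (θ, s)) * hκ2
  refine ⟨coordMap X Y Z, isAnnulus_coordMap hXsm hYsm hZsm heq ?_ ?_ ?_ ?_, ?_⟩
  · intro θ s hs n
    simp only [hX, hY, hZ, cos_add_int, sin_add_int, and_self]
  · intro θ θ' s hs s' hs' h1 h2 h3
    have hss : s = s' := by
      simp only [hZ, ← h1, ← h2] at h3
      exact mul_right_cancel₀ (Real.sqrt_pos.2 (hKpos θ s hs)).ne' h3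
    subst hss
    have hκ0 : κ ≠ 0 := by rcases hκ with rfl | rfl <;> norm_num
    exact ⟨rfl, exists_int_of_cos_sin_eq (mul_left_cancel₀ (hρpos s hs).ne' (add_left_cancel h1))
      (mul_left_cancel₀ (hρpos s hs).ne' (mul_left_cancel₀ hκ0 h2))⟩
  · intro θ s hs
    have hKp := hKpos θ s hs
    have hXs : deriv (fun b => X (θ, b)) s = κ * s / ρ s * Real.cos (2 * Real.pi * θ) :=
      (((hρd s hs).mul_const (Real.cos (2 * Real.pi * θ))).const_add c).deriv
    have hYs : deriv (fun b => Y (θ, b)) s = κ * (κ * s / ρ s * Real.sin (2 * Real.pi * θ)) :=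
      (((hρd s hs).mul_const (Real.sin (2 * Real.pi * θ))).const_mul κ).deriv
    have hXθ : deriv (fun a => X (a, s)) θ = ρ s * -(2 * Real.pi * Real.sin (2 * Real.pi * θ)) :=
      (((hasDerivAt_cos_two_pi θ).const_mul (ρ s)).const_add c).deriv
    have hYθ : deriv (fun a => Y (a, s)) θ = κ * (ρ s * (2 * Real.pi * Real.cos (2 * Real.pi * θ))) :=
      (((hasDerivAt_sin_two_pi θ).const_mul (ρ s)).const_mul κ).deriv
    rw [hXs, hYs, hXθ, hYθ]
    have hr := hρpos s hs
    rcases eq_or_ne s 0 with rfl | hs0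
    · -- on the core circle the radial vector serves
      refine ⟨![Real.cos (2 * Real.pi * θ), κ * Real.sin (2 * Real.pi * θ), 0], ?_⟩
      have hZs : deriv (fun b => Z (θ, b)) 0 = √(K (X (θ, 0), Y (θ, 0))) := by
        have hd : DifferentiableAt ℝ (fun b : ℝ => √(K (X (θ, b), Y (θ, b)))) 0 :=
          DifferentiableAt.comp (f := fun b : ℝ => (θ, b)) (0 : ℝ)
            (((hGsm.contDiffAt (IsAnnulus.isOpen_strip.mem_nhds
              (show (θ, (0 : ℝ)) ∈ (univ : Set ℝ) ×ˢ Ioo (-1 : ℝ) 1 from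
                ⟨mem_univ θ, hs⟩))).differentiableAt (by simp))) (by fun_prop)
        have h2 := ((hasDerivAt_id (0 : ℝ)).mul hd.hasDerivAt).deriv
        exact Eq.trans h2 (by simp)
      have hn : fderiv ℝ surfFun ![X (θ, 0), Y (θ, 0), Z (θ, 0)]
          ![Real.cos (2 * Real.pi * θ), κ * Real.sin (2 * Real.pi * θ), 0] =
          -(κ * (2 * ρ 0) * K (X (θ, 0), Y (θ, 0))) := by
        refine fderiv_surfFun_of_line ?_
        have e : (fun t : ℝ => surfFun (![X (θ, 0), Y (θ, 0), Z (θ, 0)] +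
            t • ![Real.cos (2 * Real.pi * θ), κ * Real.sin (2 * Real.pi * θ), 0])) =
            fun t => -(κ * (2 * ρ 0 * t + t ^ 2) * K (X (θ, 0) + t * Real.cos (2 * Real.pi * θ),
              Y (θ, 0) + t * (κ * Real.sin (2 * Real.pi * θ)))) := by
          funext t
          have h0 := hρsq 0 hs
          have e2 : (X (θ, 0) + t * Real.cos (2 * Real.pi * θ) - c) ^ 2 +
              (Y (θ, 0) + t * (κ * Real.sin (2 * Real.pi * θ))) ^ 2 - R = 2 * ρ 0 * t + t ^ 2 := by
            simp only [hX, hY]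
            linear_combination h0 + (ρ 0 + t) ^ 2 * hcs θ +
              (ρ 0 + t) ^ 2 * Real.sin (2 * Real.pi * θ) ^ 2 * hκ2
          simp only [surfFun_eq, Pi.add_apply, Pi.smul_apply, smul_eq_mul, Matrix.cons_val_zero,
            Matrix.cons_val_one, Matrix.cons_val, hplane, e2]
          simp [hZ]
        rw [e]
        have hd : DifferentiableAt ℝ (fun t : ℝ => K (X (θ, 0) + t * Real.cos (2 * Real.pi * θ),
              Y (θ, 0) + t * (κ * Real.sin (2 * Real.pi * θ)))) 0 :=
          ((hK.differentiable (by simp)).comp (f := fun t : ℝ =>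
            (X (θ, 0) + t * Real.cos (2 * Real.pi * θ),
              Y (θ, 0) + t * (κ * Real.sin (2 * Real.pi * θ)))) (by fun_prop)) 0
        have h1 := ((((hasDerivAt_id (0 : ℝ)).const_mul (2 * ρ 0)).add
          ((hasDerivAt_id (0 : ℝ)).pow 2)).const_mul κ).mul hd.hasDerivAt
        refine h1.neg.congr_deriv ?_
        simp
      rw [hn, hZs]
      have hk := Real.sqrt_pos.2 hKp
      generalize √(K (X (θ, 0), Y (θ, 0))) = k at *
      generalize deriv (fun a => Z (a, 0)) θ = d
      have h4 : 0 < K (X (θ, 0), Y (θ, 0)) * k * (ρ 0) ^ 2 * Real.pi := by positivity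
      refine (mul_pos four_pos h4).trans_eq ?_
      simp only [Matrix.det_fin_three, Matrix.of_apply, Matrix.cons_val', Matrix.cons_val]
      linear_combination -4 * K (X (θ, 0), Y (θ, 0)) * k * (ρ 0) ^ 2 * Real.pi * κ ^ 2 * hcs θ -
        4 * K (X (θ, 0), Y (θ, 0)) * k * (ρ 0) ^ 2 * Real.pi * hκ2
    · -- off the core circle `z ≠ 0`, and the vertical vector is transverse to the surface
      refine ⟨![0, 0, 1], ?_⟩
      rw [fderiv_surfFun_vertical]
      have hk := Real.sqrt_pos.2 hKp
      have h4 : 0 < 4 * Real.pi * s ^ 2 * √(K (X (θ, s), Y (θ, s))) := by positivity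
      refine h4.trans_eq ?_
      simp only [Matrix.det_fin_three, Matrix.of_apply, Matrix.cons_val', Matrix.cons_val, hZ]
      have hinv := mul_inv_cancel₀ hr.ne'
      have hc := hcs θ
      rw [div_eq_mul_inv]
      generalize √(K (X (θ, s), Y (θ, s))) = k at *
      generalize Real.sin (2 * Real.pi * θ) = S at *
      generalize Real.cos (2 * Real.pi * θ) = D at *
      linear_combination -(4 * Real.pi * s ^ 2 * k * κ ^ 2 * (S ^ 2 + D ^ 2)) * hinv -
        4 * Real.pi * s ^ 2 * k * κ ^ 2 * hc - 4 * Real.pi * s ^ 2 * k * hκ2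
  · intro q
    constructor
    · rintro ⟨hz, hq⟩
      have hs0 : (0 : ℝ) ∈ Ioo (-1 : ℝ) 1 := by simp
      have h0 := hρsq 0 hs0
      have hr := (hρpos 0 hs0).ne'
      obtain ⟨θ, h1, h2⟩ := exists_cos_sin_eq (x := (q.1 0 - c) / ρ 0) (y := κ * q.1 1 / ρ 0) (by
        field_simp
        linear_combination hq - h0 + q.1 1 ^ 2 * hκ2)
      refine ⟨θ, funext fun i => ?_⟩
      fin_cases i
      · simp only [hX, h1]
        field_simp
        simp
      · simp only [hY, h2]
        field_simp
        simp [hκ2]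
      · simpa [hZ] using hz
    · rintro ⟨θ, h⟩
      have h2 := hXY θ 0 (by simp)
      rw [mem_ofPred_eq, h]
      simpa [hZ] using h2
  · intro θ s hs
    rw [coordMap_val (heq θ s hs)]
    exact ⟨⟨_, Real.sqrt_pos.2 (hKpos θ s hs), rfl⟩, ρ s, hρpos s hs, by simp [hY]; ring⟩

/-- An annulus around an oval in the plane `y = 0`. For fixed `y` the surface is
`z² = (r² - (x - m)²) G`, with `G > 0` on the interval `[m - r, m + r]`, which is parametrised by
`x = m + r cos`, `z = r sin √G`. The second parameter of the annulus is `s = 2 y`, so that `|s| < 1`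
keeps `y` away from the tops of the holes. -/
lemma exists_isAnnulus_oval (m r : ℝ → ℝ) (G : ℝ × ℝ → ℝ)
    (hm : ContDiffOn ℝ ∞ m (Ioo (-(1 / 2)) (1 / 2))) (hr : ContDiffOn ℝ ∞ r (Ioo (-(1 / 2)) (1 / 2)))
    (hG : ContDiffOn ℝ ∞ G (univ ×ˢ Ioo (-(1 / 2)) (1 / 2)))
    (hplane : ∀ x, ∀ y ∈ Ioo (-(1 / 2) : ℝ) (1 / 2),
      planeFun x y = (r y ^ 2 - (x - m y) ^ 2) * G (x, y))
    (hrpos : ∀ y ∈ Ioo (-(1 / 2) : ℝ) (1 / 2), 0 < r y)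
    (hpos : ∀ x, ∀ y ∈ Ioo (-(1 / 2) : ℝ) (1 / 2), m y - r y ≤ x → x ≤ m y + r y → 0 < G (x, y)) :
    ∃ φ, IsAnnulus φ {q | q.1 1 = 0 ∧ m 0 - r 0 ≤ q.1 0 ∧ q.1 0 ≤ m 0 + r 0} ∧
      IsAligned φ 1 2 1 := by
  have half : ∀ s ∈ Ioo (-1 : ℝ) 1, s / 2 ∈ Ioo (-(1 / 2) : ℝ) (1 / 2) := fun s hs =>
    ⟨by linarith [hs.1], by linarith [hs.2]⟩
  set X : ℝ × ℝ → ℝ := fun q => m (q.2 / 2) + r (q.2 / 2) * Real.cos (2 * Real.pi * q.1) with hX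
  set Y : ℝ × ℝ → ℝ := fun q => q.2 / 2 with hY
  set Z : ℝ × ℝ → ℝ := fun q =>
    r (q.2 / 2) * Real.sin (2 * Real.pi * q.1) * √(G (X q, q.2 / 2)) with hZ
  have hcs : ∀ θ, Real.sin (2 * Real.pi * θ) ^ 2 + Real.cos (2 * Real.pi * θ) ^ 2 = 1 := fun θ =>
    Real.sin_sq_add_cos_sq _
  have hGpos : ∀ θ : ℝ, ∀ s ∈ Ioo (-1 : ℝ) 1, 0 < G (X (θ, s), s / 2) := fun θ s hs =>
    hpos _ _ (half s hs)
      (by have h1 := hrpos _ (half s hs)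
          have h2 := Real.neg_one_le_cos (2 * Real.pi * θ)
          simp only [hX]; nlinarith)
      (by have h1 := hrpos _ (half s hs)
          have h2 := Real.cos_le_one (2 * Real.pi * θ)
          simp only [hX]; nlinarith)
  have hYsm : ContDiffOn ℝ ∞ Y (univ ×ˢ Ioo (-1) 1) := (contDiff_snd.div_const 2).contDiffOn
  have hrsm : ContDiffOn ℝ ∞ (fun q : ℝ × ℝ => r (q.2 / 2)) (univ ×ˢ Ioo (-1) 1) :=
    hr.comp hYsm fun q hq => half q.2 hq.2
  have hXsm : ContDiffOn ℝ ∞ X (univ ×ˢ Ioo (-1) 1) :=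
    (hm.comp hYsm fun q hq => half q.2 hq.2).add (hrsm.mul contDiff_cos_fst.contDiffOn)
  have hGsm : ContDiffOn ℝ ∞ (fun q => √(G (X q, q.2 / 2))) (univ ×ˢ Ioo (-1) 1) :=
    (hG.comp (hXsm.prodMk hYsm) fun q hq => ⟨mem_univ _, half q.2 hq.2⟩).sqrt
      fun q hq => (hGpos q.1 q.2 hq.2).ne'
  have hZsm : ContDiffOn ℝ ∞ Z (univ ×ˢ Ioo (-1) 1) :=
    (hrsm.mul contDiff_sin_fst.contDiffOn).mul hGsm
  have heq : ∀ θ : ℝ, ∀ s ∈ Ioo (-1 : ℝ) 1, Z (θ, s) ^ 2 = planeFun (X (θ, s)) (Y (θ, s)) := by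
    intro θ s hs
    simp only [hY]
    rw [hplane _ _ (half s hs)]
    simp only [hZ]
    rw [mul_pow, Real.sq_sqrt (hGpos θ s hs).le]
    have e : X (θ, s) - m (s / 2) = r (s / 2) * Real.cos (2 * Real.pi * θ) := by simp only [hX]; ring
    rw [e]
    linear_combination r (s / 2) ^ 2 * G (X (θ, s), s / 2) * hcs θ
  refine ⟨coordMap X Y Z, isAnnulus_coordMap hXsm hYsm hZsm heq ?_ ?_ ?_ ?_, ?_⟩
  · intro θ s hs n
    simp only [hX, hY, hZ, cos_add_int, sin_add_int, and_self]
  · intro θ θ' s hs s' hs' h1 h2 h3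
    have hss : s = s' := by
      simp only [hY] at h2
      linarith
    subst hss
    have hr0 := (hrpos _ (half s hs)).ne'
    simp only [hZ, ← h1] at h3
    exact ⟨rfl, exists_int_of_cos_sin_eq (mul_left_cancel₀ hr0 (add_left_cancel h1))
      (mul_left_cancel₀ hr0 (mul_right_cancel₀ (Real.sqrt_pos.2 (hGpos θ s hs)).ne' h3))⟩
  · intro θ s hs
    have hGp := hGpos θ s hs
    have hk := Real.sqrt_pos.2 hGp
    have hrp := hrpos _ (half s hs)
    have hYs : deriv (fun b => Y (θ, b)) s = 1 / 2 := ((hasDerivAt_id s).div_const 2).deriv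
    have hXθ : deriv (fun a => X (a, s)) θ =
        r (s / 2) * -(2 * Real.pi * Real.sin (2 * Real.pi * θ)) :=
      (((hasDerivAt_cos_two_pi θ).const_mul (r (s / 2))).const_add (m (s / 2))).deriv
    have hYθ : deriv (fun a => Y (a, s)) θ = 0 := deriv_const θ (s / 2)
    rw [hYs, hXθ, hYθ]
    generalize deriv (fun b => X (θ, b)) s = xs
    generalize deriv (fun b => Z (θ, b)) s = zs
    rcases eq_or_ne (Real.sin (2 * Real.pi * θ)) 0 with hsin | hsin
    · -- where the oval meets the plane `z = 0` a horizontal vector serves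
      have hC : Real.cos (2 * Real.pi * θ) ^ 2 = 1 := by
        have := hcs θ
        rw [hsin] at this
        linarith
      refine ⟨![Real.cos (2 * Real.pi * θ), 0, 0], ?_⟩
      have hZθ : deriv (fun a => Z (a, s)) θ = r (s / 2) *
          (2 * Real.pi * Real.cos (2 * Real.pi * θ)) * √(G (X (θ, s), s / 2)) := by
        have hd : DifferentiableAt ℝ (fun a : ℝ => √(G (X (a, s), s / 2))) θ :=
          DifferentiableAt.comp (f := fun a : ℝ => (a, s)) θ
            (((hGsm.contDiffAt (IsAnnulus.isOpen_strip.mem_nhds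
              (show (θ, s) ∈ (univ : Set ℝ) ×ˢ Ioo (-1 : ℝ) 1 from
                ⟨mem_univ θ, hs⟩))).differentiableAt (by simp))) (by fun_prop)
        have h2 := (((hasDerivAt_sin_two_pi θ).const_mul (r (s / 2))).mul hd.hasDerivAt).deriv
        rw [hsin, mul_zero, zero_mul, add_zero] at h2
        exact h2
      have hn : fderiv ℝ surfFun ![X (θ, s), Y (θ, s), Z (θ, s)]
          ![Real.cos (2 * Real.pi * θ), 0, 0] = 2 * r (s / 2) * G (X (θ, s), s / 2) := by
        refine fderiv_surfFun_of_line ?_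
        have e : (fun t : ℝ => surfFun (![X (θ, s), Y (θ, s), Z (θ, s)] +
            t • ![Real.cos (2 * Real.pi * θ), 0, 0])) =
            fun t => (2 * r (s / 2) * t + t ^ 2) *
              G (X (θ, s) + t * Real.cos (2 * Real.pi * θ), s / 2) := by
          funext t
          have e2 : r (s / 2) ^ 2 - (X (θ, s) + t * Real.cos (2 * Real.pi * θ) - m (s / 2)) ^ 2 =
              -(2 * r (s / 2) * t + t ^ 2) := by
            simp only [hX]
            linear_combination -(r (s / 2) + t) ^ 2 * hC
          simp only [surfFun_eq, Pi.add_apply, Pi.smul_apply, smul_eq_mul, Matrix.cons_val_zero,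
            Matrix.cons_val_one, Matrix.cons_val, mul_zero, add_zero, hY,
            hplane _ _ (half s hs), e2]
          simp [hZ, hsin]
          ring
        rw [e]
        have hGd : DifferentiableAt ℝ G (X (θ, s) + 0 * Real.cos (2 * Real.pi * θ), s / 2) :=
          ((hG.contDiffAt ((isOpen_univ.prod isOpen_Ioo).mem_nhds
            (show (X (θ, s) + 0 * Real.cos (2 * Real.pi * θ), s / 2) ∈
              (univ : Set ℝ) ×ˢ Ioo (-(1 / 2) : ℝ) (1 / 2) from
                ⟨mem_univ _, half s hs⟩))).differentiableAt (by simp))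
        have hd : DifferentiableAt ℝ
            (fun t : ℝ => G (X (θ, s) + t * Real.cos (2 * Real.pi * θ), s / 2)) 0 :=
          DifferentiableAt.comp (f := fun t : ℝ =>
            (X (θ, s) + t * Real.cos (2 * Real.pi * θ), s / 2)) 0 hGd (by fun_prop)
        have h1 := (((hasDerivAt_id (0 : ℝ)).const_mul (2 * r (s / 2))).add
          ((hasDerivAt_id (0 : ℝ)).pow 2)).mul hd.hasDerivAt
        refine h1.congr_deriv ?_
        simp
      rw [hn, hZθ]
      generalize √(G (X (θ, s), s / 2)) = k at *
      have h4 : 0 < 2 * G (X (θ, s), s / 2) * k * r (s / 2) ^ 2 * Real.pi := by positivity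
      refine h4.trans_eq ?_
      simp only [Matrix.det_fin_three, Matrix.of_apply, Matrix.cons_val', Matrix.cons_val]
      linear_combination -2 * G (X (θ, s), s / 2) * k * r (s / 2) ^ 2 * Real.pi * hC
    · refine ⟨![0, 0, 1], ?_⟩
      rw [fderiv_surfFun_vertical]
      have h4 : 0 < 2 * Real.pi * r (s / 2) ^ 2 * Real.sin (2 * Real.pi * θ) ^ 2 *
          √(G (X (θ, s), s / 2)) := by positivity
      refine h4.trans_eq ?_
      simp only [Matrix.det_fin_three, Matrix.of_apply, Matrix.cons_val', Matrix.cons_val, hZ]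
      ring
  · have h0 : (0 : ℝ) ∈ Ioo (-(1 / 2) : ℝ) (1 / 2) := by norm_num
    have hr0 := hrpos 0 h0
    intro q
    constructor
    · rintro ⟨hy, hq1, hq2⟩
      have hg := hpos _ 0 h0 hq1 hq2
      have hk := (Real.sqrt_pos.2 hg).ne'
      have hk2 := Real.sq_sqrt hg.le
      have hq := q.eqn
      rw [hy, hplane _ 0 h0] at hq
      generalize hkd : √(G (q.1 0, 0)) = k at *
      obtain ⟨θ, h1, h2⟩ := exists_cos_sin_eq (x := (q.1 0 - m 0) / r 0)
        (y := q.1 2 / (r 0 * k)) (by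
          field_simp
          linear_combination hq - (r 0 ^ 2 - (q.1 0 - m 0) ^ 2) * hk2)
      have hx : X (θ, 0) = q.1 0 := by
        simp only [hX, zero_div, h1]
        field_simp
        ring
      refine ⟨θ, funext fun i => ?_⟩
      fin_cases i
      · exact hx.symm
      · simpa [hY] using hy
      · simp only [hZ, hx, zero_div, h2, hkd]
        field_simp
        simp
    · rintro ⟨θ, h⟩
      have h1 := Real.neg_one_le_cos (2 * Real.pi * θ)
      have h2 := Real.cos_le_one (2 * Real.pi * θ)
      rw [mem_ofPred_eq, h]
      refine ⟨by simp [hY], ?_, ?_⟩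
      · simp [hX]; nlinarith
      · simp [hX]; nlinarith
  · intro θ s hs
    rw [coordMap_val (heq θ s hs)]
    refine ⟨⟨1 / 2, by norm_num, by simp [hY]; ring⟩, r (s / 2) * √(G (X (θ, s), s / 2)),
      mul_pos (hrpos _ (half s hs)) (Real.sqrt_pos.2 (hGpos θ s hs)), by simp [hZ]; ring⟩

/-! ### The annuli of the ovals and circles -/

lemma sqrt_sub_sq_contDiffOn {a : ℝ} (ha : 1 / 4 ≤ a) :
    ContDiffOn ℝ ∞ (fun y : ℝ => √(a - y ^ 2)) (Ioo (-(1 / 2)) (1 / 2)) :=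
  ContDiffOn.sqrt (contDiff_const.sub (contDiff_id.pow 2)).contDiffOn fun y hy => by
    have : y ^ 2 < 1 / 4 := by nlinarith [hy.1, hy.2]
    linarith

lemma sqrt_quarter_sub_sq {y : ℝ} (hy : y ∈ Ioo (-(1 / 2) : ℝ) (1 / 2)) :
    0 < √(1 / 4 - y ^ 2) ∧ √(1 / 4 - y ^ 2) ≤ 1 / 2 ∧ √(1 / 4 - y ^ 2) ^ 2 = 1 / 4 - y ^ 2 := by
  have h : 0 < 1 / 4 - y ^ 2 := by nlinarith [hy.1, hy.2]
  refine ⟨Real.sqrt_pos.2 h, ?_, Real.sq_sqrt h.le⟩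
  exact Real.sqrt_le_iff.2 ⟨by norm_num, by nlinarith⟩

lemma sqrt_nine_sub_sq {y : ℝ} (hy : y ∈ Ioo (-(1 / 2) : ℝ) (1 / 2)) :
    29 / 10 < √(9 - y ^ 2) ∧ √(9 - y ^ 2) ^ 2 = 9 - y ^ 2 := by
  have h : y ^ 2 < 1 / 4 := by nlinarith [hy.1, hy.2]
  exact ⟨Real.lt_sqrt_of_sq_lt (by linarith), Real.sq_sqrt (by linarith)⟩

lemma sqrt_quarter : √(1 / 4 - (0 : ℝ) ^ 2) = 1 / 2 := by
  rw [show (1 / 4 - (0 : ℝ) ^ 2) = (1 / 2) ^ 2 by norm_num]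
  exact Real.sqrt_sq (by norm_num)

lemma sqrt_nine : √(9 - (0 : ℝ) ^ 2) = 3 := by
  rw [show (9 - (0 : ℝ) ^ 2) = 3 ^ 2 by norm_num]
  exact Real.sqrt_sq (by norm_num)

/-- The left (`e = -1`) and the right (`e = 1`) oval. At height `y` it extends in `e x` from the edge
`3/2 + √(1/4 - y²)` of the hole to the outer circle at `√(9 - y²)`. -/
lemma exists_isAnnulus_outer_oval {e : ℝ} (he : e = 1 ∨ e = -1) : ∃ φ,
    IsAnnulus φ {q | q.1 1 = 0 ∧ e * (5 / 2) - 1 / 2 ≤ q.1 0 ∧ q.1 0 ≤ e * (5 / 2) + 1 / 2} ∧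
      IsAligned φ 1 2 1 := by
  have hq := sqrt_sub_sq_contDiffOn (a := 1 / 4) le_rfl
  have hp := sqrt_sub_sq_contDiffOn (a := 9) (by norm_num)
  have h := exists_isAnnulus_oval
    (fun y => e * ((√(9 - y ^ 2) + (3 / 2 + √(1 / 4 - y ^ 2))) / 2))
    (fun y => (√(9 - y ^ 2) - (3 / 2 + √(1 / 4 - y ^ 2))) / 2)
    (fun v => (√(9 - v.2 ^ 2) + e * v.1) * (e * v.1 - 3 / 2 + √(1 / 4 - v.2 ^ 2)) *
      ((e * v.1 + 3 / 2) ^ 2 + v.2 ^ 2 - 1 / 4))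
    (contDiffOn_const.mul ((hp.add (contDiffOn_const.add hq)).div_const 2))
    ((hp.sub (contDiffOn_const.add hq)).div_const 2) ?_ ?_ ?_ ?_
  · simp only [sqrt_quarter, sqrt_nine] at h
    norm_num at h
    norm_num
    exact h
  · have hq' : ContDiffOn ℝ ∞ (fun v : ℝ × ℝ => √(1 / 4 - v.2 ^ 2))
        (univ ×ˢ Ioo (-(1 / 2)) (1 / 2)) := hq.comp contDiff_snd.contDiffOn fun v hv => hv.2
    have hp' : ContDiffOn ℝ ∞ (fun v : ℝ × ℝ => √(9 - v.2 ^ 2))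
        (univ ×ˢ Ioo (-(1 / 2)) (1 / 2)) := hp.comp contDiff_snd.contDiffOn fun v hv => hv.2
    have hx : ContDiff ℝ ∞ fun v : ℝ × ℝ => e * v.1 := contDiff_const.mul contDiff_fst
    refine ((hp'.add hx.contDiffOn).mul ((hx.sub contDiff_const).contDiffOn.add hq')).mul ?_
    exact ((((hx.add contDiff_const).pow 2).add (contDiff_snd.pow 2)).sub
      contDiff_const).contDiffOn
  · intro x y hy
    obtain ⟨-, -, q2⟩ := sqrt_quarter_sub_sq hy
    obtain ⟨-, p2⟩ := sqrt_nine_sub_sq hy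
    simp only [planeFun]
    generalize √(1 / 4 - y ^ 2) = q at *
    generalize √(9 - y ^ 2) = p at *
    rw [show 9 - x ^ 2 - y ^ 2 = p ^ 2 - x ^ 2 by linarith,
      show y ^ 2 = 1 / 4 - q ^ 2 by linarith]
    rcases he with rfl | rfl <;> ring
  · intro y hy
    obtain ⟨-, q1, -⟩ := sqrt_quarter_sub_sq hy
    obtain ⟨p1, -⟩ := sqrt_nine_sub_sq hy
    linarith
  · intro x y hy h1 h2
    obtain ⟨q0, q1, q2⟩ := sqrt_quarter_sub_sq hy
    obtain ⟨p1, p2⟩ := sqrt_nine_sub_sq hy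
    simp only at h1 h2 ⊢
    generalize √(1 / 4 - y ^ 2) = q at *
    generalize √(9 - y ^ 2) = p at *
    have hx : 3 / 2 + q ≤ e * x := by rcases he with rfl | rfl <;> linarith
    refine mul_pos (mul_pos ?_ ?_) ?_
    · linarith
    · linarith
    · nlinarith [sq_nonneg y]

/-- The oval between the two holes. -/
lemma exists_isAnnulus_middle_oval : ∃ φ,
    IsAnnulus φ {q | q.1 1 = 0 ∧ -1 ≤ q.1 0 ∧ q.1 0 ≤ 1} ∧ IsAligned φ 1 2 1 := by
  have hq := sqrt_sub_sq_contDiffOn (a := 1 / 4) le_rfl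
  have h := exists_isAnnulus_oval (fun _ => 0) (fun y => 3 / 2 - √(1 / 4 - y ^ 2))
    (fun v => (9 - v.1 ^ 2 - v.2 ^ 2) * ((3 / 2 + √(1 / 4 - v.2 ^ 2)) ^ 2 - v.1 ^ 2))
    contDiffOn_const (contDiffOn_const.sub hq) ?_ ?_ ?_ ?_
  · simp only [sqrt_quarter] at h
    norm_num at h
    exact h
  · have hq' : ContDiffOn ℝ ∞ (fun v : ℝ × ℝ => √(1 / 4 - v.2 ^ 2))
        (univ ×ˢ Ioo (-(1 / 2)) (1 / 2)) := hq.comp contDiff_snd.contDiffOn fun v hv => hv.2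
    exact ((contDiff_const.sub (contDiff_fst.pow 2)).sub (contDiff_snd.pow 2)).contDiffOn.mul
      (((contDiffOn_const.add hq').pow 2).sub (contDiff_fst.pow 2).contDiffOn)
  · intro x y hy
    obtain ⟨-, -, q2⟩ := sqrt_quarter_sub_sq hy
    simp only [planeFun]
    generalize √(1 / 4 - y ^ 2) = q at *
    rw [show y ^ 2 = 1 / 4 - q ^ 2 by linarith]
    ring
  · intro y hy
    obtain ⟨-, q1, -⟩ := sqrt_quarter_sub_sq hy
    linarith
  · intro x y hy h1 h2
    obtain ⟨q0, q1, q2⟩ := sqrt_quarter_sub_sq hy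
    simp only at h1 h2 ⊢
    generalize √(1 / 4 - y ^ 2) = q at *
    refine mul_pos ?_ ?_ <;> nlinarith

/-- An aligned annulus around every component of the intersection with the plane `y = 0`. -/
lemma exists_isAnnulus_ovalSet (k : Fin 3) : ∃ φ, IsAnnulus φ (ovalSet k) ∧ IsAligned φ 1 2 1 := by
  fin_cases k
  · have h := exists_isAnnulus_outer_oval (e := -1) (Or.inr rfl)
    norm_num at h
    exact h
  · exact exists_isAnnulus_middle_oval
  · have h := exists_isAnnulus_outer_oval (e := 1) (Or.inl rfl)
    norm_num at h
    exact h

/-- An aligned annulus around every component of the intersection with the plane `z = 0`. -/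
lemma exists_isAnnulus_circSet (k : Fin 3) :
    ∃ φ κ, (κ = 1 ∨ κ = -1) ∧ IsAnnulus φ (circSet k) ∧ IsAligned φ 2 1 κ := by
  have hole : ∀ e : ℝ, e = 1 ∨ e = -1 → ∃ φ, IsAnnulus φ
      {q | q.1 2 = 0 ∧ (q.1 0 - e * (3 / 2)) ^ 2 + q.1 1 ^ 2 = 1 / 4} ∧ IsAligned φ 2 1 1 := by
    intro e he
    refine exists_isAnnulus_circle (e * (3 / 2)) (1 / 4) 1
      (fun v => (9 - v.1 ^ 2 - v.2 ^ 2) * ((v.1 + e * (3 / 2)) ^ 2 + v.2 ^ 2 - 1 / 4)) (Or.inl rfl)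
      (by fun_prop) ?_ ?_ ?_
    · intro x y
      rw [planeFun]
      rcases he with rfl | rfl <;> ring
    · intro s hs
      positivity
    · intro x y s hs h
      have hs2 : s ^ 2 < 1 := by nlinarith [hs.1, hs.2]
      have hx1 : -(6 / 5) ≤ x - e * (3 / 2) := by nlinarith [sq_nonneg y]
      have hx2 : x - e * (3 / 2) ≤ 6 / 5 := by nlinarith [sq_nonneg y]
      refine mul_pos ?_ ?_
      · rcases he with rfl | rfl <;> nlinarith
      · rcases he with rfl | rfl <;> nlinarith [sq_nonneg y]
  fin_cases k
  · obtain ⟨φ, h⟩ := hole (-1) (Or.inr rfl)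
    refine ⟨φ, 1, Or.inl rfl, ?_⟩
    simpa [circSet, circC, circR] using h
  · obtain ⟨φ, h⟩ := hole 1 (Or.inl rfl)
    refine ⟨φ, 1, Or.inl rfl, ?_⟩
    simpa [circSet, circC, circR] using h
  · have h := exists_isAnnulus_circle 0 9 (-1)
      (fun v => ((v.1 + 3 / 2) ^ 2 + v.2 ^ 2 - 1 / 4) * ((v.1 - 3 / 2) ^ 2 + v.2 ^ 2 - 1 / 4))
      (Or.inr rfl) (by fun_prop) ?_ ?_ ?_
    · obtain ⟨φ, h⟩ := h
      exact ⟨φ, -1, Or.inr rfl, h⟩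
    · intro x y
      rw [planeFun]
      ring
    · intro s hs
      nlinarith [hs.1, hs.2]
    · intro x y s hs h
      have hs2 : s ^ 2 < 1 := by nlinarith [hs.1, hs.2]
      rw [sub_zero] at h
      refine mul_pos ?_ ?_
      · nlinarith [sq_nonneg (x + 3)]
      · nlinarith [sq_nonneg (x - 3)]

lemma chainCurve_zero : chainCurve 0 = ovalSet 0 := by
  ext q
  refine and_congr_right fun hy => ⟨fun h => ⟨?_, h⟩, fun h => h.2⟩
  have h2 := (planeFun_nonneg_iff.1 q.planeFun_nonneg).1
  change -3 ≤ q.1 0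
  nlinarith [sq_nonneg (q.1 1)]

lemma chainCurve_four : chainCurve 4 = ovalSet 2 := by
  ext q
  refine and_congr_right fun hy => ⟨fun h => ⟨h, ?_⟩, fun h => h.1⟩
  have h2 := (planeFun_nonneg_iff.1 q.planeFun_nonneg).1
  change q.1 0 ≤ 3
  nlinarith [sq_nonneg (q.1 1)]

lemma chainCurve_two : chainCurve 2 = ovalSet 1 := rfl

lemma chainCurve_one : chainCurve 1 = circSet 0 := by
  ext q
  simp [chainCurve, circSet, circC, circR]

lemma chainCurve_three : chainCurve 3 = circSet 1 := by
  ext q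
  simp [chainCurve, circSet, circC, circR]

lemma exists_isDehnTwist_chainCurve (i : Fin 5) : ∃ t : DiffPlus, IsDehnTwist t (chainCurve i) := by
  have oval : ∀ k, ∃ t : DiffPlus, IsDehnTwist t (ovalSet k) := fun k => by
    obtain ⟨φ, h, -⟩ := exists_isAnnulus_ovalSet k
    exact h.exists_isDehnTwist
  have circ : ∀ k, ∃ t : DiffPlus, IsDehnTwist t (circSet k) := fun k => by
    obtain ⟨φ, κ, -, h, -⟩ := exists_isAnnulus_circSet k
    exact h.exists_isDehnTwist
  fin_cases i
  · exact chainCurve_zero ▸ oval 0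
  · exact chainCurve_one ▸ circ 0
  · exact chainCurve_two ▸ oval 1
  · exact chainCurve_three ▸ circ 1
  · exact chainCurve_four ▸ oval 2

/-! ### The loops of the labelling generate the fundamental group -/


lemma comp_mem_range {x y : FundamentalGroupoid.mk (vtx 0) ⟶ FundamentalGroupoid.mk (vtx 0)}
    (hx : x ∈ gamma2ToPi.range) (hy : y ∈ gamma2ToPi.range) : x ≫ y ∈ gamma2ToPi.range :=
  gamma2ToPi.range.mul_mem (x := y) (y := x) hy hx

lemma loopLabel_mem_range (i : Fin 6) (ε δ : Bool) : loopLabel i ε δ ∈ gamma2ToPi.range :=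
  isLabelling_loopLabel.mem_of_quad_mem (S := gamma2ToPi.range)
    (fun j => ⟨gamma2Gen j, gamma2ToPi_gen j⟩) i ε δ

lemma vtxClass_comp_mem_range (i : Fin 6) (ε δ ε' δ' : Bool) :
    vtxClass ε δ 0 i ≫ vtxClass ε' δ' i 0 ∈ gamma2ToPi.range := by
  have h := comp_mem_range (loopLabel_mem_range i ε δ)
    (gamma2ToPi.range.inv_mem (loopLabel_mem_range i ε' δ'))
  rw [loopLabel_inv] at h
  have e : (vtxClass ε δ 0 i ≫ vtxClass true true i 0) ≫
      (vtxClass true true 0 i ≫ vtxClass ε' δ' i 0) =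
      vtxClass ε δ 0 i ≫ vtxClass ε' δ' i 0 := by simp
  rw [← e]
  exact h

/-- A loop that goes to a point in one face and returns in another one comes from the surface group.
-/
lemma faceClass_comp_mem_range {q : Surf} {ε δ ε' δ' : Bool} (h : q ∈ face ε δ)
    (h' : q ∈ face ε' δ') :
    faceClass ε δ (vtx_mem_face 0 ε δ) h ≫ faceClass ε' δ' h' (vtx_mem_face 0 ε' δ') ∈
      gamma2ToPi.range := by
  -- the place where the face is changed can be moved to a vertex
  have of_vertex : ∀ {ε δ ε' δ' : Bool} (h : q ∈ face ε δ) (h' : q ∈ face ε' δ') (i : Fin 6),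
      faceClass ε δ (vtx_mem_face i ε δ) h = faceClass ε' δ' (vtx_mem_face i ε' δ') h' →
      faceClass ε δ (vtx_mem_face 0 ε δ) h ≫ faceClass ε' δ' h' (vtx_mem_face 0 ε' δ') ∈
        gamma2ToPi.range := by
    intro ε δ ε' δ' h h' i e
    have e2 : faceClass ε δ (vtx_mem_face 0 ε δ) h ≫ faceClass ε' δ' h' (vtx_mem_face 0 ε' δ') =
        vtxClass ε δ 0 i ≫ vtxClass ε' δ' i 0 := by
      rw [← faceClass_comp (vtx_mem_face 0 ε δ) (vtx_mem_face i ε δ) h, e, Category.assoc,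
        faceClass_comp]
      rfl
    rw [e2]
    exact vtxClass_comp_mem_range _ _ _ _ _
  have across_oval : ∀ {ε δ ε' : Bool} (h : q ∈ face ε δ) (h' : q ∈ face ε' δ),
      faceClass ε δ (vtx_mem_face 0 ε δ) h ≫ faceClass ε' δ h' (vtx_mem_face 0 ε' δ) ∈
        gamma2ToPi.range := by
    intro ε δ ε' h h'
    rcases eq_or_ne ε ε' with rfl | hne
    · exact of_vertex h h' 0 rfl
    · have hy : q.1 1 = 0 := by
        have h1 := h.1
        have h2 := h'.1
        cases ε <;> cases ε' <;> simp [sg] at * <;> linarith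
      obtain ⟨k, hk⟩ := exists_mem_ovalSet hy
      obtain ⟨i, rfl⟩ : ∃ i, ovalIdx i = k := by clear hk; revert k; decide
      refine of_vertex h h' i ?_
      have hi := vtx_mem_ovalSet i
      cases ε <;> cases ε' <;> first
        | exact absurd rfl hne
        | exact faceClass_eq_of_ovalSet hi hk _ _ _ _
        | exact (faceClass_eq_of_ovalSet hi hk _ _ _ _).symm
  have across_circ : ∀ {ε δ δ' : Bool} (h : q ∈ face ε δ) (h' : q ∈ face ε δ'),
      faceClass ε δ (vtx_mem_face 0 ε δ) h ≫ faceClass ε δ' h' (vtx_mem_face 0 ε δ') ∈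
        gamma2ToPi.range := by
    intro ε δ δ' h h'
    rcases eq_or_ne δ δ' with rfl | hne
    · exact of_vertex h h' 0 rfl
    · have hz : q.1 2 = 0 := by
        have h1 := h.2
        have h2 := h'.2
        cases δ <;> cases δ' <;> simp [sg] at * <;> linarith
      obtain ⟨k, hk⟩ := exists_mem_circSet hz
      obtain ⟨i, rfl⟩ : ∃ i, circIdx i = k := by clear hk; revert k; decide
      refine of_vertex h h' i ?_
      have hi := vtx_mem_circSet i
      cases δ <;> cases δ' <;> first
        | exact absurd rfl hne
        | exact faceClass_eq_of_circSet hi hk _ _ _ _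
        | exact (faceClass_eq_of_circSet hi hk _ _ _ _).symm
  have hm : q ∈ face ε' δ := ⟨h'.1, h.2⟩
  have e := comp_mem_range (across_oval h hm) (across_circ hm h')
  rw [Category.assoc, faceClass_comp_assoc, faceClass_self, Category.id_comp] at e
  exact e

/-- The path class becomes an element of the image of the surface group when its end points are
joined to the base point inside of faces. -/
def FaceGen {a b : Surf} (x : FundamentalGroupoid.mk a ⟶ FundamentalGroupoid.mk b) : Prop :=
  ∀ (ε δ ε' δ' : Bool) (ha : a ∈ face ε δ) (hb : b ∈ face ε' δ'),
    faceClass ε δ (vtx_mem_face 0 ε δ) ha ≫ x ≫ faceClass ε' δ' hb (vtx_mem_face 0 ε' δ') ∈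
      gamma2ToPi.range

lemma FaceGen.comp {a b c : Surf} {x : FundamentalGroupoid.mk a ⟶ FundamentalGroupoid.mk b}
    {y : FundamentalGroupoid.mk b ⟶ FundamentalGroupoid.mk c} (hx : FaceGen x) (hy : FaceGen y) :
    FaceGen (x ≫ y) := by
  intro ε δ ε' δ' ha hc
  have hb := exists_mem_face b
  have e := comp_mem_range (hx ε δ _ _ ha hb) (hy _ _ ε' δ' hb hc)
  simp only [Category.assoc] at e ⊢
  rwa [faceClass_comp_assoc, faceClass_self, Category.id_comp] at e

lemma faceGen_faceClass {ε δ : Bool} {a b : Surf} (ha : a ∈ face ε δ) (hb : b ∈ face ε δ) :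
    FaceGen (faceClass ε δ ha hb) := by
  intro ε₁ δ₁ ε₂ δ₂ ha' hb'
  have e := comp_mem_range (faceClass_comp_mem_range ha' ha) (faceClass_comp_mem_range hb hb')
  rw [Category.assoc, faceClass_comp_assoc] at e
  exact e

lemma faceGen_of_mem_face {ε δ : Bool} {a b : Surf} {γ : Path a b} (h : ∀ t, γ t ∈ face ε δ) :
    FaceGen (pathClass γ) := by
  rw [pathClass_eq_faceClass γ h]
  exact faceGen_faceClass _ _

lemma faceGen_cast {a b a' b' : Surf} (ha : a' = a) (hb : b' = b) {γ : Path a b}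
    (h : FaceGen (pathClass γ)) : FaceGen (pathClass (γ.cast ha hb)) := by
  subst ha hb
  exact h

/-- The image of a segment that stays in a face. -/
lemma faceGen_simpClass_of_segment (f : C(ℝ × ℝ, Surf)) (u v : ℝ × ℝ) {ε δ : Bool}
    (h : ∀ w ∈ segment ℝ u v, f w ∈ face ε δ) : FaceGen (simpClass f u v) := by
  let γ : Path u v :=
    { toFun := fun t => AffineMap.lineMap u v (t : ℝ)
      continuous_toFun := by
        exact (AffineMap.lineMap_continuous (R := ℝ)).comp continuous_subtype_val
      source' := by simp
      target' := by simp }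
  rw [← pathClass_map_eq_simpClass f γ]
  refine faceGen_of_mem_face (ε := ε) (δ := δ) fun t => h _ ?_
  rw [segment_eq_image_lineMap]
  exact ⟨t, t.2, rfl⟩

lemma exists_sg_mul_nonneg (r : ℝ) : ∃ ε, 0 ≤ sg ε * r := by
  rcases le_total 0 r with h | h
  · exact ⟨true, by simpa [sg] using h⟩
  · exact ⟨false, by simpa [sg] using h⟩

/-- The sign of the sine is constant on the half turns. -/
lemma exists_sg_mul_sin_nonneg {κ : ℝ} (hκ : κ = 1 ∨ κ = -1) (j : ℤ) :
    ∃ ε, ∀ θ : ℝ, (j : ℝ) / 2 ≤ θ → θ ≤ ((j : ℝ) + 1) / 2 →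
      0 ≤ sg ε * (κ * Real.sin (2 * Real.pi * θ)) := by
  have main : ∀ θ : ℝ, (j : ℝ) / 2 ≤ θ → θ ≤ ((j : ℝ) + 1) / 2 →
      0 ≤ (-1) ^ j * Real.sin (2 * Real.pi * θ) := by
    intro θ h1 h2
    have hpi := Real.pi_pos
    have e : 2 * Real.pi * θ - j * Real.pi = Real.pi * (2 * θ - j) := by ring
    rw [← Real.sin_sub_int_mul_pi, e]
    refine Real.sin_nonneg_of_nonneg_of_le_pi (mul_nonneg hpi.le (by linarith)) ?_
    nlinarith
  rcases Int.even_or_odd j with hj | hj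
  · rw [hj.neg_one_zpow] at main
    rcases hκ with rfl | rfl
    · exact ⟨true, fun θ h1 h2 => by simpa [sg] using main θ h1 h2⟩
    · exact ⟨false, fun θ h1 h2 => by simpa [sg] using main θ h1 h2⟩
  · rw [hj.neg_one_zpow] at main
    rcases hκ with rfl | rfl
    · exact ⟨false, fun θ h1 h2 => by simpa [sg] using main θ h1 h2⟩
    · exact ⟨true, fun θ h1 h2 => by simpa [sg] using main θ h1 h2⟩

/-- Paths in an aligned annulus are composed of paths in faces. -/
lemma IsAnnulus.exists_faceGen_nhds {φ : ℝ → ℝ → Surf} {C : Set Surf} (hφ : IsAnnulus φ C)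
    {m n : Fin 3} (hmn : m = 1 ∧ n = 2 ∨ m = 2 ∧ n = 1) {κ : ℝ} (hκ : κ = 1 ∨ κ = -1)
    (hal : IsAligned φ m n κ) {p : Surf} (hp : p ∈ C) :
    ∃ U : Set Surf, IsOpen U ∧ p ∈ U ∧
      ∀ {a b : Surf} (γ : Path a b), (∀ t, γ t ∈ U) → FaceGen (pathClass γ) := by
  rw [← hφ.core] at hp
  obtain ⟨θ₀, rfl⟩ := hp
  obtain ⟨Θ, U, hU, hmem, hΘ, hΘ₀, -, hΘq⟩ := hφ.exists_chart θ₀ (s₀ := 0) (by simp)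
  -- `cl` clamps the second parameter, so that the annulus extends to a map of the whole plane
  let cl : ℝ → ℝ := fun s => max (-(1 / 2)) (min s (1 / 2))
  have hcl : ∀ s, cl s ∈ Ioo (-1 : ℝ) 1 := fun s =>
    ⟨lt_of_lt_of_le (by norm_num) (le_max_left _ _),
      max_lt (by norm_num) ((min_le_right _ _).trans_lt (by norm_num))⟩
  have hclpos : ∀ s, 0 ≤ s → 0 ≤ cl s := fun s hs => le_max_of_le_right (le_min hs (by norm_num))
  have hclneg : ∀ s, s ≤ 0 → cl s ≤ 0 := fun s hs =>
    max_le (by norm_num) ((min_le_left _ _).trans hs)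
  have hclcont : Continuous cl := by fun_prop
  have hclid : ∀ s ∈ Ioo (-(1 / 2) : ℝ) (1 / 2), cl s = s := fun s hs => by
    simp only [cl]
    rw [min_eq_left hs.2.le, max_eq_right hs.1.le]
  let f : C(ℝ × ℝ, Surf) := ⟨fun q => φ q.1 (cl q.2), hφ.continuousOn.comp_continuous
    (f := fun q : ℝ × ℝ => (q.1, cl q.2)) (by fun_prop) fun q => ⟨mem_univ _, hcl _⟩⟩
  have sign : ∀ (u v : ℝ × ℝ), (∃ ε, ∀ w ∈ segment ℝ u v, 0 ≤ sg ε * cl w.2) →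
      (∃ ε, ∀ w ∈ segment ℝ u v, 0 ≤ sg ε * (κ * Real.sin (2 * Real.pi * w.1))) →
      FaceGen (simpClass f u v) := by
    rintro u v ⟨ε, hε⟩ ⟨δ, hδ⟩
    have h1 : ∀ w ∈ segment ℝ u v, 0 ≤ sg ε * (f w).1 m := fun w hw => by
      obtain ⟨⟨a, ha, e⟩, -⟩ := hal w.1 _ (hcl w.2)
      change 0 ≤ sg ε * (φ w.1 (cl w.2)).1 m
      rw [e, ← mul_assoc]
      exact mul_nonneg (hε w hw) ha.le
    have h2 : ∀ w ∈ segment ℝ u v, 0 ≤ sg δ * (f w).1 n := fun w hw => by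
      obtain ⟨-, b, hb, e⟩ := hal w.1 _ (hcl w.2)
      change 0 ≤ sg δ * (φ w.1 (cl w.2)).1 n
      rw [e, ← mul_assoc]
      exact mul_nonneg (hδ w hw) hb.le
    rcases hmn with ⟨rfl, rfl⟩ | ⟨rfl, rfl⟩
    · exact faceGen_simpClass_of_segment f u v (ε := ε) (δ := δ) fun w hw => ⟨h1 w hw, h2 w hw⟩
    · exact faceGen_simpClass_of_segment f u v (ε := δ) (δ := ε) fun w hw => ⟨h2 w hw, h1 w hw⟩
  have vert : ∀ θ s t : ℝ, (0 ≤ s ∧ 0 ≤ t ∨ s ≤ 0 ∧ t ≤ 0) →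
      FaceGen (simpClass f (θ, s) (θ, t)) := by
    intro θ s t hst
    have hseg : ∀ w ∈ segment ℝ ((θ, s) : ℝ × ℝ) (θ, t), w.1 = θ ∧ (0 ≤ w.2 ∨ ¬ (0 ≤ s ∧ 0 ≤ t)) ∧
        (w.2 ≤ 0 ∨ ¬ (s ≤ 0 ∧ t ≤ 0)) := by
      rintro w ⟨a, b, ha, hb, hab, rfl⟩
      refine ⟨?_, ?_, ?_⟩
      · simp [← add_mul, hab]
      · rw [or_iff_not_imp_right, not_not]
        rintro ⟨h1, h2⟩
        simpa using add_nonneg (mul_nonneg ha h1) (mul_nonneg hb h2)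
      · rw [or_iff_not_imp_right, not_not]
        rintro ⟨h1, h2⟩
        simpa using add_nonpos (mul_nonpos_of_nonneg_of_nonpos ha h1)
          (mul_nonpos_of_nonneg_of_nonpos hb h2)
    refine sign _ _ ?_ ?_
    · rcases hst with h | h
      · exact ⟨true, fun w hw => by
          simpa [sg] using hclpos _ ((hseg w hw).2.1.resolve_right (not_not.2 h))⟩
      · exact ⟨false, fun w hw => by
          simpa [sg] using hclneg _ ((hseg w hw).2.2.resolve_right (not_not.2 h))⟩
    · obtain ⟨ε, hε⟩ := exists_sg_mul_nonneg (κ * Real.sin (2 * Real.pi * θ))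
      exact ⟨ε, fun w hw => by rwa [(hseg w hw).1]⟩
  have hor : ∀ (j : ℤ) (θ θ' : ℝ), θ ∈ Icc ((j : ℝ) / 2) (((j : ℝ) + 1) / 2) →
      θ' ∈ Icc ((j : ℝ) / 2) (((j : ℝ) + 1) / 2) → FaceGen (simpClass f (θ, 0) (θ', 0)) := by
    intro j θ θ' hθ hθ'
    have hseg : ∀ w ∈ segment ℝ ((θ, 0) : ℝ × ℝ) (θ', 0),
        w.1 ∈ Icc ((j : ℝ) / 2) (((j : ℝ) + 1) / 2) ∧ w.2 = 0 := by
      rintro w ⟨a, b, ha, hb, hab, rfl⟩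
      exact ⟨by simpa using convex_Icc _ _ hθ hθ' ha hb hab, by simp⟩
    refine sign _ _ ⟨true, fun w hw => ?_⟩ ?_
    · rw [(hseg w hw).2]
      simpa [sg] using hclpos 0 le_rfl
    · obtain ⟨ε, hε⟩ := exists_sg_mul_sin_nonneg hκ j
      exact ⟨ε, fun w hw => hε _ (hseg w hw).1.1 (hseg w hw).1.2⟩
  have trans : ∀ u v w : ℝ × ℝ, FaceGen (simpClass f u v) → FaceGen (simpClass f v w) →
      FaceGen (simpClass f u w) := fun u v w h1 h2 => by
    rw [← simpClass_comp f u v w]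
    exact h1.comp h2
  have floor : ∀ θ : ℝ, θ ∈ Icc ((⌊2 * θ⌋ : ℝ) / 2) (((⌊2 * θ⌋ : ℝ) + 1) / 2) := fun θ =>
    ⟨by linarith [Int.floor_le (2 * θ)], by linarith [Int.lt_floor_add_one (2 * θ)]⟩
  have left : ∀ j : ℤ, ((j : ℝ) / 2) ∈ Icc ((j : ℝ) / 2) (((j : ℝ) + 1) / 2) := fun j =>
    ⟨le_rfl, by linarith⟩
  have right : ∀ j : ℤ, (((j + 1 : ℤ) : ℝ) / 2) ∈ Icc ((j : ℝ) / 2) (((j : ℝ) + 1) / 2) := fun j =>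
    ⟨by push_cast; linarith, by push_cast; linarith⟩
  have horiz : ∀ θ θ' : ℝ, FaceGen (simpClass f (θ, 0) (θ', 0)) := by
    intro θ θ'
    have ind : ∀ j : ℤ, FaceGen (simpClass f (θ, 0) ((j : ℝ) / 2, 0)) := by
      intro j
      induction j using Int.inductionOn' (b := ⌊2 * θ⌋) with
      | zero => exact hor _ _ _ (floor θ) (left _)
      | succ k _ ih => exact trans _ _ _ ih (hor k _ _ (left k) (right k))
      | pred k _ ih =>
        refine trans _ _ _ ih (hor (k - 1) _ _ ?_ (left (k - 1)))
        simpa using right (k - 1)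
    exact trans _ _ _ (ind ⌊2 * θ'⌋) (hor _ _ _ (left _) (floor θ'))
  -- go vertically to the core, along it in half turns, and vertically to the end
  have all : ∀ u v : ℝ × ℝ, FaceGen (simpClass f u v) := by
    rintro ⟨θ, s⟩ ⟨θ', s'⟩
    have h1 : FaceGen (simpClass f (θ, s) (θ, 0)) := vert _ _ _ (by
      rcases le_total 0 s with h | h <;> simp [h])
    have h2 : FaceGen (simpClass f (θ', 0) (θ', s')) := vert _ _ _ (by
      rcases le_total 0 s' with h | h <;> simp [h])
    exact trans _ _ _ h1 (trans _ _ _ (horiz θ θ') h2)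
  have hΘc : ContinuousOn Θ U := hΘ.continuousOn
  let V : Set R3 := U ∩ (fun x => (Θ x).2) ⁻¹' Ioo (-(1 / 2)) (1 / 2)
  have hV : IsOpen V := (continuous_snd.comp_continuousOn hΘc).isOpen_inter_preimage hU isOpen_Ioo
  refine ⟨Subtype.val ⁻¹' V, hV.preimage continuous_subtype_val,
    ⟨hmem, by simp [mem_preimage, hΘ₀]⟩, ?_⟩
  intro a b γ hγ
  have hf : ∀ q : Surf, (q : R3) ∈ V → f (Θ q) = q := fun q hq => by
    change φ (Θ q).1 (cl (Θ q).2) = q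
    rw [hclid _ hq.2, hΘq q hq.1]
  have ha : (a : R3) ∈ V := by simpa using hγ 0
  have hb : (b : R3) ∈ V := by simpa using hγ 1
  let Γ : Path (Θ a) (Θ b) :=
    { toFun := fun t => Θ (γ t)
      continuous_toFun := hΘc.comp_continuous (continuous_subtype_val.comp γ.continuous)
        fun t => (hγ t).1
      source' := by simp
      target' := by simp }
  have e : γ = (Γ.map f.continuous).cast (hf a ha).symm (hf b hb).symm := by
    ext1
    funext t
    exact (hf _ (hγ t)).symm
  rw [e]
  refine faceGen_cast _ _ ?_
  rw [pathClass_map_eq_simpClass]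
  exact all _ _

/-- Every path class is composed of classes of paths in faces. -/
lemma faceGen_of_pathClass {a b : Surf} (x : FundamentalGroupoid.mk a ⟶ FundamentalGroupoid.mk b) :
    FaceGen x := by
  have loc : ∀ p : Surf, ∃ U : Set Surf, IsOpen U ∧ p ∈ U ∧
      ∀ {a b : Surf} (γ : Path a b), (∀ t, γ t ∈ U) → FaceGen (pathClass γ) := by
    intro p
    by_cases hy : p.1 1 = 0
    · obtain ⟨k, hk⟩ := exists_mem_ovalSet hy
      obtain ⟨φ, hφ, hal⟩ := exists_isAnnulus_ovalSet k
      exact hφ.exists_faceGen_nhds (Or.inl ⟨rfl, rfl⟩) (Or.inl rfl) hal hk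
    by_cases hz : p.1 2 = 0
    · obtain ⟨k, hk⟩ := exists_mem_circSet hz
      obtain ⟨φ, κ, hκ, hφ, hal⟩ := exists_isAnnulus_circSet k
      exact hφ.exists_faceGen_nhds (Or.inr ⟨rfl, rfl⟩) hκ hal hk
    obtain ⟨ε, hε⟩ := exists_sg_mul_nonneg (p.1 1)
    obtain ⟨δ, hδ⟩ := exists_sg_mul_nonneg (p.1 2)
    have hsg : ∀ ε, sg ε ≠ 0 := fun ε => by cases ε <;> simp [sg]
    refine ⟨{q | 0 < sg ε * q.1 1 ∧ 0 < sg δ * q.1 2},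
      (isOpen_lt continuous_const (continuous_const.mul (Surf.continuous_coord 1))).inter
        (isOpen_lt continuous_const (continuous_const.mul (Surf.continuous_coord 2))),
      ⟨hε.lt_of_ne (mul_ne_zero (hsg ε) hy).symm, hδ.lt_of_ne (mul_ne_zero (hsg δ) hz).symm⟩, ?_⟩
    intro a b γ hγ
    exact faceGen_of_mem_face (ε := ε) (δ := δ) fun t => ⟨(hγ t).1.le, (hγ t).2.le⟩
  choose U hU hpU hUγ using loc
  exact pathClass_induction U hU (fun p => ⟨p, hpU p⟩) (fun x => FaceGen x)
    (fun _ _ hx hy => hx.comp hy) (fun i _ _ γ hγ => hUγ i γ hγ) x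

lemma gamma2ToPi_surjective : Function.Surjective gamma2ToPi := by
  intro x
  have h := faceGen_of_pathClass x true true true true (vtx_mem_face 0 _ _) (vtx_mem_face 0 _ _)
  rw [faceClass_self, Category.id_comp, Category.comp_id] at h
  exact h

/-- The surface group is the fundamental group of the surface. -/
def gamma2EquivPi : Gamma2 ≃* FundamentalGroup Surf (vtx 0) :=
  MulEquiv.ofBijective gamma2ToPi ⟨gamma2ToPi_injective, gamma2ToPi_surjective⟩

/-! ### The two sides of an annulus around a curve of the chain -/

lemma pos_of_isPreconnected {X : Type*} [TopologicalSpace X] {S : Set X} (hS : _root_.IsPreconnected S)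
    {g : X → ℝ} (hg : ContinuousOn g S) (h0 : ∀ x ∈ S, g x ≠ 0) {a b : X} (ha : a ∈ S) (hb : b ∈ S)
    (hpos : 0 < g a) : 0 < g b := by
  by_contra hneg
  obtain ⟨x, hx, e⟩ := hS.intermediate_value hb ha hg ⟨not_lt.1 hneg, hpos.le⟩
  exact h0 x hx e

/-- The coordinate that vanishes on the `i`-th curve of the chain. -/
def sideIdx (i : Fin 5) : Fin 3 := ![1, 2, 1, 2, 1] i

/-- The coordinate other than `x` that does not vanish on the `i`-th curve of the chain. -/
def arcIdx (i : Fin 5) : Fin 3 := ![2, 1, 2, 1, 2] i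

lemma nonneg_of_posFace {i : Fin 5} {ε δ : Bool} (h : IsLabelling.posFace i ε δ = true) {q : Surf}
    (hq : q ∈ face ε δ) : 0 ≤ q.1 (sideIdx i) := by
  obtain ⟨h1, h2⟩ := hq
  fin_cases i <;> simp [IsLabelling.posFace] at h <;> subst h <;> simp [sg] at h1 h2 <;> assumption

lemma nonpos_of_posFace {i : Fin 5} {ε δ : Bool} (h : IsLabelling.posFace i ε δ = false) {q : Surf}
    (hq : q ∈ face ε δ) : q.1 (sideIdx i) ≤ 0 := by
  obtain ⟨h1, h2⟩ := hq
  fin_cases i <;> simp [IsLabelling.posFace] at h <;> subst h <;> simp [sg] at h1 h2 <;> assumption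

lemma mem_face_of_arc_nonneg {i : Fin 5} {q : Surf} (h0 : q.1 (sideIdx i) = 0)
    (h : 0 ≤ q.1 (arcIdx i)) : q ∈ face true true := by
  fin_cases i <;> simp [sideIdx, arcIdx] at h0 h <;> simp [face, sg, h0, h]

lemma mem_face_of_arc_nonpos {i : Fin 5} {q : Surf} (h0 : q.1 (sideIdx i) = 0)
    (h : q.1 (arcIdx i) ≤ 0) : q ∈ face (IsLabelling.backFace i).1 (IsLabelling.backFace i).2 := by
  fin_cases i <;> simp [sideIdx, arcIdx] at h0 h <;> simp [IsLabelling.backFace, face, sg, h0, h]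

lemma IsLabelling.posFace_true (i : Fin 5) : IsLabelling.posFace i true true = true := by revert i; decide

/-- A curve of the chain is a component of the intersection of the surface with a plane. -/
lemma chainCurve_component (i : Fin 5) : ∃ W : Set Surf, IsOpen W ∧ chainCurve i ⊆ W ∧
    ∀ q ∈ W, q.1 (sideIdx i) = 0 → q ∈ chainCurve i := by
  have oval : ∀ k, ∃ W : Set Surf, IsOpen W ∧ ovalSet k ⊆ W ∧
      ∀ q ∈ W, q.1 1 = 0 → q ∈ ovalSet k := by
    intro k
    refine ⟨⋂ l, {q | l = k} ∪ (ovalSet l)ᶜ, isOpen_iInter_of_finite fun l =>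
      isOpen_const.union (isClosed_ovalSet l).isOpen_compl, fun q hq => mem_iInter.2 fun l => ?_,
      fun q hq h => ?_⟩
    · by_cases hl : q ∈ ovalSet l
      · exact Or.inl (ovalSet_disjoint hl hq)
      · exact Or.inr hl
    · obtain ⟨l, hl⟩ := exists_mem_ovalSet h
      rcases mem_iInter.1 hq l with e | e
      · exact (show l = k from e) ▸ hl
      · exact absurd hl e
  have circ : ∀ k, ∃ W : Set Surf, IsOpen W ∧ circSet k ⊆ W ∧
      ∀ q ∈ W, q.1 2 = 0 → q ∈ circSet k := by
    intro k
    refine ⟨⋂ l, {q | l = k} ∪ (circSet l)ᶜ, isOpen_iInter_of_finite fun l =>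
      isOpen_const.union (isClosed_circSet l).isOpen_compl, fun q hq => mem_iInter.2 fun l => ?_,
      fun q hq h => ?_⟩
    · by_cases hl : q ∈ circSet l
      · exact Or.inl (circSet_disjoint hl hq)
      · exact Or.inr hl
    · obtain ⟨l, hl⟩ := exists_mem_circSet h
      rcases mem_iInter.1 hq l with e | e
      · exact (show l = k from e) ▸ hl
      · exact absurd hl e
  fin_cases i
  · exact chainCurve_zero ▸ oval 0
  · exact chainCurve_one ▸ circ 0
  · exact chainCurve_two ▸ oval 1
  · exact chainCurve_three ▸ circ 1
  · exact chainCurve_four ▸ oval 2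

lemma side_eq_zero {i : Fin 5} {q : Surf} (h : q ∈ chainCurve i) : q.1 (sideIdx i) = 0 := by
  fin_cases i <;> exact h.1

lemma vtx_mem_chainCurve {i : Fin 5} {k : Fin 6} :
    vtx k ∈ chainCurve i ↔ k = i.castSucc ∨ k = i.succ := by
  fin_cases i <;> fin_cases k <;> norm_num [chainCurve, vtxX, Fin.ext_iff]

lemma eq_vtx_of_arc_eq_zero {i : Fin 5} {q : Surf} (h : q ∈ chainCurve i)
    (h0 : q.1 (arcIdx i) = 0) : q = vtx i.castSucc ∨ q = vtx i.succ := by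
  have key : ∀ k l : Fin 6, q.1 1 = 0 → q.1 2 = 0 → (q.1 0 - vtxX k) * (q.1 0 - vtxX l) = 0 →
      q = vtx k ∨ q = vtx l := by
    intro k l hy hz hx
    rcases mul_eq_zero.1 hx with e | e
    · exact Or.inl (Surf.ext' (by simpa using sub_eq_zero.1 e) hy hz)
    · exact Or.inr (Surf.ext' (by simpa using sub_eq_zero.1 e) hy hz)
  have hs := side_eq_zero h
  have hy : q.1 1 = 0 := by fin_cases i <;> assumption
  have hz : q.1 2 = 0 := by fin_cases i <;> assumption
  refine key _ _ hy hz ?_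
  have hq := q.eqn
  rw [hz, hy, planeFun] at hq
  have e : (q.1 0 - -3) * (q.1 0 - -2) * ((q.1 0 - -1) * (q.1 0 - 1)) *
      ((q.1 0 - 2) * (q.1 0 - 3)) = 0 := by linear_combination hq
  rw [mul_eq_zero, mul_eq_zero] at e
  fin_cases i
  · obtain ⟨-, hx⟩ := h
    have := (planeFun_nonneg_iff.1 q.planeFun_nonneg).1
    exact (e.resolve_right (by nlinarith)).resolve_right (by nlinarith)
  · obtain ⟨-, hx⟩ := h
    rw [hy] at hx
    change (q.1 0 - -2) * (q.1 0 - -1) = 0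
    linear_combination hx
  · obtain ⟨-, hx1, hx2⟩ := h
    exact (e.resolve_right (by nlinarith)).resolve_left (by nlinarith)
  · obtain ⟨-, hx⟩ := h
    rw [hy] at hx
    change (q.1 0 - 1) * (q.1 0 - 2) = 0
    linear_combination hx
  · obtain ⟨-, hx⟩ := h
    exact e.resolve_left fun h' => by rcases h' with h' | h' <;> nlinarith

lemma surfNormal_vtx (k : Fin 6) : surfNormal (vtx k) = ![2 * vtxX k *
    ((vtxX k + 3 / 2) ^ 2 - 1 / 4) * ((vtxX k - 3 / 2) ^ 2 - 1 / 4) - (9 - vtxX k ^ 2) *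
    (2 * (vtxX k + 3 / 2) * ((vtxX k - 3 / 2) ^ 2 - 1 / 4) +
      ((vtxX k + 3 / 2) ^ 2 - 1 / 4) * (2 * (vtxX k - 3 / 2))), 0, 0] := by
  have hid := hasDerivAt_id (0 : ℝ)
  have hsq := hid.pow 2
  have hv : (vtx k : R3) = ![vtxX k, 0, 0] := rfl
  generalize vtxX k = x at *
  funext i
  rw [surfNormal, hv]
  refine fderiv_surfFun_of_line ?_
  fin_cases i
  · have e : (fun t : ℝ => surfFun (![x, 0, 0] + t • Pi.single 0 1)) = fun t =>
        -((9 - (x + t) ^ 2) * ((x + 3 / 2 + t) ^ 2 - 1 / 4) * ((x - 3 / 2 + t) ^ 2 - 1 / 4)) := by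
      funext t
      simp only [surfFun_eq, planeFun, Pi.add_apply, Pi.smul_apply, smul_eq_mul]
      simp
      ring
    change HasDerivAt (fun t : ℝ => surfFun (![x, 0, 0] + t • Pi.single 0 1)) _ 0
    rw [e]
    have h := (((((hid.const_add x).pow 2).const_sub 9).mul
      (((hid.const_add (x + 3 / 2)).pow 2).sub_const (1 / 4))).mul
      (((hid.const_add (x - 3 / 2)).pow 2).sub_const (1 / 4))).neg
    refine h.congr_deriv ?_
    simp
    ring
  · have e : (fun t : ℝ => surfFun (![x, 0, 0] + t • Pi.single 1 1)) = fun t =>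
        -((9 - x ^ 2 - t ^ 2) * ((x + 3 / 2) ^ 2 - 1 / 4 + t ^ 2) *
          ((x - 3 / 2) ^ 2 - 1 / 4 + t ^ 2)) := by
      funext t
      simp only [surfFun_eq, planeFun, Pi.add_apply, Pi.smul_apply, smul_eq_mul]
      simp
      ring
    change HasDerivAt (fun t : ℝ => surfFun (![x, 0, 0] + t • Pi.single 1 1)) _ 0
    rw [e]
    have h := (((hsq.const_sub (9 - x ^ 2)).mul
      (hsq.const_add ((x + 3 / 2) ^ 2 - 1 / 4))).mul
      (hsq.const_add ((x - 3 / 2) ^ 2 - 1 / 4))).neg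
    refine h.congr_deriv ?_
    simp
  · have e : (fun t : ℝ => surfFun (![x, 0, 0] + t • Pi.single 2 1)) = fun t =>
        t ^ 2 - planeFun x 0 := by
      funext t
      simp only [surfFun_eq, Pi.add_apply, Pi.smul_apply, smul_eq_mul]
      simp
    change HasDerivAt (fun t : ℝ => surfFun (![x, 0, 0] + t • Pi.single 2 1)) _ 0
    rw [e]
    refine (hsq.sub_const _).congr_deriv ?_
    simp

/-- At the right vertex of a curve of the chain, a positive basis whose second vector is tangent to
the curve. The normal points to the right if the curve is an oval and to the left if it is the
boundary of a hole. -/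
lemma mul_pos_of_surfOrient_pos {i : Fin 5} {u v : R3} (h : 0 < surfOrient (vtx i.succ) u v)
    (hv : v (sideIdx i) = 0) : 0 < u (sideIdx i) * v (arcIdx i) := by
  rw [surfOrient, surfNormal_vtx] at h
  simp only [Matrix.det_fin_three, Matrix.of_apply, Matrix.cons_val', Matrix.cons_val] at h
  fin_cases i
  · have hv' : v 1 = 0 := hv
    change 0 < u 1 * v 2
    rw [hv', show vtxX _ = -2 from rfl] at h
    norm_num at h
    nlinarith
  · have hv' : v 2 = 0 := hv
    change 0 < u 2 * v 1
    rw [hv', show vtxX _ = -1 from rfl] at h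
    norm_num at h
    nlinarith
  · have hv' : v 1 = 0 := hv
    change 0 < u 1 * v 2
    rw [hv', show vtxX _ = 1 from rfl] at h
    norm_num at h
    nlinarith
  · have hv' : v 2 = 0 := hv
    change 0 < u 2 * v 1
    rw [hv', show vtxX _ = 2 from rfl] at h
    norm_num at h
    nlinarith
  · have hv' : v 1 = 0 := hv
    change 0 < u 1 * v 2
    rw [hv', show vtxX _ = 3 from rfl] at h
    norm_num at h
    nlinarith

/-- The `m`-th coordinate is negative for `-ε ≤ s < 0`, zero for `s = 0` and positive for
`0 < s ≤ ε` in the annulus `φ`. -/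
structure IsSided (φ : ℝ → ℝ → Surf) (m : Fin 3) (ε : ℝ) : Prop where
  eps_pos : 0 < ε
  eps_le : ε ≤ 1 / 2
  pos : ∀ θ : ℝ, ∀ s ∈ Ioc 0 ε, 0 < (φ θ s).1 m
  neg : ∀ θ : ℝ, ∀ s ∈ Ico (-ε) 0, (φ θ s).1 m < 0

lemma sign_of_hasDerivAt_pos {g : ℝ → ℝ} {g' x : ℝ} (h : HasDerivAt g g' x) (hg' : 0 < g')
    (h0 : g x = 0) : ∀ᶠ y in 𝓝 x, (x < y → 0 < g y) ∧ (y < x → g y < 0) := by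
  have h1 := eventually_nhdsWithin_sign_eq_of_deriv_pos (f := g) (x₀ := x) (by rwa [h.deriv]) h0
  filter_upwards [h1] with y hy
  constructor
  · intro hxy
    rw [sign_pos (sub_pos.2 hxy)] at hy
    exact sign_eq_one_iff.1 hy
  · intro hxy
    rw [sign_neg (sub_neg.2 hxy)] at hy
    exact sign_eq_neg_one_iff.1 hy

/-- A thin annulus around a curve of the chain meets the plane of the curve only in the curve; if the
coordinate increases across the curve at one point, then it does so at all points. -/
lemma IsAnnulus.exists_isSided {φ : ℝ → ℝ → Surf} {i : Fin 5} (hφ : IsAnnulus φ (chainCurve i))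
    {θ₀ : ℝ} (hd : 0 < deriv (fun b => (φ θ₀ b : R3)) 0 (sideIdx i)) :
    ∃ ε, IsSided φ (sideIdx i) ε := by
  obtain ⟨W, hW, hCW, hWC⟩ := chainCurve_component i
  have hmem : ∀ θ, φ θ 0 ∈ chainCurve i := fun θ => hφ.core ▸ ⟨θ, rfl⟩
  have hop := hφ.continuousOn.isOpen_inter_preimage IsAnnulus.isOpen_strip hW
  obtain ⟨u, v, hu, hv, hIu, hv0, huv⟩ := generalized_tube_lemma (isCompact_Icc (a := (0 : ℝ)) (b := 1))
    (isCompact_singleton (x := (0 : ℝ))) hop (by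
      rintro ⟨θ, s⟩ ⟨-, rfl⟩
      exact ⟨⟨mem_univ _, by simp⟩, hCW (hmem θ)⟩)
  obtain ⟨η, hη, hηv⟩ := Metric.isOpen_iff.1 hv 0 (hv0 rfl)
  set ε := min (η / 2) (1 / 2) with hε
  have hε0 : 0 < ε := lt_min (by linarith) (by norm_num)
  have hε2 : ε ≤ 1 / 2 := min_le_right _ _
  have hstrip : ∀ s ∈ Icc (-ε) ε, s ∈ Ioo (-1 : ℝ) 1 := fun s hs =>
    ⟨by linarith [hs.1], by linarith [hs.2]⟩
  have hin : ∀ θ : ℝ, ∀ s ∈ Icc (-ε) ε, φ θ s ∈ W := by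
    intro θ s hs
    have hsv : s ∈ v := hηv (by
      rw [Metric.mem_ball, Real.dist_eq, sub_zero]
      exact (abs_le.2 hs).trans_lt ((min_le_left _ _).trans_lt (by linarith)))
    have h := (huv (show (Int.fract θ, s) ∈ u ×ˢ v from
      ⟨hIu ⟨Int.fract_nonneg _, (Int.fract_lt_one _).le⟩, hsv⟩)).2
    have e := hφ.add_int (Int.fract θ) ⌊θ⌋ (hstrip s hs)
    rw [Int.fract_add_floor] at e
    rw [e]
    exact h
  have hne : ∀ θ : ℝ, ∀ s ∈ Icc (-ε) ε, s ≠ 0 → (φ θ s).1 (sideIdx i) ≠ 0 := by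
    intro θ s hs hs0 h0
    have := hWC _ (hin θ s hs) h0
    rw [← hφ.core] at this
    obtain ⟨θ', e⟩ := this
    exact hs0 ((hφ.inj _ _ 0 (by simp) s (hstrip s hs)).1 e).1.symm
  have hcont : ContinuousOn (fun q : ℝ × ℝ => (φ q.1 q.2).1 (sideIdx i))
      ((univ : Set ℝ) ×ˢ Ioo (-1 : ℝ) 1) :=
    (Surf.continuous_coord _).comp_continuousOn hφ.continuousOn
  have hdi := hasDerivAt_pi.1 (hφ.hasDerivAt_right θ₀ (s := 0) (by simp)) (sideIdx i)
  rw [(hφ.hasDerivAt_right θ₀ (s := 0) (by simp)).deriv] at hd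
  obtain ⟨r, hr, hball⟩ := Metric.eventually_nhds_iff.1
    (sign_of_hasDerivAt_pos hdi hd (side_eq_zero (hmem θ₀)))
  set s₀ := min (r / 2) ε with hs₀
  have hs₀0 : 0 < s₀ := lt_min (by linarith) hε0
  have hs₀r : s₀ < r := (min_le_left _ _).trans_lt (by linarith)
  have hs₀ε : s₀ ≤ ε := min_le_right _ _
  refine ⟨ε, hε0, hε2, fun θ s hs => ?_, fun θ s hs => ?_⟩
  · have hpre : _root_.IsPreconnected ((univ : Set ℝ) ×ˢ Ioc (0 : ℝ) ε) :=
      isPreconnected_univ.prod isPreconnected_Ioc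
    exact pos_of_isPreconnected hpre (g := fun q : ℝ × ℝ => (φ q.1 q.2).1 (sideIdx i))
      (hcont.mono fun q hq => ⟨mem_univ _, hstrip _ ⟨by linarith [hq.2.1], hq.2.2⟩⟩)
      (fun q hq => hne _ _ ⟨by linarith [hq.2.1], hq.2.2⟩ hq.2.1.ne')
      (a := (θ₀, s₀)) (b := (θ, s)) ⟨mem_univ _, hs₀0, hs₀ε⟩ ⟨mem_univ _, hs⟩
      ((hball (by rw [Real.dist_eq, sub_zero, abs_of_pos hs₀0]; exact hs₀r)).1 hs₀0)
  · have hpre : _root_.IsPreconnected ((univ : Set ℝ) ×ˢ Ico (-ε) 0) :=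
      isPreconnected_univ.prod isPreconnected_Ico
    have := pos_of_isPreconnected hpre (g := fun q : ℝ × ℝ => -(φ q.1 q.2).1 (sideIdx i))
      (hcont.neg.mono fun q hq => ⟨mem_univ _, hstrip _ ⟨hq.2.1, by linarith [hq.2.2]⟩⟩)
      (fun q hq => neg_ne_zero.2 (hne _ _ ⟨hq.2.1, by linarith [hq.2.2]⟩ hq.2.2.ne))
      (a := (θ₀, -s₀)) (b := (θ, s)) ⟨mem_univ _, by simpa using hs₀ε, by simpa using hs₀0⟩
      ⟨mem_univ _, hs⟩
      (neg_pos.2 ((hball (by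
        rw [Real.dist_eq, sub_zero, abs_neg, abs_of_pos hs₀0]; exact hs₀r)).2 (by linarith)))
    exact neg_pos.1 this

/-- Turning an annulus around. -/
lemma IsAnnulus.flip {φ : ℝ → ℝ → Surf} {C : Set Surf} (hφ : IsAnnulus φ C) :
    IsAnnulus (fun θ s => φ (-θ) (-s)) C := by
  have hneg : ∀ s ∈ Ioo (-1 : ℝ) 1, -s ∈ Ioo (-1 : ℝ) 1 := fun s hs =>
    ⟨by linarith [hs.2], by linarith [hs.1]⟩
  refine ⟨?_, ?_, ?_, ?_⟩
  · exact hφ.smooth.comp (g := fun q : ℝ × ℝ => (φ q.1 q.2 : R3))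
      (f := fun q : ℝ × ℝ => (-q.1, -q.2)) (by fun_prop) fun q hq => ⟨mem_univ _, hneg _ hq.2⟩
  · intro θ θ' s hs s' hs'
    rw [hφ.inj _ _ _ (hneg s hs) _ (hneg s' hs'), neg_inj]
    refine and_congr_right fun _ => ⟨?_, ?_⟩
    · rintro ⟨n, hn⟩
      exact ⟨-n, by push_cast; linarith⟩
    · rintro ⟨n, hn⟩
      exact ⟨-n, by push_cast; linarith⟩
  · intro θ s hs
    have h := hφ.oriented (-θ) (-s) (hneg s hs)
    have e1 : deriv (fun b => (φ (-θ) (-b) : R3)) s = -deriv (fun b => (φ (-θ) b : R3)) (-s) :=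
      deriv_comp_neg (fun b => (φ (-θ) b : R3)) s
    have e2 : deriv (fun a => (φ (-a) (-s) : R3)) θ = -deriv (fun a => (φ a (-s) : R3)) (-θ) :=
      deriv_comp_neg (fun a => (φ a (-s) : R3)) θ
    rw [e1, e2]
    refine h.trans_eq ?_
    simp only [surfOrient, Matrix.det_fin_three, Matrix.of_apply, Matrix.cons_val',
      Matrix.cons_val, Pi.neg_apply]
    ring
  · rw [← hφ.core]
    ext q
    constructor
    · rintro ⟨θ, h⟩
      exact ⟨-θ, by simpa using h⟩
    · rintro ⟨θ, h⟩
      exact ⟨-θ, by simpa using h⟩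

/-- A Dehn twist about a curve of the chain is the twist of an annulus of which the positive side is
the one with positive coordinate, and whose core runs through the right vertex of the curve towards
the arc with positive other coordinate. If the given annulus has the wrong sides, it is turned
around; orientation then fixes the direction of the core. -/
lemma IsDehnTwist.exists_isSided {t : Surf ≃ₜ Surf} {i : Fin 5} (ht : IsDehnTwist t (chainCurve i)) :
    ∃ (φ : ℝ → ℝ → Surf) (f : ℝ → ℝ) (θ₀ ε : ℝ), IsAnnulus φ (chainCurve i) ∧ Continuous f ∧
      (∀ s ≤ -(1 / 2 : ℝ), f s = 0) ∧ (∀ s ≥ (1 / 2 : ℝ), f s = 1) ∧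
      (t : Surf → Surf) = IsAnnulus.twist φ f ∧ φ θ₀ 0 = vtx i.succ ∧
      IsSided φ (sideIdx i) ε ∧ 0 < deriv (fun a => (φ a 0 : R3)) θ₀ (arcIdx i) := by
  have main : ∀ (φ : ℝ → ℝ → Surf), IsAnnulus φ (chainCurve i) → ∃ θ₀, φ θ₀ 0 = vtx i.succ ∧
      0 < deriv (fun b => (φ θ₀ b : R3)) 0 (sideIdx i) *
        deriv (fun a => (φ a 0 : R3)) θ₀ (arcIdx i) := by
    intro φ hφ
    have hr : vtx i.succ ∈ chainCurve i := vtx_mem_chainCurve.2 (Or.inr rfl)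
    rw [← hφ.core] at hr
    obtain ⟨θ₀, hθ₀⟩ := hr
    refine ⟨θ₀, hθ₀, ?_⟩
    have hor := hφ.oriented θ₀ 0 (by simp)
    rw [show (φ θ₀ 0 : R3) = vtx i.succ from congrArg Subtype.val hθ₀] at hor
    refine mul_pos_of_surfOrient_pos hor ?_
    have hd := hφ.hasDerivAt_left θ₀ (s := 0) (by simp)
    rw [hd.deriv]
    have h1 := hasDerivAt_pi.1 hd (sideIdx i)
    have h2 : (fun a => (φ a 0 : R3) (sideIdx i)) = fun _ => 0 :=
      funext fun a => side_eq_zero (hφ.core ▸ ⟨a, rfl⟩)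
    rw [h2] at h1
    exact h1.unique (hasDerivAt_const _ _)
  obtain ⟨φ, f, hφ, hf, hf0, hf1, hon, hoff⟩ := ht
  have het := hφ.eq_twist hon hoff
  obtain ⟨θ₀, hθ₀, hpos⟩ := main φ hφ
  rcases pos_and_pos_or_neg_and_neg_of_mul_pos hpos with ⟨h1, h2⟩ | ⟨h1, h2⟩
  · obtain ⟨ε, hε⟩ := hφ.exists_isSided h1
    exact ⟨φ, f, θ₀, ε, hφ, hf.continuous, hf0, hf1, het, hθ₀, hε, h2⟩
  · have hφ' := hφ.flip
    have e1 : deriv (fun b => (φ (-(-θ₀)) (-b) : R3)) 0 = -deriv (fun b => (φ θ₀ b : R3)) 0 := by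
      rw [neg_neg]
      simpa using deriv_comp_neg (fun b => (φ θ₀ b : R3)) 0
    have e2 : deriv (fun a => (φ (-a) (-0) : R3)) (-θ₀) = -deriv (fun a => (φ a 0 : R3)) θ₀ := by
      simpa using deriv_comp_neg (fun a => (φ a 0 : R3)) (-θ₀)
    obtain ⟨ε, hε⟩ := hφ'.exists_isSided (θ₀ := -θ₀) (by
      rw [e1, Pi.neg_apply]
      linarith)
    -- turning by `1 - f` is turning by `-f`, as the annulus has period `1`
    refine ⟨_, fun s => 1 - f (-s), -θ₀, ε, hφ', by have := hf.continuous; fun_prop,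
      fun s hs => by simp [hf1 (-s) (by linarith)],
      fun s hs => by simp [hf0 (-s) (by linarith)],
      hφ'.eq_twist ?_ fun p hp => hoff p fun θ s hs h => ?_, ?_, hε, ?_⟩
    · intro θ s hs
      have hs' : -s ∈ Ioo (-1 : ℝ) 1 := ⟨by linarith [hs.2], by linarith [hs.1]⟩
      rw [hon _ _ hs', show -θ + f (-s) = -(θ + (1 - f (-s))) + ((1 : ℤ) : ℝ) by push_cast; ring,
        hφ.add_int _ _ hs']
    · exact hp (-θ) (-s) ⟨by linarith [hs.2], by linarith [hs.1]⟩ (by simpa using h)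
    · simpa using hθ₀
    · rw [e2, Pi.neg_apply]
      linarith

/-! ### The action of a twist on the labelling -/


/-- The linear ramp that rises from `0` to `1` on `[0, ε]`. -/
def ramp (ε s : ℝ) : ℝ := max 0 (min 1 (s / ε))

lemma continuous_ramp (ε : ℝ) : Continuous (ramp ε) := by unfold ramp; fun_prop

lemma ramp_of_nonpos {ε s : ℝ} (hε : 0 < ε) (hs : s ≤ 0) : ramp ε s = 0 :=
  max_eq_left ((min_le_right _ _).trans (div_nonpos_of_nonpos_of_nonneg hs hε.le))

lemma ramp_of_le {ε s : ℝ} (hε : 0 < ε) (hs : ε ≤ s) : ramp ε s = 1 := by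
  rw [ramp, min_eq_left ((one_le_div hε).2 hs), max_eq_right zero_le_one]

lemma ramp_le_one (ε s : ℝ) : ramp ε s ≤ 1 := max_le zero_le_one (min_le_left _ _)

/-- The turning functions of a homotopy of twists, from one that is supported on `0 < s` to one that
is supported on `s < 0`. -/
def sweep (ε l s : ℝ) : ℝ := max (ramp ε s) (l * ramp ε (s + ε))

lemma continuous_sweep (ε : ℝ) : Continuous fun x : I × ℝ => sweep ε x.1 x.2 := by
  have h := continuous_ramp ε
  unfold sweep
  fun_prop

lemma sweep_of_le_neg {ε l s : ℝ} (hε : 0 < ε) (hs : s ≤ -ε) : sweep ε l s = 0 := by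
  rw [sweep, ramp_of_nonpos hε (by linarith), ramp_of_nonpos hε (by linarith), mul_zero, max_self]

lemma sweep_of_ge {ε s : ℝ} (l : I) (hε : 0 < ε) (hs : ε ≤ s) : sweep ε l s = 1 := by
  rw [sweep, ramp_of_le hε hs, ramp_of_le hε (by linarith), mul_one, max_eq_left l.2.2]

lemma sweep_zero_of_nonpos {ε s : ℝ} (hε : 0 < ε) (hs : s ≤ 0) : sweep ε 0 s = 0 := by
  rw [sweep, ramp_of_nonpos hε hs, zero_mul, max_self]

lemma sweep_one_of_nonneg {ε s : ℝ} (hε : 0 < ε) (hs : 0 ≤ s) : sweep ε 1 s = 1 := by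
  rw [sweep, ramp_of_le hε (s := s + ε) (by linarith), mul_one, max_eq_right (ramp_le_one _ _)]

lemma sweep_at_zero {ε : ℝ} (l : I) (hε : 0 < ε) : sweep ε l 0 = l := by
  rw [sweep, ramp_of_nonpos hε le_rfl, ramp_of_le hε (by linarith), mul_one, max_eq_right l.2.1]

namespace IsSided

variable {φ : ℝ → ℝ → Surf} {C : Set Surf} {m : Fin 3} {ε : ℝ}

lemma continuous_twist_sweep (hφ : IsAnnulus φ C) (h : IsSided φ m ε) :
    Continuous fun x : I × Surf => IsAnnulus.twist φ (sweep ε x.1) x.2 :=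
  hφ.continuous_twist (c := fun x : I => sweep ε x) (continuous_sweep ε) (n := 1)
    (fun _ _ hs => sweep_of_le_neg h.eps_pos (by linarith [h.eps_le]))
    (fun l s hs => by simpa using sweep_of_ge l h.eps_pos (by linarith [h.eps_le]))

/-- The twist supported on the positive side of the annulus. -/
def posTwist (hφ : IsAnnulus φ C) (h : IsSided φ m ε) : C(Surf, Surf) :=
  ⟨IsAnnulus.twist φ (sweep ε 0), (continuous_twist_sweep hφ h).comp
    (f := fun q : Surf => ((0 : I), q)) (by fun_prop)⟩

lemma twist_sweep_zero (hφ : IsAnnulus φ C) (h : IsSided φ m ε) {q : Surf} (hq : q.1 m ≤ 0) :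
    IsAnnulus.twist φ (sweep ε 0) q = q := by
  by_cases hon : ∃ θ : ℝ, ∃ s ∈ Ioo (-1 : ℝ) 1, q = φ θ s
  · obtain ⟨θ, s, hs, rfl⟩ := hon
    rw [hφ.twist_apply _ _ hs]
    rcases le_or_gt s 0 with h1 | h1
    · rw [sweep_zero_of_nonpos h.eps_pos h1, add_zero]
    · rcases le_or_gt s ε with h2 | h2
      · exact absurd hq (not_le.2 (h.pos θ s ⟨h1, h2⟩))
      · have e := sweep_of_ge (0 : I) h.eps_pos h2.le
        rw [Icc.coe_zero] at e
        rw [e]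
        simpa using hφ.add_int θ 1 hs
  · push Not at hon
    exact IsAnnulus.twist_of_forall_ne hon

lemma twist_sweep_one (hφ : IsAnnulus φ C) (h : IsSided φ m ε) {q : Surf} (hq : 0 ≤ q.1 m) :
    IsAnnulus.twist φ (sweep ε 1) q = q := by
  by_cases hon : ∃ θ : ℝ, ∃ s ∈ Ioo (-1 : ℝ) 1, q = φ θ s
  · obtain ⟨θ, s, hs, rfl⟩ := hon
    rw [hφ.twist_apply _ _ hs]
    rcases le_or_gt 0 s with h1 | h1
    · rw [sweep_one_of_nonneg h.eps_pos h1]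
      simpa using hφ.add_int θ 1 hs
    · rcases le_or_gt (-ε) s with h2 | h2
      · exact absurd hq (not_le.2 (h.neg θ s ⟨h2, h1⟩))
      · rw [sweep_of_le_neg h.eps_pos h2.le, add_zero]
  · push Not at hon
    exact IsAnnulus.twist_of_forall_ne hon

/-- The track under the homotopy of twists of a point at which the coordinate vanishes. -/
def track (hφ : IsAnnulus φ C) (h : IsSided φ m ε) {q : Surf} (hq : q.1 m = 0) : Path q q where
  toFun l := IsAnnulus.twist φ (sweep ε l) q
  continuous_toFun := (continuous_twist_sweep hφ h).comp (continuous_id.prodMk continuous_const)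
  source' := by simpa using twist_sweep_zero hφ h hq.le
  target' := by simpa using twist_sweep_one hφ h hq.ge

lemma pathClass_track_of_notMem (hφ : IsAnnulus φ C) (h : IsSided φ m ε) {q : Surf}
    (hq : q.1 m = 0) (hC : q ∉ C) : pathClass (track hφ h hq) = 𝟙 _ := by
  have e : track hφ h hq = Path.refl q := by
    ext1
    funext l
    change IsAnnulus.twist φ (sweep ε l) q = q
    by_cases hon : ∃ θ : ℝ, ∃ s ∈ Ioo (-1 : ℝ) 1, q = φ θ s
    · obtain ⟨θ, s, hs, rfl⟩ := hon
      rw [hφ.twist_apply _ _ hs]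
      rcases lt_trichotomy s 0 with h1 | rfl | h1
      · rcases le_or_gt (-ε) s with h2 | h2
        · exact absurd hq (h.neg θ s ⟨h2, h1⟩).ne
        · rw [sweep_of_le_neg h.eps_pos h2.le, add_zero]
      · exact absurd (hφ.core ▸ ⟨θ, rfl⟩) hC
      · rcases le_or_gt s ε with h2 | h2
        · exact absurd hq (h.pos θ s ⟨h1, h2⟩).ne'
        · rw [sweep_of_ge l h.eps_pos h2.le]
          simpa using hφ.add_int θ 1 hs
    · push Not at hon
      exact IsAnnulus.twist_of_forall_ne hon
  rw [e, pathClass_refl]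

lemma track_apply (hφ : IsAnnulus φ C) (h : IsSided φ m ε) {q : Surf} (hq : q.1 m = 0) {θ : ℝ}
    (hθ : φ θ 0 = q) (l : I) : track hφ h hq l = φ (θ + l) 0 := by
  subst hθ
  change IsAnnulus.twist φ (sweep ε l) (φ θ 0) = _
  rw [hφ.twist_apply _ _ (by simp), sweep_at_zero l h.eps_pos]

lemma push_posTwist_of_nonpos (hφ : IsAnnulus φ C) (h : IsSided φ m ε) {a b : Surf}
    (ha : posTwist hφ h a = a) (hb : posTwist hφ h b = b) (γ : Path a b)
    (hγ : ∀ t, (γ t).1 m ≤ 0) : pushClass (posTwist hφ h) ha hb (pathClass γ) = pathClass γ := by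
  rw [pushClass_pathClass]
  congr 1
  ext1
  funext t
  exact twist_sweep_zero hφ h (hγ t)

/-- On the positive side of the plane the twist is undone by the homotopy to the twist supported on
the negative side, which moves the end points along their tracks. -/
lemma push_posTwist_of_nonneg (hφ : IsAnnulus φ C) (h : IsSided φ m ε) {a b : Surf}
    (ha : posTwist hφ h a = a) (hb : posTwist hφ h b = b) (ha0 : a.1 m = 0) (hb0 : b.1 m = 0)
    (γ : Path a b) (hγ : ∀ t, 0 ≤ (γ t).1 m) :
    pushClass (posTwist hφ h) ha hb (pathClass γ) ≫ pathClass (track hφ h hb0) =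
      pathClass (track hφ h ha0) ≫ pathClass γ := by
  rw [pushClass_pathClass]
  exact pathClass_homotopy _ (continuous_twist_sweep hφ h) γ _ _ _ _
    (fun t => rfl) (fun t => by simpa using twist_sweep_one hφ h (hγ t))
    (fun s => rfl) (fun s => rfl)

end IsSided

/-- Subdivision of the image of an interval. -/
lemma pathClass_arc_trans {X : Type*} [TopologicalSpace X] (f : C(ℝ, X)) {u v w : ℝ} {a b c : X}
    (γ : Path a c) (γ₁ : Path a b) (γ₂ : Path b c)
    (h : ∀ t : I, γ t = f (AffineMap.lineMap u w (t : ℝ)))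
    (h₁ : ∀ t : I, γ₁ t = f (AffineMap.lineMap u v (t : ℝ)))
    (h₂ : ∀ t : I, γ₂ t = f (AffineMap.lineMap v w (t : ℝ))) :
    pathClass γ = pathClass γ₁ ≫ pathClass γ₂ := by
  obtain rfl : a = f u := by simpa using h 0
  obtain rfl : c = f w := by simpa using h 1
  obtain rfl : b = f v := by simpa using h₂ 0
  let line : ∀ x y : ℝ, Path x y := fun x y =>
    { toFun := fun t => AffineMap.lineMap x y (t : ℝ)
      continuous_toFun := (AffineMap.lineMap_continuous (R := ℝ)).comp continuous_subtype_val
      source' := by simp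
      target' := by simp }
  have e : γ = (line u w).map f.continuous := by ext1; funext t; exact h t
  have e₁ : γ₁ = (line u v).map f.continuous := by ext1; funext t; exact h₁ t
  have e₂ : γ₂ = (line v w).map f.continuous := by ext1; funext t; exact h₂ t
  rw [e, e₁, e₂, pathClass_map_eq_simpClass, pathClass_map_eq_simpClass,
    pathClass_map_eq_simpClass, simpClass_comp]

lemma side_vtx (i : Fin 5) (k : Fin 6) : (vtx k).1 (sideIdx i) = 0 := by
  fin_cases i <;> rfl

lemma arc_vtx (i : Fin 5) (k : Fin 6) : (vtx k).1 (arcIdx i) = 0 := by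
  fin_cases i <;> rfl

/-- The core of an annulus around a curve of the chain runs from the right vertex to the left one on
the positive side of the other coordinate, and returns on the negative side. -/
lemma pathClass_track_core {φ : ℝ → ℝ → Surf} {i : Fin 5} {ε θ₀ : ℝ}
    (hφ : IsAnnulus φ (chainCurve i)) (h : IsSided φ (sideIdx i) ε) (hθ₀ : φ θ₀ 0 = vtx i.succ)
    (hd : 0 < deriv (fun a => (φ a 0 : R3)) θ₀ (arcIdx i)) :
    pathClass (h.track hφ (side_vtx i i.succ)) =
        vtxClass true true i.succ i.castSucc ≫
          vtxClass (IsLabelling.backFace i).1 (IsLabelling.backFace i).2 i.castSucc i.succ ∧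
      pathClass (h.track hφ (side_vtx i i.castSucc)) =
        vtxClass (IsLabelling.backFace i).1 (IsLabelling.backFace i).2 i.castSucc i.succ ≫
          vtxClass true true i.succ i.castSucc := by
  have hs0 : (0 : ℝ) ∈ Ioo (-1 : ℝ) 1 := by simp
  have hmem : ∀ θ, φ θ 0 ∈ chainCurve i := fun θ => hφ.core ▸ ⟨θ, rfl⟩
  have hper : ∀ θ, φ (θ + 1) 0 = φ θ 0 := fun θ => by simpa using hφ.add_int θ 1 hs0
  let f : C(ℝ, Surf) := ⟨fun θ => φ θ 0, hφ.continuousOn.comp_continuous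
    (f := fun θ : ℝ => (θ, (0 : ℝ))) (by fun_prop) fun θ => ⟨mem_univ _, hs0⟩⟩
  have hne : vtx i.castSucc ≠ vtx i.succ := fun e => by
    have hx : ∀ i : Fin 5, vtxX i.castSucc ≠ vtxX i.succ := by
      intro i
      fin_cases i
      exacts [(by norm_num : (-3 : ℝ) ≠ -2), (by norm_num : (-2 : ℝ) ≠ -1),
        (by norm_num : (-1 : ℝ) ≠ 1), (by norm_num : (1 : ℝ) ≠ 2), (by norm_num : (2 : ℝ) ≠ 3)]
    exact hx i (congrArg (fun q : Surf => q.1 0) e)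
  -- the parameter of the left vertex in the period that begins at the right vertex
  obtain ⟨θ₁, hθ₁, h01, h12⟩ : ∃ θ₁, φ θ₁ 0 = vtx i.castSucc ∧ θ₀ < θ₁ ∧ θ₁ < θ₀ + 1 := by
    have hl : vtx i.castSucc ∈ chainCurve i := vtx_mem_chainCurve.2 (Or.inl rfl)
    rw [← hφ.core] at hl
    obtain ⟨θ, hθ⟩ := hl
    have hθ' : φ (θ₀ + Int.fract (θ - θ₀)) 0 = vtx i.castSucc := by
      rw [← hθ, ← hφ.add_int _ ⌊θ - θ₀⌋ hs0, add_assoc, Int.fract_add_floor]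
      simp
    refine ⟨_, hθ', ?_, by linarith [Int.fract_lt_one (θ - θ₀)]⟩
    refine lt_add_of_pos_right _ ((Int.fract_nonneg _).lt_of_ne fun e => hne ?_)
    rw [← hθ', ← e, add_zero, hθ₀]
  have hzero : ∀ θ, (φ θ 0).1 (arcIdx i) = 0 → θ₀ ≤ θ → θ ≤ θ₀ + 1 → θ = θ₀ ∨ θ = θ₁ ∨
      θ = θ₀ + 1 := by
    intro θ h0 h1 h2
    rcases eq_vtx_of_arc_eq_zero (hmem θ) h0 with e | e
    · obtain ⟨-, n, hn⟩ := (hφ.inj _ _ 0 hs0 0 hs0).1 (e.trans hθ₁.symm)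
      have n0 : n = 0 := by
        have hn1 : (-1 : ℝ) < n := by linarith
        have hn2 : (n : ℝ) < 1 := by linarith
        have : -1 < n := by exact_mod_cast hn1
        have : n < 1 := by exact_mod_cast hn2
        omega
      rw [n0] at hn
      exact Or.inr (Or.inl (by simpa using hn.symm))
    · obtain ⟨-, n, hn⟩ := (hφ.inj _ _ 0 hs0 0 hs0).1 (hθ₀.trans e.symm)
      have n0 : n = 0 ∨ n = 1 := by
        have hn1 : (0 : ℝ) ≤ n := by linarith
        have hn2 : (n : ℝ) ≤ 1 := by linarith
        have : 0 ≤ n := by exact_mod_cast hn1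
        have : n ≤ 1 := by exact_mod_cast hn2
        omega
      rcases n0 with rfl | rfl
      · exact Or.inl (by simpa using hn)
      · exact Or.inr (Or.inr (by simpa using hn))
  have hcont : Continuous fun θ => (f θ).1 (arcIdx i) := (Surf.continuous_coord _).comp f.continuous
  have hdi := hasDerivAt_pi.1 (hφ.hasDerivAt_left θ₀ hs0) (arcIdx i)
  rw [(hφ.hasDerivAt_left θ₀ hs0).deriv] at hd
  obtain ⟨r, hr, hball⟩ := Metric.eventually_nhds_iff.1
    (sign_of_hasDerivAt_pos hdi hd (by rw [hθ₀]; exact arc_vtx i _))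
  have hpos : ∀ θ, θ₀ ≤ θ → θ ≤ θ₁ → 0 ≤ (φ θ 0).1 (arcIdx i) := by
    intro θ h1 h2
    rcases h1.eq_or_lt with rfl | h1
    · rw [hθ₀, arc_vtx]
    rcases h2.eq_or_lt with rfl | h2
    · rw [hθ₁, arc_vtx]
    set θ' := θ₀ + min (r / 2) ((θ₁ - θ₀) / 2) with hθ'
    have a1 : 0 < min (r / 2) ((θ₁ - θ₀) / 2) := lt_min (by linarith) (by linarith)
    have a2 := min_le_left (r / 2) ((θ₁ - θ₀) / 2)
    have a3 := min_le_right (r / 2) ((θ₁ - θ₀) / 2)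
    refine (pos_of_isPreconnected (isPreconnected_Ioo (a := θ₀) (b := θ₁)) hcont.continuousOn
      (fun x hx h0 => ?_) (a := θ') ⟨by linarith, by linarith⟩ ⟨h1, h2⟩
      ((hball (y := θ') ?_).1 (by linarith))).le
    · rcases hzero x h0 hx.1.le (by linarith [hx.2]) with e | e | e <;> linarith [hx.1, hx.2]
    · rw [Real.dist_eq, hθ', add_sub_cancel_left, abs_of_pos a1]
      linarith
  have hneg : ∀ θ, θ₁ ≤ θ → θ ≤ θ₀ + 1 → (φ θ 0).1 (arcIdx i) ≤ 0 := by
    intro θ h1 h2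
    rcases h1.eq_or_lt with rfl | h1
    · rw [hθ₁, arc_vtx]
    rcases h2.eq_or_lt with rfl | h2
    · rw [hper, hθ₀, arc_vtx]
    set θ' := θ₀ - min (r / 2) ((θ₀ + 1 - θ₁) / 2) with hθ'
    have a1 : 0 < min (r / 2) ((θ₀ + 1 - θ₁) / 2) := lt_min (by linarith) (by linarith)
    have a2 := min_le_left (r / 2) ((θ₀ + 1 - θ₁) / 2)
    have a3 := min_le_right (r / 2) ((θ₀ + 1 - θ₁) / 2)
    have hb := (hball (y := θ') (by
      rw [Real.dist_eq, hθ', sub_sub_cancel_left, abs_neg, abs_of_pos a1]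
      linarith)).2 (by linarith)
    have := pos_of_isPreconnected (isPreconnected_Ioo (a := θ₁) (b := θ₀ + 1))
      (g := fun θ => -(f θ).1 (arcIdx i)) hcont.neg.continuousOn
      (fun x hx h0 => ?_) (a := θ' + 1) (b := θ) ⟨by linarith, by linarith⟩ ⟨h1, h2⟩ (by
        refine neg_pos.2 ?_
        change (φ (θ' + 1) 0).1 (arcIdx i) < 0
        rw [hper]
        exact hb)
    · exact (neg_pos.1 this).le
    · rcases hzero x (neg_eq_zero.1 h0) (by linarith [hx.1]) hx.2.le with e | e | e <;>
        linarith [hx.1, hx.2]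
  -- the arcs of the core
  have mkPath : ∀ {u w : ℝ} {a b : Surf}, f u = a → f w = b →
      ∃ γ : Path a b, ∀ t : I, γ t = f (AffineMap.lineMap u w (t : ℝ)) := by
    rintro u w a b rfl rfl
    exact ⟨⟨⟨fun t => f (AffineMap.lineMap u w (t : ℝ)), f.continuous.comp
      ((AffineMap.lineMap_continuous (R := ℝ)).comp continuous_subtype_val)⟩, by simp, by simp⟩,
      fun t => rfl⟩
  have hline : ∀ {u w : ℝ}, u ≤ w → ∀ t : I, u ≤ AffineMap.lineMap u w (t : ℝ) ∧
      AffineMap.lineMap u w (t : ℝ) ≤ w := by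
    intro u w huw t
    obtain ⟨t, h0, h1⟩ := t
    rw [AffineMap.lineMap_apply_ring]
    constructor <;> nlinarith
  have hθ₀' : f (θ₀ + 1) = vtx i.succ := (hper θ₀).trans hθ₀
  have hθ₁' : f (θ₁ + 1) = vtx i.castSucc := (hper θ₁).trans hθ₁
  obtain ⟨A, hA⟩ := mkPath (u := θ₀) (w := θ₁) hθ₀ hθ₁
  obtain ⟨B, hB⟩ := mkPath (u := θ₁) (w := θ₀ + 1) hθ₁ hθ₀'
  obtain ⟨A', hA'⟩ := mkPath (u := θ₀ + 1) (w := θ₁ + 1) hθ₀' hθ₁'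
  have cA : pathClass A = vtxClass true true i.succ i.castSucc :=
    pathClass_eq_faceClass A fun t => by
      rw [hA]
      exact mem_face_of_arc_nonneg (side_eq_zero (hmem _))
        (hpos _ (hline h01.le t).1 (hline h01.le t).2)
  have cB : pathClass B =
      vtxClass (IsLabelling.backFace i).1 (IsLabelling.backFace i).2 i.castSucc i.succ :=
    pathClass_eq_faceClass B fun t => by
      rw [hB]
      exact mem_face_of_arc_nonpos (side_eq_zero (hmem _))
        (hneg _ (hline h12.le t).1 (hline h12.le t).2)
  have eA : A' = A := by
    ext1
    funext t
    rw [hA, hA']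
    refine Eq.trans ?_ (hper _)
    change φ _ 0 = φ _ 0
    congr 1
    simp only [AffineMap.lineMap_apply_ring]
    ring
  rw [← cA, ← cB]
  refine ⟨pathClass_arc_trans f (u := θ₀) (v := θ₁) (w := θ₀ + 1) _ _ _ (fun t => ?_) hA hB, ?_⟩
  · rw [h.track_apply hφ _ hθ₀]
    congr 1
    simp only [AffineMap.lineMap_apply_ring]
    ring
  · refine pathClass_arc_trans f (u := θ₁) (v := θ₀ + 1) (w := θ₁ + 1) _ _ _ (fun t => ?_) hB
      (eA ▸ hA')
    rw [h.track_apply hφ _ hθ₁]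
    congr 1
    simp only [AffineMap.lineMap_apply_ring]
    ring

/-- The endomorphism of the fundamental group that is induced by a map which fixes the base point. -/
def pushHom {X : Type*} [TopologicalSpace X] (T : C(X, X)) {a : X} (h : T a = a) :
    FundamentalGroup X a →* FundamentalGroup X a where
  toFun x := pushClass T h h x
  map_one' := pushClass_id T h
  map_mul' x y := pushClass_comp T h h h y x

section Action

variable {φ : ℝ → ℝ → Surf} {i : Fin 5} {ε θ₀ : ℝ}

lemma IsSided.posTwist_vtx (hφ : IsAnnulus φ (chainCurve i)) (h : IsSided φ (sideIdx i) ε)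
    (k : Fin 6) : h.posTwist hφ (vtx k) = vtx k :=
  h.twist_sweep_zero hφ (side_vtx i k).le

/-- The class of the track of a vertex. -/
def IsSided.trackClass (hφ : IsAnnulus φ (chainCurve i)) (h : IsSided φ (sideIdx i) ε) (k : Fin 6) :
    FundamentalGroupoid.mk (vtx k) ⟶ FundamentalGroupoid.mk (vtx k) :=
  pathClass (h.track hφ (side_vtx i k))

lemma IsSided.push_vtxClass_pos (hφ : IsAnnulus φ (chainCurve i)) (h : IsSided φ (sideIdx i) ε)
    {ε' δ' : Bool} (hf : IsLabelling.posFace i ε' δ' = true) (j k : Fin 6) :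
    pushClass (h.posTwist hφ) (h.posTwist_vtx hφ j) (h.posTwist_vtx hφ k) (vtxClass ε' δ' j k) ≫
      h.trackClass hφ k = h.trackClass hφ j ≫ vtxClass ε' δ' j k := by
  obtain ⟨γ, hγ, e⟩ := exists_path_faceClass (vtx_mem_face j ε' δ') (vtx_mem_face k ε' δ')
  rw [vtxClass, ← e]
  exact h.push_posTwist_of_nonneg hφ _ _ (side_vtx i j) (side_vtx i k) γ
    fun t => nonneg_of_posFace hf (hγ t)

lemma IsSided.push_vtxClass_neg (hφ : IsAnnulus φ (chainCurve i)) (h : IsSided φ (sideIdx i) ε)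
    {ε' δ' : Bool} (hf : IsLabelling.posFace i ε' δ' = false) (j k : Fin 6) :
    pushClass (h.posTwist hφ) (h.posTwist_vtx hφ j) (h.posTwist_vtx hφ k) (vtxClass ε' δ' j k) =
      vtxClass ε' δ' j k := by
  obtain ⟨γ, hγ, e⟩ := exists_path_faceClass (vtx_mem_face j ε' δ') (vtx_mem_face k ε' δ')
  rw [vtxClass, ← e]
  exact h.push_posTwist_of_nonpos hφ _ _ γ fun t => nonpos_of_posFace hf (hγ t)

/-- The track of a vertex, joined to the base point in the front face, is the label of the curve if
the vertex lies on the curve. -/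
lemma IsSided.trackClass_conj (hφ : IsAnnulus φ (chainCurve i)) (h : IsSided φ (sideIdx i) ε)
    (hθ₀ : φ θ₀ 0 = vtx i.succ) (hd : 0 < deriv (fun a => (φ a 0 : R3)) θ₀ (arcIdx i)) (k : Fin 6) :
    (vtxClass true true 0 k ≫ h.trackClass hφ k ≫ vtxClass true true k 0 :
      FundamentalGroup Surf (vtx 0)) =
      if k = i.castSucc ∨ k = i.succ then IsLabelling.core loopLabel i else 1 := by
  obtain ⟨h1, h2⟩ := pathClass_track_core hφ h hθ₀ hd
  rw [IsLabelling.core, loopLabel_mul_inv]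
  split_ifs with hk
  · rcases hk with rfl | rfl
    · rw [IsSided.trackClass, h2]
      simp
    · rw [IsSided.trackClass, h1]
      simp
  · have e : h.trackClass hφ k = 𝟙 _ :=
      h.pathClass_track_of_notMem hφ _ fun hC => hk (vtx_mem_chainCurve.1 hC)
    rw [e, Category.id_comp, vtxClass_comp, vtxClass_self]
    rfl

/-- The twist supported on the positive side changes the labelling in the way that is required by
`IsLabelling.quad_twist`. -/
lemma IsSided.exists_pushHom_quad (hφ : IsAnnulus φ (chainCurve i)) (h : IsSided φ (sideIdx i) ε)
    (hθ₀ : φ θ₀ 0 = vtx i.succ) (hd : 0 < deriv (fun a => (φ a 0 : R3)) θ₀ (arcIdx i)) :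
    ∃ g, ∀ j, pushHom (h.posTwist hφ) (h.posTwist_vtx hφ 0) (IsLabelling.quad loopLabel j) =
      g * twistMove (IsLabelling.quad loopLabel) i j * g⁻¹ := by
  let c : FundamentalGroup Surf (vtx 0) := h.trackClass hφ 0
  refine isLabelling_loopLabel.quad_twist _ i c ?_ ?_ ?_
  · have e := h.trackClass_conj hφ hθ₀ hd 0
    rw [vtxClass_self, Category.comp_id, Category.id_comp] at e
    have hi : ∀ i : Fin 5, ((0 : Fin 6) = i.castSucc ∨ (0 : Fin 6) = i.succ) ↔ i = 0 := by decide
    exact e.trans (if_congr (hi i) rfl rfl)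
  · intro k ε' δ' hf
    rw [mul_assoc, eq_inv_mul_iff_mul_eq]
    have e1 := h.push_vtxClass_pos hφ hf 0 k
    have e2 := h.push_vtxClass_pos hφ (IsLabelling.posFace_true i) k 0
    have e : pushClass (h.posTwist hφ) (h.posTwist_vtx hφ 0) (h.posTwist_vtx hφ 0)
        (vtxClass ε' δ' 0 k ≫ vtxClass true true k 0) ≫ h.trackClass hφ 0 =
        h.trackClass hφ 0 ≫ vtxClass ε' δ' 0 k ≫ vtxClass true true k 0 := by
      rw [pushClass_comp _ _ (h.posTwist_vtx hφ k), Category.assoc, e2, ← Category.assoc, e1,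
        Category.assoc]
    exact e
  · intro k ε' δ' hf
    rw [mul_assoc, eq_inv_mul_iff_mul_eq, ← h.trackClass_conj hφ hθ₀ hd k]
    have e2 := h.push_vtxClass_pos hφ (IsLabelling.posFace_true i) k 0
    have e : pushClass (h.posTwist hφ) (h.posTwist_vtx hφ 0) (h.posTwist_vtx hφ 0)
        (vtxClass ε' δ' 0 k ≫ vtxClass true true k 0) ≫ h.trackClass hφ 0 =
        (vtxClass ε' δ' 0 k ≫ vtxClass true true k 0) ≫
          vtxClass true true 0 k ≫ h.trackClass hφ k ≫ vtxClass true true k 0 := by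
      rw [pushClass_comp _ _ (h.posTwist_vtx hφ k), Category.assoc, e2,
        h.push_vtxClass_neg hφ hf]
      simp
    exact e

end Action

/-- A Dehn twist acts on the loops at the base vertex, up to the change of base point along some
path, by the substitution. -/
lemma IsDehnTwist.exists_action {t : Surf ≃ₜ Surf} {i : Fin 5} (ht : IsDehnTwist t (chainCurve i)) :
    ∃ (T : FundamentalGroup Surf (vtx 0) →* FundamentalGroup Surf (vtx 0))
      (δ : Path (vtx 0) (t (vtx 0))),
      (∀ x : FundamentalGroup Surf (vtx 0), (T x : _ ⟶ _) ≫ pathClass δ =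
        pathClass δ ≫ pushClass (t : C(Surf, Surf)) rfl rfl x) ∧
      ∃ g, ∀ j, T (IsLabelling.quad loopLabel j) =
        g * twistMove (IsLabelling.quad loopLabel) i j * g⁻¹ := by
  obtain ⟨φ, f, θ₀, ε, hφ, hf, hf0, hf1, het, hθ₀, h, hd⟩ := ht.exists_isSided
  -- the given twist and the one supported on the positive side are homotopic by a convex combination
  -- of the turning functions
  let c : I → ℝ → ℝ := fun l s => (1 - l) * f s + l * sweep ε 0 s
  have hsweep : Continuous (sweep ε 0) :=
    (continuous_sweep ε).comp (f := fun s : ℝ => ((0 : I), s)) (by fun_prop)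
  have hcont : Continuous fun x : I × Surf => IsAnnulus.twist φ (c x.1) x.2 := by
    refine hφ.continuous_twist (n := 1) (by fun_prop) ?_ ?_
    · intro l s hs
      simp only [c]
      rw [hf0 s hs, sweep_of_le_neg h.eps_pos (by linarith [h.eps_le]), mul_zero, mul_zero, add_zero]
    · intro l s hs
      have e := sweep_of_ge (0 : I) h.eps_pos (s := s) (by linarith [h.eps_le])
      rw [Icc.coe_zero] at e
      simp only [c]
      rw [hf1 s hs, e]
      push_cast
      ring
  have hc0 : c 0 = f := by funext s; simp [c]
  have hc1 : c 1 = sweep ε 0 := by funext s; simp [c]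
  let δ : Path (t (vtx 0)) (vtx 0) :=
    { toFun := fun l => IsAnnulus.twist φ (c l) (vtx 0)
      continuous_toFun := hcont.comp (continuous_id.prodMk continuous_const)
      source' := by rw [hc0, het]
      target' := by rw [hc1]; exact h.posTwist_vtx hφ 0 }
  refine ⟨pushHom (h.posTwist hφ) (h.posTwist_vtx hφ 0), δ.symm, fun x => ?_,
    h.exists_pushHom_quad hφ hθ₀ hd⟩
  obtain ⟨γ, rfl⟩ := exists_pathClass_eq (X := Surf) x
  have e := pathClass_homotopy (fun x : I × Surf => IsAnnulus.twist φ (c x.1) x.2) hcont γ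
    (γ.map (t : C(Surf, Surf)).continuous)
    ((γ.map (h.posTwist hφ).continuous).cast (h.posTwist_vtx hφ 0).symm
      (h.posTwist_vtx hφ 0).symm) δ δ
    (fun s => by simp only [hc0]; rw [← het]; rfl) (fun s => by simp only [hc1]; rfl)
    (fun _ => rfl) (fun _ => rfl)
  rw [pathClass_symm]
  have e' : pathClass δ ≫ pushHom (h.posTwist hφ) (h.posTwist_vtx hφ 0) (pathClass γ) =
      pushClass (t : C(Surf, Surf)) rfl rfl (pathClass γ) ≫ pathClass δ := e.symm
  rw [← cancel_epi (pathClass δ), ← Category.assoc, e', ← Category.assoc, Category.assoc]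
  simp

/-! ### The action of the mapping class group on the fundamental group -/

section ChangeOfBasePoint

open FundamentalGroup

variable {X : Type*} [TopologicalSpace X]

lemma fundamentalGroupMulEquivOfPath_apply {a b : X} (δ : Path a b) (x : FundamentalGroup X a) :
    fundamentalGroupMulEquivOfPath δ x = Groupoid.inv (pathClass δ) ≫ x ≫ pathClass δ := rfl

lemma fundamentalGroupMulEquivOfPath_trans {a b c : X} (δ : Path a b) (η : Path b c)
    (x : FundamentalGroup X a) :
    fundamentalGroupMulEquivOfPath (δ.trans η) x =
      fundamentalGroupMulEquivOfPath η (fundamentalGroupMulEquivOfPath δ x) := by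
  simp only [fundamentalGroupMulEquivOfPath_apply, pathClass_trans, Groupoid.inv_eq_inv,
    IsIso.inv_comp, Category.assoc]

lemma fundamentalGroupMulEquivOfPath_symm {a b : X} (δ : Path a b) (x : FundamentalGroup X b) :
    fundamentalGroupMulEquivOfPath δ.symm x = (fundamentalGroupMulEquivOfPath δ).symm x := by
  rw [MulEquiv.eq_symm_apply]
  simp only [fundamentalGroupMulEquivOfPath_apply, pathClass_symm, Groupoid.inv_eq_inv,
    Category.assoc, IsIso.inv_inv, IsIso.inv_hom_id_assoc, IsIso.inv_hom_id]
  exact Category.comp_id x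

/-- Every inner automorphism is the change of base point along a loop. -/
lemma exists_loop_fundamentalGroupMulEquivOfPath_eq {a : X} (g : FundamentalGroup X a) :
    ∃ γ : Path a a, ∀ x, fundamentalGroupMulEquivOfPath γ x = g * x * g⁻¹ := by
  obtain ⟨γ, hγ⟩ := exists_pathClass_eq (X := X) g
  refine ⟨γ, fun x => ?_⟩
  rw [fundamentalGroupMulEquivOfPath_apply, ← hγ, mul_assoc]
  exact (Category.assoc _ _ _).symm

/-- The change of base point along a loop is an inner automorphism. -/
lemma exists_fundamentalGroupMulEquivOfPath_loop {a : X} (γ : Path a a) :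
    ∃ g : FundamentalGroup X a, ∀ x, fundamentalGroupMulEquivOfPath γ x = g * x * g⁻¹ := by
  refine ⟨pathClass γ, fun x => ?_⟩
  rw [fundamentalGroupMulEquivOfPath_apply, mul_assoc]
  exact (Category.assoc _ _ _).symm

lemma map_eq_pushClass {Y : Type*} [TopologicalSpace Y] (f : C(X, Y)) {a : X}
    (x : FundamentalGroup X a) : FundamentalGroup.map f a x = pushClass f rfl rfl x := by
  rw [pushClass, Path.Homotopic.Quotient.cast_rfl_rfl]
  rfl

lemma map_fundamentalGroupMulEquivOfPath {Y : Type*} [TopologicalSpace Y] (f : C(X, Y)) {a b : X}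
    (δ : Path a b) (x : FundamentalGroup X a) :
    FundamentalGroup.map f b (fundamentalGroupMulEquivOfPath δ x) =
      fundamentalGroupMulEquivOfPath (δ.map f.continuous) (FundamentalGroup.map f a x) := by
  simp only [map_eq_pushClass, fundamentalGroupMulEquivOfPath_apply]
  rw [pushClass_comp f rfl rfl rfl, pushClass_comp f rfl rfl rfl, pushClass_inv]
  rfl

lemma map_homeomorph_bijective (h : X ≃ₜ X) (a : X) :
    Function.Bijective (FundamentalGroup.map (h : C(X, X)) a) := by
  have key : ∀ (h : X ≃ₜ X) {a b : X} (hab : h a = b) (ha : h.symm b = a)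
      (x : FundamentalGroup X a), pushClass (h.symm : C(X, X)) ha ha
        (pushClass (h : C(X, X)) hab hab x) = x := by
    intro h a b hab ha x
    obtain ⟨γ, rfl⟩ := exists_pathClass_eq (X := X) x
    rw [pushClass_pathClass, pushClass_pathClass]
    congr 1
    ext t
    simp
  rw [show ⇑(FundamentalGroup.map (h : C(X, X)) a) = _ from
    funext (map_eq_pushClass (h : C(X, X)))]
  refine Function.bijective_iff_has_inverse.2
    ⟨fun x => pushClass (h.symm : C(X, X)) (h.symm_apply_apply a) (h.symm_apply_apply a) x,
      key h rfl _, fun x => key h.symm (h.symm_apply_apply a) rfl x⟩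

end ChangeOfBasePoint

section Induced

open FundamentalGroup

variable {Γ : Type*} [Group Γ] {p : Surf} {e : Γ ≃* FundamentalGroup Surf p}
  {h k : Surf ≃ₜ Surf} {φ ψ : MulAut Γ}

lemma exists_mulAut_of_path (e : Γ ≃* FundamentalGroup Surf p) (h : Surf ≃ₜ Surf)
    (δ : Path p (h p)) : ∃ φ : MulAut Γ, ∀ w, fundamentalGroupMulEquivOfPath δ (e (φ w)) =
      FundamentalGroup.map (h : C(Surf, Surf)) p (e w) := by
  let H := MulEquiv.ofBijective _ (map_homeomorph_bijective h p)
  exact ⟨e.trans (H.trans ((fundamentalGroupMulEquivOfPath δ).symm.trans e.symm)), fun w => by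
    simp [H]⟩

lemma Induces.mul (hφ : Induces e h φ) (hψ : Induces e k ψ) : Induces e (h * k) (φ * ψ) := by
  obtain ⟨δ, hδ⟩ := hφ
  obtain ⟨η, hη⟩ := hψ
  refine ⟨δ.trans (η.map h.continuous), fun w => ?_⟩
  have e1 : FundamentalGroup.map ((h * k : Surf ≃ₜ Surf) : C(Surf, Surf)) p (e w) =
      FundamentalGroup.map (h : C(Surf, Surf)) (k p)
        (FundamentalGroup.map (k : C(Surf, Surf)) p (e w)) := by
    obtain ⟨γ, hγ⟩ := exists_pathClass_eq (X := Surf) (e w)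
    rw [← hγ]
    rfl
  rw [e1, ← hη, map_fundamentalGroupMulEquivOfPath, ← hδ, ← fundamentalGroupMulEquivOfPath_trans]
  rfl

/-- The induced automorphism is unique up to inner automorphisms. -/
lemma Induces.mk_eq_mk (hφ : Induces e h φ) (hψ : Induces e h ψ) :
    (QuotientGroup.mk φ : OutAut Γ) = QuotientGroup.mk ψ := by
  obtain ⟨δ, hδ⟩ := hφ
  obtain ⟨η, hη⟩ := hψ
  obtain ⟨g, hg⟩ := exists_fundamentalGroupMulEquivOfPath_loop (δ.trans η.symm)
  have key : ψ = MulAut.conj (e.symm g) * φ := by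
    ext w
    apply e.injective
    have h1 : fundamentalGroupMulEquivOfPath (δ.trans η.symm) (e (φ w)) = e (ψ w) := by
      rw [fundamentalGroupMulEquivOfPath_trans, hδ, ← hη, fundamentalGroupMulEquivOfPath_symm,
        MulEquiv.symm_apply_apply]
    rw [← h1, hg]
    simp [MulAut.mul_apply]
  rw [eq_comm, key, QuotientGroup.mk_mul, (QuotientGroup.eq_one_iff _).2 (MonoidHom.mem_range.2 ⟨_, rfl⟩), one_mul]

/-- An automorphism of the same outer class is induced with the help of another path. -/
lemma Induces.of_mk_eq_mk (hφ : Induces e h φ)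
    (hψ : (QuotientGroup.mk φ : OutAut Γ) = QuotientGroup.mk ψ) : Induces e h ψ := by
  obtain ⟨δ, hδ⟩ := hφ
  obtain ⟨g, hg⟩ := QuotientGroup.eq.1 hψ.symm
  obtain ⟨γ, hγ⟩ := exists_loop_fundamentalGroupMulEquivOfPath_eq (e (ψ g))
  refine ⟨γ.trans δ, fun w => ?_⟩
  rw [fundamentalGroupMulEquivOfPath_trans, ← hδ, hγ]
  have e1 : φ = ψ * MulAut.conj g := by rw [hg, mul_inv_cancel_left]
  simp [e1, MulAut.mul_apply]

lemma IsSmoothFamily.continuous {Φ : I → Surf → Surf} (hΦ : IsSmoothFamily Φ) :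
    Continuous fun x : I × Surf => Φ x.1 x.2 := by
  rw [continuous_iff_continuousAt]
  rintro ⟨t, q⟩
  obtain ⟨U, H, hU, hm, hH, e⟩ := hΦ t q
  rw [IsInducing.subtypeVal.continuousAt_iff]
  have hc : Continuous fun x : I × Surf => ((x.1 : ℝ), (x.2 : R3)) := by fun_prop
  have hH' : ContinuousAt H ((t : ℝ), (q : R3)) := hH.continuousOn.continuousAt (hU.mem_nhds hm)
  refine (ContinuousAt.comp (x := (t, q)) (f := fun x : I × Surf => ((x.1 : ℝ), (x.2 : R3)))
    hH' hc.continuousAt).congr ?_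
  filter_upwards [hc.continuousAt.preimage_mem_nhds (hU.mem_nhds hm)] with x hx
  exact e x.1 x.2 hx

lemma induces_one_of_mem_diffZero (e : Γ ≃* FundamentalGroup Surf p) {h : DiffPlus}
    (hh : h ∈ DiffZero) : Induces e h 1 := by
  obtain ⟨Φ, h0, rfl, hs, -⟩ := hh
  have hc := hs.continuous
  let δ : Path p ((Φ 1 : Surf ≃ₜ Surf) p) :=
    { toFun := fun t => (Φ t : Surf ≃ₜ Surf) p
      continuous_toFun := hc.comp (continuous_id.prodMk continuous_const)
      source' := by simp [h0]
      target' := rfl }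
  refine ⟨δ, fun w => ?_⟩
  obtain ⟨γ, hγ⟩ := exists_pathClass_eq (X := Surf) (e w)
  have key := pathClass_homotopy _ hc γ γ (γ.map (Φ 1 : Surf ≃ₜ Surf).continuous) δ δ
    (fun t => by simp [h0]) (fun _ => rfl) (fun _ => rfl) (fun _ => rfl)
  rw [MulAut.one_apply, fundamentalGroupMulEquivOfPath_apply, ← hγ, key]
  simp only [Groupoid.inv_eq_inv, IsIso.inv_hom_id_assoc]
  rfl

/-- The homomorphism from the mapping class group to the group of outer automorphisms. -/
lemma exists_map2_hom (e : Γ ≃* FundamentalGroup Surf p)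
    (hp : ∀ q : Surf, Nonempty (Path p q)) :
    ∃ ρ : Map2 →* OutAut Γ, ∀ (h : DiffPlus) (φ : MulAut Γ),
      ρ (QuotientGroup.mk h) = QuotientGroup.mk φ ↔ Induces e h φ := by
  have hex : ∀ h : DiffPlus, ∃ φ : MulAut Γ, Induces e h φ := fun h =>
    let ⟨δ⟩ := hp ((h : Surf ≃ₜ Surf) p)
    let ⟨φ, hφ⟩ := exists_mulAut_of_path e h δ
    ⟨φ, δ, hφ⟩
  choose F hF using hex
  let R : DiffPlus →* OutAut Γ := MonoidHom.mk' (fun h => QuotientGroup.mk (F h)) fun h k =>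
    (hF (h * k)).mk_eq_mk ((hF h).mul (hF k))
  have hR : DiffZero ≤ R.ker := fun h hh =>
    MonoidHom.mem_ker.2 ((hF h).mk_eq_mk (induces_one_of_mem_diffZero e hh))
  exact ⟨QuotientGroup.lift DiffZero R hR, fun h φ =>
    ⟨fun H => (hF h).of_mk_eq_mk H, fun H => (hF h).mk_eq_mk H⟩⟩

/-- The induced automorphisms do not depend on the base point, if the identifications of `Γ` with
the fundamental groups correspond under a change of base point. -/
lemma Induces.change_base {q : Surf} (hφ : Induces e h φ) (d : Path p q) :
    Induces (e.trans (fundamentalGroupMulEquivOfPath d)) h φ := by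
  obtain ⟨δ, hδ⟩ := hφ
  refine ⟨d.symm.trans (δ.trans (d.map h.continuous)), fun w => ?_⟩
  simp only [MulEquiv.trans_apply, fundamentalGroupMulEquivOfPath_trans,
    fundamentalGroupMulEquivOfPath_symm, MulEquiv.symm_apply_apply, hδ]
  exact (map_fundamentalGroupMulEquivOfPath (h : C(Surf, Surf)) d (e w)).symm

end Induced

/-! ### The action of the Dehn twists -/

lemma map_twistMove {G H : Type*} [Group G] [Group H] (f : G →* H) (V : Fin 4 → G) (i : Fin 5)
    (j : Fin 4) : f (twistMove V i j) = twistMove (fun j => f (V j)) i j := by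
  fin_cases i <;> fin_cases j <;> simp [twistMove, twistElt]

lemma IsDehnTwist.exists_induces {t : Surf ≃ₜ Surf} {i : Fin 5} (ht : IsDehnTwist t (chainCurve i)) :
    ∃ φ : MulAut Gamma2, (∀ j, φ (gamma2Gen j) = twistMove gamma2Gen i j) ∧
      Induces gamma2EquivPi t φ := by
  obtain ⟨T, δ, hT, g, hg⟩ := ht.exists_action
  obtain ⟨φ, hφ⟩ := exists_mulAut_of_path gamma2EquivPi t δ
  have hφT : ∀ w, gamma2EquivPi (φ w) = T (gamma2EquivPi w) := fun w => by
    apply (FundamentalGroup.fundamentalGroupMulEquivOfPath δ).injective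
    rw [hφ, fundamentalGroupMulEquivOfPath_apply, hT, map_eq_pushClass]
    simp only [Groupoid.inv_eq_inv, IsIso.inv_hom_id_assoc]
  have hgen : ∀ j, gamma2EquivPi (gamma2Gen j) = IsLabelling.quad loopLabel j := gamma2ToPi_gen
  let c := gamma2EquivPi.symm g
  have hc : gamma2EquivPi c = g := gamma2EquivPi.apply_symm_apply g
  refine ⟨MulAut.conj c⁻¹ * φ, fun j => ?_, Induces.of_mk_eq_mk ⟨δ, hφ⟩ ?_⟩
  · apply gamma2EquivPi.injective
    have e2 : gamma2EquivPi (twistMove gamma2Gen i j) = twistMove (IsLabelling.quad loopLabel) i j :=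
      (map_twistMove gamma2EquivPi.toMonoidHom gamma2Gen i j).trans
        (congrArg (fun V => twistMove V i j) (funext hgen))
    rw [e2, MulAut.mul_apply, MulAut.conj_apply, map_mul, map_mul, inv_inv, map_inv, hc, hφT, hgen,
      hg]
    group
  · rw [QuotientGroup.mk_mul, (QuotientGroup.eq_one_iff _).2 (MonoidHom.mem_range.2 ⟨_, rfl⟩), one_mul]

end

theorem proposition5 (p : Surf) :
    -- the two expressions for `x`
    twistElt gamma2Gen =
      gamma2Gen 2 * (gamma2Gen 3)⁻¹ * (gamma2Gen 2)⁻¹ * gamma2Gen 1 ∧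
    -- an identification of `Γ(2 | -)` with the fundamental group, and the action of `Map₂`
    ∃ (e : Gamma2 ≃* FundamentalGroup Surf p) (ρ : Map2 →* OutAut Gamma2),
      (∀ (h : DiffPlus) (φ : MulAut Gamma2),
        ρ (QuotientGroup.mk h) = QuotientGroup.mk φ ↔ Induces e h φ) ∧
      ∀ i : Fin 5,
        -- Dehn twists about `γ i` exist,
        (∃ t : DiffPlus, IsDehnTwist t (chainCurve i)) ∧
        -- and each of them acts by the formula,
        ∀ t : DiffPlus, IsDehnTwist t (chainCurve i) →
          (∃ φ : MulAut Gamma2, (∀ j, φ (gamma2Gen j) = twistMove gamma2Gen i j) ∧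
            ρ (QuotientGroup.mk t) = QuotientGroup.mk φ) ∧
          -- also on the generating vectors of type `(2 | -)` of finite groups.
          ∀ (G : Type*) [Group G] [Finite G] (V : Fin 4 → G),
            IsGeneratingVector ![] ![V 0, V 2] ![V 1, V 3] ![] →
            ∃ θ : Gamma2 →* G, (∀ j, θ (gamma2Gen j) = V j) ∧
              ∀ φ : MulAut Gamma2, ρ (QuotientGroup.mk t) = QuotientGroup.mk φ →
                ∃ g : G, ∀ j, θ (φ (gamma2Gen j)) = g * twistMove V i j * g⁻¹ := by
  obtain ⟨d, -, -⟩ := exists_path_faceClass (vtx_mem_face 0 _ _) (exists_mem_face p)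
  have hp : ∀ q : Surf, Nonempty (Path p q) := fun q => by
    obtain ⟨d', -, -⟩ := exists_path_faceClass (vtx_mem_face 0 _ _) (exists_mem_face q)
    exact ⟨d.symm.trans d'⟩
  obtain ⟨ρ, hρ⟩ := exists_map2_hom
    (gamma2EquivPi.trans (FundamentalGroup.fundamentalGroupMulEquivOfPath d)) hp
  refine ⟨twistElt_eq gamma2Gen_relation, _, ρ, hρ, fun i =>
    ⟨exists_isDehnTwist_chainCurve i, fun t ht => ?_⟩⟩
  obtain ⟨φ, hφ, hind⟩ := ht.exists_induces
  have hρt := (hρ t φ).2 (hind.change_base d)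
  refine ⟨⟨φ, hφ, hρt⟩, fun G _ _ V hV => ?_⟩
  have hrel : ⁅V 0, V 1⁆ * ⁅V 2, V 3⁆ = 1 := by
    simpa [List.ofFn_succ] using hV.relation
  refine ⟨gamma2Hom V hrel, gamma2Hom_gen V hrel, fun ψ hψ => ?_⟩
  obtain ⟨g, hg⟩ := QuotientGroup.eq.1 (hρt.symm.trans hψ)
  have e : ψ = φ * MulAut.conj g := by rw [hg, mul_inv_cancel_left]
  refine ⟨gamma2Hom V hrel (φ g), fun j => ?_⟩
  rw [e, MulAut.mul_apply, MulAut.conj_apply, map_mul, map_mul, map_mul, map_mul, map_inv, map_inv,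
    hφ, map_twistMove]
  simp only [gamma2Hom_gen]
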